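/- Let $N\ge 1$, let $\mathcal D\subset\mathbb R^N$ be a bounded, convex, open set with smooth boundary and outward unit normal $n(x)$, let $1\le p<\infty$ and $X_p=L^p(\mathcal D\times\mathbb R^N,\mathrm dx\otimes\mathrm dv)$ (real- or complex-valued functions), let $0<\gamma<1$, and let $\Sigma:\mathbb R^N\to[0,\infty)$ be a measurable function with $\Sigma(-v)=\Sigma(v)$ for all $v$ (a space-homogeneous collision frequency). Put $$\Gamma_\pm=\{(x,v)\in\partial\mathcal D\times\mathbb R^N:\ \pm v\cdot n(x)\ge 0\},\qquad L^p_\pm=L^p\big(\Gamma_\pm;|v\cdot n(x)|\,\mathrm d\gamma(x)\otimes\mathrm dv\big),$$ where $\mathrm d\gamma(x)$ denotes the surface measure on $\partial\mathcal D$. Let $T$ be the streaming operator with bounce-back boundary conditions in $X_p$, $$T\psi(x,v)=-v\cdot\nabla_x\psi(x,v)-\Sigma(v)\psi(x,v),$$ whose domain consists of all $\psi\in X_p$ such that $v\cdot\nabla_x\psi\in X_p$ (in the sense of distributions) and $\Sigma\psi\in X_p$ (which is automatic if $\Sigma$ is bounded), whose traces $\psi_{|\Gamma_\pm}$ (limits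 along the characteristics $s\mapsto x+sv$) belong to $L^p_\pm$, and which satisfy $\psi_{|\Gamma_-}(x,v)=\gamma\,\psi_{|\Gamma_+}(x,-v)$ for a.e. $(x,v)\in\Gamma_-$. For $(x,v)\in\mathcal D\times\mathbb R^N$ with $v\neq0$ let $$t_\pm(x,v)=\inf\{s>0:\ x\pm sv\notin\mathcal D\},\qquad \tau(x,v)=t_-(x,v)+t_+(x,v),$$ $$\mathcal I_k(x,v)=[k\,\tau(x,v)+t_-(x,v),\,(k+1)\,\tau(x,v)+t_-(x,v)]\qquad(k=0,1,2,\dots).$$ Then $T$ generates a $C_0$-semigroup in $X_p$, and the $C_0$-semigroup $(U(t))_{t\ge0}$ generated by $T$ is given by $$U(t)=\sum_{n=0}^\infty U_n(t)\qquad\text{for all } t\ge 0,$$ where the series converges in operator norm and, for each $t\ge0$, the $U_n(t)$ are the bounded linear operators on $X_p$ given, for all $\varphi\in X_p$ and almost every $(x,v)\in\mathcal D\times\mathbb R^N$, by $$[U_0(t)\varphi](x,v)=\varphi(x-tv,v)\,e^{-\Sigma(v)t}\,\chi_{\{t<t_-(x,v)\}},$$ and, for every integer $n\ge0$, $$[U_{2n+1}(t)\varphi](x,v)=\gamma^{2n+1}e^{-\Sigma(v)t}\,\chi_{\mathcal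 I_{2n}(x,v)}(t)\,\varphi\big(x+tv-2t_-(x,v)v-2n\,\tau(x,v)v,\,-v\big),$$ $$[U_{2n+2}(t)\varphi](x,v)=\gamma^{2n+2}e^{-\Sigma(v)t}\,\chi_{\mathcal I_{2n+1}(x,v)}(t)\,\varphi\big(x-tv+(2n+2)\,\tau(x,v)v,\,v\big).$$ -/

import Mathlib

open MeasureTheory Filter Topology Set
open scoped ENNReal NNReal ContDiff

noncomputable section

namespace BounceBack

/-- The phase space `ℝ^N × ℝ^N` of pairs (position, velocity). -/
abbrev Phase (N : ℕ) : Type := EuclideanSpace ℝ (Fin N) × EuclideanSpace ℝ (Fin N)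

/-! ### Geometry of the spatial domain -/

/-- `ρ` is a smooth defining function of `D` near the boundary point `x`: near `x`, the set `D` is
`{ρ < 0}`, and the gradient of `ρ` does not vanish at `x`. -/
def IsDefiningFunctionAt {N : ℕ} (D : Set (EuclideanSpace ℝ (Fin N)))
    (x : EuclideanSpace ℝ (Fin N)) (ρ : EuclideanSpace ℝ (Fin N) → ℝ) : Prop :=
  ∃ W : Set (EuclideanSpace ℝ (Fin N)), IsOpen W ∧ x ∈ W ∧ ContDiffOn ℝ ∞ ρ W ∧
    ρ x = 0 ∧ gradient ρ x ≠ 0 ∧ ∀ y ∈ W, (y ∈ D ↔ ρ y < 0)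

/-- `D` has a smooth boundary. -/
def HasSmoothBoundary {N : ℕ} (D : Set (EuclideanSpace ℝ (Fin N))) : Prop :=
  ∀ x ∈ frontier D, ∃ ρ, IsDefiningFunctionAt D x ρ

open Classical in
/-- The outward unit normal `n(x)` at `x ∈ ∂D`, i.e. the normalised gradient of a local defining
function (it does not depend on the choice of that function). -/
def outwardNormal {N : ℕ} (D : Set (EuclideanSpace ℝ (Fin N))) (x : EuclideanSpace ℝ (Fin N)) :
    EuclideanSpace ℝ (Fin N) :=
  if h : ∃ ρ, IsDefiningFunctionAt D x ρ then
    ‖gradient h.choose x‖⁻¹ • gradient h.choose x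
  else 0

/-- The incoming part `Γ₋` of the boundary of the phase space. -/
def incoming {N : ℕ} (D : Set (EuclideanSpace ℝ (Fin N))) : Set (Phase N) :=
  {z | z.1 ∈ frontier D ∧ inner ℝ z.2 (outwardNormal D z.1) ≤ 0}

/-- The outgoing part `Γ₊` of the boundary of the phase space. -/
def outgoing {N : ℕ} (D : Set (EuclideanSpace ℝ (Fin N))) : Set (Phase N) :=
  {z | z.1 ∈ frontier D ∧ 0 ≤ inner ℝ z.2 (outwardNormal D z.1)}

/-- The measure `|v · n(x)| dγ(x) ⊗ dv` on `∂D × ℝ^N`, where `dγ` is the surface measure on `∂D`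
(the `(N-1)`-dimensional Euclidean Hausdorff measure). -/
def fluxMeasure {N : ℕ} (D : Set (EuclideanSpace ℝ (Fin N))) : Measure (Phase N) :=
  (((μHE[N - 1] : Measure (EuclideanSpace ℝ (Fin N))).restrict (frontier D)).prod
    (volume : Measure (EuclideanSpace ℝ (Fin N)))).withDensity
      (fun z => ENNReal.ofReal |inner ℝ z.2 (outwardNormal D z.1)|)

/-- The measure of `L^p_- = L^p(Γ₋; |v · n(x)| dγ(x) ⊗ dv)`. -/
def incomingMeasure {N : ℕ} (D : Set (EuclideanSpace ℝ (Fin N))) : Measure (Phase N) :=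
  (fluxMeasure D).restrict (incoming D)

/-- The measure of `L^p_+ = L^p(Γ₊; |v · n(x)| dγ(x) ⊗ dv)`. -/
def outgoingMeasure {N : ℕ} (D : Set (EuclideanSpace ℝ (Fin N))) : Measure (Phase N) :=
  (fluxMeasure D).restrict (outgoing D)

/-! ### The space `X_p`, the directional derivative and the traces -/

/-- Lebesgue measure `dx ⊗ dv` on `D × ℝ^N`. -/
def phaseMeasure {N : ℕ} (D : Set (EuclideanSpace ℝ (Fin N))) : Measure (Phase N) :=
  (volume : Measure (Phase N)).restrict (D ×ˢ univ)

/-- The space `X_p = L^p(D × ℝ^N, dx ⊗ dv)` of real- or complex-valued functions. -/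
abbrev X {N : ℕ} (𝕜 : Type*) [RCLike 𝕜] (p : ℝ≥0∞) (D : Set (EuclideanSpace ℝ (Fin N))) : Type _ :=
  Lp 𝕜 p (phaseMeasure D)

/-- `v · ∇ₓ ψ = g` in the sense of distributions on `D × ℝ^N`. -/
def HasWeakTransport {N : ℕ} {𝕜 : Type*} [RCLike 𝕜] (D : Set (EuclideanSpace ℝ (Fin N)))
    (ψ g : Phase N → 𝕜) : Prop :=
  ∀ φ : Phase N → ℝ, ContDiff ℝ ∞ φ → HasCompactSupport φ → tsupport φ ⊆ D ×ˢ univ →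
    ∫ z, fderiv ℝ φ z (z.2, 0) • ψ z ∂(phaseMeasure D) = - ∫ z, φ z • g z ∂(phaseMeasure D)

/-- `h` is the trace of `ψ` on `Γ₋`: some representative of `ψ` has, for almost every
`(x, v) ∈ Γ₋`, the limit `h (x, v)` at `(x, v)` along the characteristic that enters there. -/
def HasIncomingTrace {N : ℕ} {𝕜 : Type*} [RCLike 𝕜] (D : Set (EuclideanSpace ℝ (Fin N)))
    (ψ h : Phase N → 𝕜) : Prop :=
  ∃ ψ' : Phase N → 𝕜, ψ' =ᵐ[phaseMeasure D] ψ ∧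
    ∀ᵐ z ∂(incomingMeasure D),
      Tendsto (fun s : ℝ => ψ' (z.1 + s • z.2, z.2)) (𝓝[>] 0) (𝓝 (h z))

/-- `h` is the trace of `ψ` on `Γ₊`: some representative of `ψ` has, for almost every
`(x, v) ∈ Γ₊`, the limit `h (x, v)` at `(x, v)` along the characteristic that leaves there. -/
def HasOutgoingTrace {N : ℕ} {𝕜 : Type*} [RCLike 𝕜] (D : Set (EuclideanSpace ℝ (Fin N)))
    (ψ h : Phase N → 𝕜) : Prop :=
  ∃ ψ' : Phase N → 𝕜, ψ' =ᵐ[phaseMeasure D] ψ ∧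
    ∀ᵐ z ∂(outgoingMeasure D),
      Tendsto (fun s : ℝ => ψ' (z.1 - s • z.2, z.2)) (𝓝[>] 0) (𝓝 (h z))

/-- The graph of the streaming operator `T ψ = -v · ∇ₓ ψ - Σ ψ` in `X_p`. Its domain consists of
the `ψ ∈ X_p` with `v · ∇ₓ ψ ∈ X_p` (and `Σ ψ ∈ X_p`, which is automatic for bounded `Σ`) whose
traces belong to `L^p_±` and satisfy the bounce-back condition `ψ|Γ₋ (x, v) = γ ψ|Γ₊ (x, -v)`. -/
def streamingGraph {N : ℕ} (𝕜 : Type*) [RCLike 𝕜] (p : ℝ≥0∞) (D : Set (EuclideanSpace ℝ (Fin N)))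
    (S : Phase N → ℝ) (γ : ℝ) : Set (X 𝕜 p D × X 𝕜 p D) :=
  {a | (∃ g : X 𝕜 p D, HasWeakTransport D a.1 g ∧
        ∀ᵐ z ∂(phaseMeasure D), a.2 z = -g z - (S z : 𝕜) * a.1 z) ∧
      ∃ hIn hOut : Phase N → 𝕜,
        MemLp hIn p (incomingMeasure D) ∧ MemLp hOut p (outgoingMeasure D) ∧
        HasIncomingTrace D a.1 hIn ∧ HasOutgoingTrace D a.1 hOut ∧
        ∀ᵐ z ∂(incomingMeasure D), hIn z = (γ : 𝕜) * hOut (z.1, -z.2)}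

/-! ### Strongly continuous semigroups -/

/-- `U` is a `C₀`-semigroup of bounded operators on `Y`. -/
structure IsC0Semigroup {𝕜 Y : Type*} [RCLike 𝕜] [NormedAddCommGroup Y] [NormedSpace 𝕜 Y]
    (U : ℝ≥0 → Y →L[𝕜] Y) : Prop where
  zero : U 0 = ContinuousLinearMap.id 𝕜 Y
  add : ∀ s t, U (s + t) = (U s).comp (U t)
  continuousAt_zero : ∀ y, Tendsto (fun t => U t y) (𝓝 0) (𝓝 y)

/-- The graph of the infinitesimal generator of `U`: the pairs `(y, w)` with
`w = lim_{t → 0+} (U(t) y - y) / t`. -/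
def generatorGraph {𝕜 Y : Type*} [RCLike 𝕜] [NormedAddCommGroup Y] [NormedSpace 𝕜 Y]
    (U : ℝ≥0 → Y →L[𝕜] Y) : Set (Y × Y) :=
  {a | Tendsto (fun t : ℝ≥0 => (((t : ℝ) : 𝕜)⁻¹) • (U t a.1 - a.1)) (𝓝[>] 0) (𝓝 a.2)}

/-! ### Exit times and the terms of the series -/

/-- `t₋(x, v) = inf {s > 0 : x - s v ∉ D}`. For bounded `D` the set is non-empty unless `v = 0`
(velocities that form a null set if `N ≥ 1`). -/
def tMinus {N : ℕ} (D : Set (EuclideanSpace ℝ (Fin N))) (z : Phase N) : ℝ :=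
  sInf {s : ℝ | 0 < s ∧ z.1 - s • z.2 ∉ D}

/-- `t₊(x, v) = inf {s > 0 : x + s v ∉ D}`. -/
def tPlus {N : ℕ} (D : Set (EuclideanSpace ℝ (Fin N))) (z : Phase N) : ℝ :=
  sInf {s : ℝ | 0 < s ∧ z.1 + s • z.2 ∉ D}

/-- `τ(x, v) = t₋(x, v) + t₊(x, v)`. -/
def tau {N : ℕ} (D : Set (EuclideanSpace ℝ (Fin N))) (z : Phase N) : ℝ :=
  tMinus D z + tPlus D z

/-- The time interval `I_k(x, v) = [k τ(x, v) + t₋(x, v), (k + 1) τ(x, v) + t₋(x, v)]`. -/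
def reflectionInterval {N : ℕ} (D : Set (EuclideanSpace ℝ (Fin N))) (k : ℕ) (z : Phase N) :
    Set ℝ :=
  Icc (k * tau D z + tMinus D z) ((k + 1) * tau D z + tMinus D z)

open Classical in
/-- The function `U_n(t) φ` of the phase variable. For `n = k + 1` the velocity at which `φ` is
evaluated is reversed if `n` is odd (`k` even) and unchanged if `n` is even (`k` odd). -/
def seriesTerm {N : ℕ} {𝕜 : Type*} [RCLike 𝕜] (D : Set (EuclideanSpace ℝ (Fin N)))
    (σ : EuclideanSpace ℝ (Fin N) → ℝ) (γ t : ℝ) (φ : Phase N → 𝕜) : ℕ → Phase N → 𝕜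
  | 0, z =>
      if t < tMinus D z then
        (Real.exp (-(σ z.2 * t)) : 𝕜) * φ (z.1 - t • z.2, z.2)
      else 0
  | k + 1, z =>
      if t ∈ reflectionInterval D k z then
        ((γ ^ (k + 1) * Real.exp (-(σ z.2 * t)) : ℝ) : 𝕜) *
          (if Even k then
            φ (z.1 + t • z.2 - (2 * tMinus D z) • z.2 - (k * tau D z) • z.2, -z.2)
          else
            φ (z.1 - t • z.2 + ((k + 1) * tau D z) • z.2, z.2))
      else 0

end BounceBack

end

/-!
Along the line through `z = (x, v)` the domain is met in an interval, so `z` lies on one chord: it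
is `flow s b` for the pair `b` at which the characteristic enters and for `s = t₋(z) ∈ (0, τ(b))`
(`exists_entrance`). Transport with bounce-back boundary conditions only moves values along a
chord and back along the same chord with the opposite velocity; `turn b` is the entrance at the
other end. Unrolling these reflections turns each chord into a half-line `y < τ(b)`: the function
`unfold D γ f b` carries on it the values of `f` met in the past of the chord, with a factor `γ`
for each passage through the boundary, and the solution `evolve` is translation by `t` of this
coordinate, times `exp (-Σ t)`. The semigroup law is therefore the additivity of translations
(`evolve_evolve`, where `Σ` has to be even), and the `n`-th term of the series is the part of
`evolve` with exactly `n` reflections (`IsEntrance.seriesTerm_flow`), outside the null set of pairs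
whose backward trajectory is on the boundary at the time considered.

The measure `dx ⊗ dv` disintegrates into `ds` along the chords over a measure `chordMeasure` on the
entrances (`lintegral_chord`), which `turn` preserves (`measurePreserving_turn`). Hence the `n`-th
term does not increase the `L^p` norm by more than `γ ^ n` (`lintegral_place_le`, `exists_term`):
the series converges in operator norm, and its sum is a bounded `C₀`-semigroup
(`exists_semigroup`). All of this is independent of the boundary measure.

The flux measure `|v · n(x)| dγ(x) ⊗ dv` enters only through the traces. It is comparable to
`chordMeasure`, both from above and from below, up to the constant `fluxConst`
(`incomingMeasure_le`, `chordMeasure_absolutelyContinuous`): near an entrance the boundary is almost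
flat, so that the volume of the tube swept out in a short time `δ` over a boundary patch is
comparable to `δ |v · n|` times the area of the patch. The two measures are in fact equal, but the
comparison is enough, because the traces are only required to be in `L^p` and to satisfy a relation
almost everywhere.

The generator is identified through the resolvent `R` at `1`. A pair `(ψ, w)` is in the graph of the
generator if and only if `R (ψ - w) = ψ` (`IsC0Semigroup.mem_generatorGraph_iff`). Computed
pointwise, `R f` is on each chord the average of the unfolded function with the weight
`exp (-(1 + Σ) t)` (`resolvent_ae`). It solves `w' + (1 + Σ) w = f` along the chord, satisfies the
boundary condition, and by Jensen's inequality `(1 + Σ) R f`, as well as both traces, are in `L^p`;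
so it belongs to the domain of the streaming operator `T`, with `(1 - T) R f = f`
(`stationary_mem_streamingGraph`). Conversely `1 - T` is injective
(`eq_zero_of_mem_streamingGraph`): a weak solution of `v · ∇ₓ ψ = -(1 + Σ) ψ` satisfies the
integrated equation along almost every characteristic (`HasWeakTransport.along_flow`), so it decays
exponentially on each chord (`HasWeakTransport.exists_exp`), and the boundary condition at both
ends bounds the incoming trace by `γ ^ 2 < 1` times itself. So the graphs of the generator and of
`T` coincide, and a semigroup with this generator is the one constructed
(`IsC0Semigroup.eq_of_generatorGraph_eq`).
-/


open MeasureTheory Filter Topology Set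
open scoped ENNReal NNReal ContDiff

noncomputable section

namespace BounceBack

/-! ### Chords of the domain -/

section Geometry

variable {N : ℕ} {D : Set (EuclideanSpace ℝ (Fin N))}

/-- Free transport for the time `r`. -/
def flow (r : ℝ) (z : Phase N) : Phase N := (z.1 + r • z.2, z.2)

/-- Reversal of the velocity. -/
def rev (z : Phase N) : Phase N := (z.1, -z.2)

/-- The pair at which the characteristic through `z` enters the domain. -/
def entry (D : Set (EuclideanSpace ℝ (Fin N))) (z : Phase N) : Phase N := flow (-tMinus D z) z

/-- For an entering pair `b`, the pair that enters at the other end of the same chord with the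
opposite velocity. -/
def turn (D : Set (EuclideanSpace ℝ (Fin N))) (b : Phase N) : Phase N := rev (flow (tau D b) b)

/-- The line through `z` meets `D` exactly for the parameters in `(a, c)`. -/
structure IsChord (D : Set (EuclideanSpace ℝ (Fin N))) (z : Phase N) (a c : ℝ) : Prop where
  lt : a < c
  mem_iff : ∀ r : ℝ, z.1 + r • z.2 ∈ D ↔ a < r ∧ r < c

/-- Pairs that enter the domain: the line through `b` meets `D` for the parameters in
`(0, τ(b))`. -/
def IsEntrance (D : Set (EuclideanSpace ℝ (Fin N))) (b : Phase N) : Prop :=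
  IsChord D b 0 (tau D b)

@[simp] lemma flow_fst (r : ℝ) (z : Phase N) : (flow r z).1 = z.1 + r • z.2 := rfl
@[simp] lemma flow_snd (r : ℝ) (z : Phase N) : (flow r z).2 = z.2 := rfl
@[simp] lemma rev_fst (z : Phase N) : (rev z).1 = z.1 := rfl
@[simp] lemma rev_snd (z : Phase N) : (rev z).2 = -z.2 := rfl
@[simp] lemma rev_rev (z : Phase N) : rev (rev z) = z := by simp [rev]
@[simp] lemma entry_snd (z : Phase N) : (entry D z).2 = z.2 := rfl
@[simp] lemma turn_snd (z : Phase N) : (turn D z).2 = -z.2 := rfl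

lemma flow_flow (r s : ℝ) (z : Phase N) : flow r (flow s z) = flow (r + s) z := by
  ext1
  · simp only [flow, add_smul]; abel
  · rfl

@[simp] lemma flow_zero (z : Phase N) : flow 0 z = z := by simp [flow]

lemma flow_rev (r : ℝ) (z : Phase N) : flow r (rev z) = rev (flow (-r) z) := by
  simp [flow, rev]

lemma IsChord.flow {z : Phase N} {a c : ℝ} (h : IsChord D z a c) (r : ℝ) :
    IsChord D (flow r z) (a - r) (c - r) where
  lt := by linarith [h.lt]
  mem_iff s := by
    have := h.mem_iff (r + s)
    rw [flow_fst, flow_snd, add_assoc, ← add_smul, this]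
    constructor <;> rintro ⟨h1, h2⟩ <;> constructor <;> linarith

lemma IsChord.rev {z : Phase N} {a c : ℝ} (h : IsChord D z a c) : IsChord D (rev z) (-c) (-a) where
  lt := by linarith [h.lt]
  mem_iff s := by
    have := h.mem_iff (-s)
    rw [rev_fst, rev_snd, smul_neg, ← neg_smul, this]
    constructor <;> rintro ⟨h1, h2⟩ <;> constructor <;> linarith

lemma IsChord.snd_ne_zero {z : Phase N} {a c : ℝ} (h : IsChord D z a c) : z.2 ≠ 0 := by
  intro h0
  have h1 := (h.mem_iff ((a + c) / 2)).2 ⟨by linarith [h.lt], by linarith [h.lt]⟩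
  have h2 := (h.mem_iff c).1 (by simpa [h0] using h1)
  exact lt_irrefl _ h2.2

lemma tPlus_eq_tMinus_rev (z : Phase N) : tPlus D z = tMinus D (rev z) := by
  simp [tPlus, tMinus]

lemma tMinus_rev (z : Phase N) : tMinus D (rev z) = tPlus D z := (tPlus_eq_tMinus_rev z).symm

lemma tPlus_rev (z : Phase N) : tPlus D (rev z) = tMinus D z := by
  rw [tPlus_eq_tMinus_rev, rev_rev]

lemma tau_rev (z : Phase N) : tau D (rev z) = tau D z := by
  rw [tau, tau, tMinus_rev, tPlus_rev, add_comm]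

lemma IsChord.tMinus_eq {z : Phase N} {a c : ℝ} (h : IsChord D z a c) (ha : a ≤ 0) (hc : 0 ≤ c) :
    tMinus D z = -a := by
  have : {s : ℝ | 0 < s ∧ z.1 - s • z.2 ∉ D} = {s | 0 < s ∧ -a ≤ s} := by
    ext s
    simp only [mem_ofPred_eq, sub_eq_add_neg, ← neg_smul, h.mem_iff, not_and_or, not_lt]
    constructor
    · rintro ⟨h1, h2 | h2⟩
      · exact ⟨h1, by linarith⟩
      · exact absurd h2 (by linarith)
    · rintro ⟨h1, h2⟩
      exact ⟨h1, Or.inl (by linarith)⟩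
  rw [tMinus, this]
  rcases ha.eq_or_lt with rfl | ha
  · have : {s : ℝ | 0 < s ∧ -0 ≤ s} = Ioi 0 := by
      ext s; simp; exact fun h => h.le
    rw [this, csInf_Ioi, neg_zero]
  · have : {s : ℝ | 0 < s ∧ -a ≤ s} = Ici (-a) := by
      ext s; simp; intro h; linarith
    rw [this, csInf_Ici]

lemma IsChord.tPlus_eq {z : Phase N} {a c : ℝ} (h : IsChord D z a c) (ha : a ≤ 0) (hc : 0 ≤ c) :
    tPlus D z = c := by
  rw [tPlus_eq_tMinus_rev, h.rev.tMinus_eq (by linarith) (by linarith), neg_neg]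

lemma IsChord.tau_eq {z : Phase N} {a c : ℝ} (h : IsChord D z a c) (ha : a ≤ 0) (hc : 0 ≤ c) :
    tau D z = c - a := by
  rw [tau, h.tMinus_eq ha hc, h.tPlus_eq ha hc]; ring

lemma IsChord.isEntrance {z : Phase N} {c : ℝ} (h : IsChord D z 0 c) : IsEntrance D z := by
  rw [IsEntrance, h.tau_eq le_rfl h.lt.le, sub_zero]
  exact h

/-- A line that meets a bounded convex open set meets it in an open bounded interval. -/
lemma exists_isChord (hDo : IsOpen D) (hDc : Convex ℝ D) (hDb : Bornology.IsBounded D)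
    {z : Phase N} (hz : z.1 ∈ D) (hv : z.2 ≠ 0) : ∃ a c, a < 0 ∧ 0 < c ∧ IsChord D z a c := by
  set S : Set ℝ := {r | z.1 + r • z.2 ∈ D} with hS
  have hcont : Continuous fun r : ℝ => z.1 + r • z.2 := by fun_prop
  have hSo : IsOpen S := hDo.preimage hcont
  have hSc : Convex ℝ S := by
    intro x hx y hy a b ha hb hab
    have := hDc hx hy ha hb hab
    simp only [hS, mem_ofPred_eq]
    convert this using 1
    rw [smul_add, smul_add, smul_smul, smul_smul,
      show a • z.1 + (a * x) • z.2 + (b • z.1 + (b * y) • z.2)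
        = (a + b) • z.1 + (a * x + b * y) • z.2 by module, hab, one_smul]
    rfl
  have h0 : (0 : ℝ) ∈ S := by simpa [hS] using hz
  obtain ⟨R, hR⟩ := hDb.subset_ball z.1
  have hbd : ∀ r ∈ S, |r| < R / ‖z.2‖ := by
    intro r hr
    have := hR hr
    rw [Metric.mem_ball, dist_eq_norm, add_sub_cancel_left, norm_smul, Real.norm_eq_abs] at this
    rwa [lt_div_iff₀ (norm_pos_iff.2 hv)]
  have hba : BddAbove S := ⟨R / ‖z.2‖, fun r hr => (le_abs_self r).trans (hbd r hr).le⟩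
  have hbb : BddBelow S := ⟨-(R / ‖z.2‖), fun r hr => (abs_le.1 (hbd r hr).le).1⟩
  have hlt : ∀ r ∈ S, sInf S < r ∧ r < sSup S := by
    intro r hr
    obtain ⟨ε, hε, hball⟩ := Metric.isOpen_iff.1 hSo r hr
    have h1 : r - ε / 2 ∈ S := hball (by simp [abs_of_pos hε, hε.lt])
    have h2 : r + ε / 2 ∈ S := hball (by simp [abs_of_pos hε, hε.lt])
    exact ⟨(csInf_le hbb h1).trans_lt (by linarith), (by linarith : r < r + ε / 2).trans_le
      (le_csSup hba h2)⟩
  refine ⟨sInf S, sSup S, (hlt 0 h0).1, (hlt 0 h0).2, (hlt 0 h0).1.trans (hlt 0 h0).2, ?_⟩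
  intro r
  refine ⟨hlt r, fun hr => ?_⟩
  obtain ⟨x, hx, hxr⟩ := exists_lt_of_csInf_lt ⟨0, h0⟩ hr.1
  obtain ⟨y, hy, hry⟩ := exists_lt_of_lt_csSup ⟨0, h0⟩ hr.2
  exact hSc.ordConnected.out hx hy ⟨hxr.le, hry.le⟩

lemma isChord_of_mem (hDo : IsOpen D) (hDc : Convex ℝ D) (hDb : Bornology.IsBounded D)
    {z : Phase N} (hz : z.1 ∈ D) (hv : z.2 ≠ 0) :
    0 < tMinus D z ∧ 0 < tPlus D z ∧ IsChord D z (-tMinus D z) (tPlus D z) := by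
  obtain ⟨a, c, ha, hc, h⟩ := exists_isChord hDo hDc hDb hz hv
  rw [h.tMinus_eq ha.le hc.le, h.tPlus_eq ha.le hc.le, neg_neg]
  exact ⟨by linarith, hc, h⟩

/-- A pair outside `D` is an entrance as soon as its characteristic stays in `D` for a while; the
chord through a later point then begins exactly at time `0`. -/
lemma isEntrance_of_not_mem (hDo : IsOpen D) (hDc : Convex ℝ D) (hDb : Bornology.IsBounded D)
    {b : Phase N} (hb : b.1 ∉ D) (hv : b.2 ≠ 0) {δ : ℝ} (hδ : 0 < δ)
    (h : ∀ s, 0 < s → s ≤ δ → b.1 + s • b.2 ∈ D) : IsEntrance D b ∧ δ < tau D b := by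
  obtain ⟨a, c, ha, hc, hch⟩ := exists_isChord (z := flow δ b) hDo hDc hDb (h δ hδ le_rfl) hv
  have h1 := hch.flow (-δ)
  rw [flow_flow, neg_add_cancel, flow_zero] at h1
  have h2 : a - -δ = 0 := by
    apply le_antisymm
    · by_contra! hlt
      have := (h1.mem_iff (min (a - -δ) δ)).1
        (h _ (lt_min hlt hδ) (min_le_right _ _))
      exact absurd this.1 (not_lt.2 (min_le_left _ _))
    · by_contra! hlt
      apply hb
      simpa using (h1.mem_iff 0).2 ⟨hlt, by linarith⟩
  rw [h2] at h1
  refine ⟨h1.isEntrance, ?_⟩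
  rw [h1.tau_eq le_rfl h1.lt.le]
  linarith

/-! ### Entrances -/

lemma IsEntrance.tau_pos {b : Phase N} (h : IsEntrance D b) : 0 < tau D b := h.lt

lemma IsEntrance.mem_iff {b : Phase N} (h : IsEntrance D b) (s : ℝ) :
    (flow s b).1 ∈ D ↔ 0 < s ∧ s < tau D b := IsChord.mem_iff h s

lemma IsEntrance.tMinus_flow {b : Phase N} (h : IsEntrance D b) {s : ℝ} (h0 : 0 ≤ s)
    (h1 : s ≤ tau D b) : tMinus D (flow s b) = s := by
  rw [(IsChord.flow h s).tMinus_eq (by linarith) (by linarith)]; ring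

lemma IsEntrance.tPlus_flow {b : Phase N} (h : IsEntrance D b) {s : ℝ} (h0 : 0 ≤ s)
    (h1 : s ≤ tau D b) : tPlus D (flow s b) = tau D b - s := by
  rw [(IsChord.flow h s).tPlus_eq (by linarith) (by linarith)]

lemma IsEntrance.tau_flow {b : Phase N} (h : IsEntrance D b) {s : ℝ} (h0 : 0 ≤ s)
    (h1 : s ≤ tau D b) : tau D (flow s b) = tau D b := by
  rw [(IsChord.flow h s).tau_eq (by linarith) (by linarith)]; ring

lemma IsEntrance.entry_flow {b : Phase N} (h : IsEntrance D b) {s : ℝ} (h0 : 0 ≤ s)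
    (h1 : s ≤ tau D b) : entry D (flow s b) = b := by
  rw [entry, h.tMinus_flow h0 h1, flow_flow, neg_add_cancel, flow_zero]

lemma IsEntrance.turn {b : Phase N} (h : IsEntrance D b) : IsEntrance D (turn D b) := by
  have h1 := (IsChord.flow h (tau D b)).rev
  rw [sub_self, neg_zero] at h1
  exact h1.isEntrance

lemma IsEntrance.tau_turn {b : Phase N} (h : IsEntrance D b) : tau D (BounceBack.turn D b) = tau D b := by
  rw [BounceBack.turn, tau_rev, h.tau_flow h.lt.le le_rfl]

lemma flow_turn (b : Phase N) (s : ℝ) :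
    flow s (turn D b) = rev (flow (tau D b - s) b) := by
  rw [turn, flow_rev, flow_flow]; congr 2; ring

lemma IsEntrance.turn_turn {b : Phase N} (h : IsEntrance D b) :
    BounceBack.turn D (BounceBack.turn D b) = b := by
  conv_lhs => rw [BounceBack.turn, flow_turn, h.tau_turn, sub_self, flow_zero, rev_rev]

lemma IsEntrance.turn_iterate {b : Phase N} (h : IsEntrance D b) (n : ℕ) :
    IsEntrance D ((BounceBack.turn D)^[n] b) := by
  induction n with
  | zero => exact h
  | succ n ih => rw [Function.iterate_succ_apply']; exact ih.turn

lemma IsEntrance.tau_turn_iterate {b : Phase N} (h : IsEntrance D b) (n : ℕ) :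
    tau D ((BounceBack.turn D)^[n] b) = tau D b := by
  induction n with
  | zero => rfl
  | succ n ih => rw [Function.iterate_succ_apply', (h.turn_iterate n).tau_turn, ih]

lemma IsEntrance.turn_iterate_even {b : Phase N} (h : IsEntrance D b) {n : ℕ} (hn : Even n) :
    (BounceBack.turn D)^[n] b = b := by
  obtain ⟨k, rfl⟩ := hn
  induction k with
  | zero => rfl
  | succ k ih =>
    rw [show k + 1 + (k + 1) = (k + k) + 1 + 1 by ring, Function.iterate_succ_apply,
      Function.iterate_succ_apply, h.turn_turn, ih]

lemma isEntrance_entry (hDo : IsOpen D) (hDc : Convex ℝ D) (hDb : Bornology.IsBounded D)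
    {z : Phase N} (hz : z.1 ∈ D) (hv : z.2 ≠ 0) :
    IsEntrance D (entry D z) ∧ tau D (entry D z) = tau D z ∧ flow (tMinus D z) (entry D z) = z ∧
      0 < tMinus D z ∧ tMinus D z < tau D z := by
  obtain ⟨h1, h2, h3⟩ := isChord_of_mem hDo hDc hDb hz hv
  have h4 := h3.flow (-tMinus D z)
  rw [sub_self] at h4
  refine ⟨h4.isEntrance, ?_, ?_, h1, ?_⟩
  · rw [entry, h4.tau_eq le_rfl h4.lt.le, tau]; ring
  · rw [entry, flow_flow, add_neg_cancel, flow_zero]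
  · rw [tau]; linarith

/-- Every pair `z` in `D × ℝ^N` with non-zero velocity is `flow s b` for an entrance `b` and a
parameter `s` in `(0, τ(b))`. -/
lemma exists_entrance (hDo : IsOpen D) (hDc : Convex ℝ D) (hDb : Bornology.IsBounded D)
    {z : Phase N} (hz : z.1 ∈ D) (hv : z.2 ≠ 0) :
    ∃ b s, IsEntrance D b ∧ 0 < s ∧ s < tau D b ∧ z = flow s b := by
  obtain ⟨h1, h2, h3, h4, h5⟩ := isEntrance_entry hDo hDc hDb hz hv
  exact ⟨entry D z, tMinus D z, h1, h4, h2 ▸ h5, h3.symm⟩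

lemma entry_rev (hDo : IsOpen D) (hDc : Convex ℝ D) (hDb : Bornology.IsBounded D)
    {z : Phase N} (hz : z.1 ∈ D) (hv : z.2 ≠ 0) : entry D (rev z) = turn D (entry D z) := by
  obtain ⟨b, s, hb, hs0, hs1, rfl⟩ := exists_entrance hDo hDc hDb hz hv
  rw [hb.entry_flow hs0.le hs1.le]
  have : rev (flow s b) = flow (tau D b - s) (turn D b) := by
    rw [flow_turn]; congr 2; ring
  rw [this, hb.turn.entry_flow (by linarith) (by rw [hb.tau_turn]; linarith)]

/-! ### Measurability of the entrance and of the exit times -/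

lemma measurable_flow : Measurable fun q : ℝ × Phase N => flow q.1 q.2 := by
  unfold flow
  fun_prop

lemma continuous_flow (r : ℝ) : Continuous (flow r : Phase N → Phase N) := by
  unfold flow
  fun_prop

lemma measurable_rev : Measurable (rev : Phase N → Phase N) := by
  unfold rev
  fun_prop

lemma measurable_tMinus (hDo : IsOpen D) (hDb : Bornology.IsBounded D) :
    Measurable (tMinus D : Phase N → ℝ) := by
  set E : Set (Phase N) := {z | z.1 ∈ D ∧ z.2 = 0} with hE
  have hEm : MeasurableSet E :=
    (hDo.measurableSet.preimage measurable_fst).inter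
      ((measurableSet_singleton 0).preimage measurable_snd)
  have hne : ∀ z ∉ E, {s : ℝ | 0 < s ∧ z.1 - s • z.2 ∉ D}.Nonempty := by
    intro z hz
    by_cases hv : z.2 = 0
    · refine ⟨1, one_pos, fun h => hz ⟨by simpa [hv] using h, hv⟩⟩
    · obtain ⟨R, hR⟩ := hDb.subset_ball z.1
      refine ⟨max 1 (R / ‖z.2‖), lt_max_of_lt_left one_pos, fun h => ?_⟩
      have := hR h
      have h1 : (0 : ℝ) < max 1 (R / ‖z.2‖) := lt_max_of_lt_left one_pos
      rw [Metric.mem_ball, dist_eq_norm, sub_sub_cancel_left, norm_neg, norm_smul,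
        Real.norm_eq_abs, abs_of_pos h1, ← lt_div_iff₀ (norm_pos_iff.2 hv)] at this
      exact absurd this (not_lt.2 (le_max_right _ _))
  apply measurable_of_Iio
  intro c
  -- closed parameter intervals `[1 / (n + 1), c - 1 / (n + 1)]` exhaust `(0, c)`
  have : tMinus D ⁻¹' Iio c = (E ∩ {_z | 0 < c}) ∪
      ⋃ n : ℕ, {z : Phase N | ∃ s ∈ Icc (1 / ((n : ℝ) + 1)) (c - 1 / ((n : ℝ) + 1)),
        z.1 - s • z.2 ∉ D} := by
    ext z
    simp only [mem_preimage, mem_Iio, mem_union, mem_inter_iff, mem_ofPred_eq, mem_iUnion]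
    by_cases hz : z ∈ E
    -- here the set of exit times is empty, and `tMinus` is `sInf ∅ = 0`
    · have hD : ∀ s : ℝ, z.1 - s • z.2 ∈ D := by
        intro s; simpa [hz.2] using hz.1
      have : {s : ℝ | 0 < s ∧ z.1 - s • z.2 ∉ D} = ∅ := by
        ext s; simp [hD]
      rw [tMinus, this, Real.sInf_empty]
      simp [hz, hD]
    · rw [tMinus]
      simp only [hz, false_and, false_or]
      rw [csInf_lt_iff ⟨0, fun s hs => hs.1.le⟩ (hne z hz)]
      constructor
      · rintro ⟨s, ⟨h1, h2⟩, h3⟩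
        obtain ⟨n, hn⟩ := exists_nat_one_div_lt (lt_min h1 (sub_pos.2 h3))
        rw [lt_min_iff] at hn
        exact ⟨n, s, ⟨hn.1.le, by linarith⟩, h2⟩
      · rintro ⟨n, s, ⟨h1, h2⟩, h3⟩
        have : (0 : ℝ) < 1 / ((n : ℝ) + 1) := by positivity
        exact ⟨s, ⟨by linarith, h3⟩, by linarith⟩
  rw [this]
  refine (hEm.inter (MeasurableSet.const _)).union (MeasurableSet.iUnion fun n => ?_)
  -- the projection along a compact parameter interval of a closed set is closed
  apply IsClosed.measurableSet
  have hcl : IsClosed {q : Phase N × Icc (1 / ((n : ℝ) + 1)) (c - 1 / ((n : ℝ) + 1)) |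
      q.1.1 - (q.2 : ℝ) • q.1.2 ∉ D} := by
    have : Continuous fun q : Phase N × Icc (1 / ((n : ℝ) + 1)) (c - 1 / ((n : ℝ) + 1)) =>
      q.1.1 - (q.2 : ℝ) • q.1.2 := by fun_prop
    exact hDo.isClosed_compl.preimage this
  convert isClosedMap_fst_of_compactSpace _ hcl using 1
  ext z
  constructor
  · rintro ⟨s, hs, h⟩
    exact ⟨(z, ⟨s, hs⟩), h, rfl⟩
  · rintro ⟨⟨z', s⟩, h, rfl⟩
    exact ⟨s, s.2, h⟩

lemma measurable_tPlus (hDo : IsOpen D) (hDb : Bornology.IsBounded D) :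
    Measurable (tPlus D : Phase N → ℝ) := by
  have : (tPlus D : Phase N → ℝ) = fun z => tMinus D (rev z) := by
    ext z; exact tPlus_eq_tMinus_rev z
  rw [this]
  exact (measurable_tMinus hDo hDb).comp measurable_rev

lemma measurable_tau (hDo : IsOpen D) (hDb : Bornology.IsBounded D) :
    Measurable (tau D : Phase N → ℝ) :=
  (measurable_tMinus hDo hDb).add (measurable_tPlus hDo hDb)

lemma measurable_entry (hDo : IsOpen D) (hDb : Bornology.IsBounded D) :
    Measurable (entry D : Phase N → Phase N) :=
  measurable_flow.comp ((measurable_tMinus hDo hDb).neg.prodMk measurable_id)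

lemma measurable_turn (hDo : IsOpen D) (hDb : Bornology.IsBounded D) :
    Measurable (turn D : Phase N → Phase N) :=
  measurable_rev.comp (measurable_flow.comp ((measurable_tau hDo hDb).prodMk measurable_id))

lemma isEntrance_iff (hDo : IsOpen D) (hDc : Convex ℝ D) (hDb : Bornology.IsBounded D)
    (b : Phase N) : IsEntrance D b ↔ b.2 ≠ 0 ∧ b.1 ∉ D ∧ 0 < tPlus D b := by
  constructor
  · intro h
    refine ⟨h.snd_ne_zero, fun hb => ?_, ?_⟩
    · have := (h.mem_iff 0).1 (by simpa using hb)
      exact lt_irrefl _ this.1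
    · have := h.tPlus_flow le_rfl h.lt.le
      rw [flow_zero] at this
      rw [this, sub_zero]; exact h.lt
  · rintro ⟨hv, hb, ht⟩
    refine (isEntrance_of_not_mem hDo hDc hDb hb hv (half_pos ht) fun s hs0 hs1 => ?_).1
    by_contra hs
    have : tPlus D b ≤ s := csInf_le ⟨0, fun r hr => hr.1.le⟩ ⟨hs0, hs⟩
    linarith

lemma measurableSet_isEntrance (hDo : IsOpen D) (hDc : Convex ℝ D) (hDb : Bornology.IsBounded D) :
    MeasurableSet {b : Phase N | IsEntrance D b} := by
  simp only [isEntrance_iff hDo hDc hDb]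
  refine ((measurableSet_singleton 0).preimage measurable_snd).compl.inter
    ((hDo.measurableSet.preimage measurable_fst).compl.inter ?_)
  exact measurableSet_lt measurable_const (measurable_tPlus hDo hDb)

end Geometry

/-! ### Disintegration of the phase measure along the chords -/

section Disintegration

variable {N : ℕ} {D : Set (EuclideanSpace ℝ (Fin N))}

/-- The measure on the entrances over which `dx ⊗ dv` disintegrates into `ds` along the chords: the
image under `entry` of `dx ⊗ dv` with the density `1 / τ`, which gives each chord total weight `1`
instead of its length. -/
def chordMeasure (D : Set (EuclideanSpace ℝ (Fin N))) : Measure (Phase N) :=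
  ((phaseMeasure D).withDensity (fun z => (ENNReal.ofReal (tau D z))⁻¹)).map (entry D)

/-- The measure `chordMeasure ⊗ ds` on the pairs `(b, s)` with `0 < s < τ(b)`. -/
def chordProd (D : Set (EuclideanSpace ℝ (Fin N))) : Measure (Phase N × ℝ) :=
  ((chordMeasure D).prod volume).restrict {q | 0 < q.2 ∧ q.2 < tau D q.1}

instance : SFinite (phaseMeasure D) := by unfold phaseMeasure; infer_instance

instance : SigmaFinite (phaseMeasure D) := by unfold phaseMeasure; infer_instance

instance : SFinite (chordMeasure D) := by unfold chordMeasure; infer_instance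

instance : SFinite (chordProd D) := by unfold chordProd; infer_instance

lemma measurePreserving_flow (r : ℝ) :
    MeasurePreserving (flow r : Phase N → Phase N) volume volume := by
  have h : MeasurePreserving (fun q : EuclideanSpace ℝ (Fin N) × EuclideanSpace ℝ (Fin N) =>
      (q.1, q.2 + r • q.1)) (volume.prod volume) (volume.prod volume) := by
    refine (MeasurePreserving.id volume).skew_product (g := fun v x => x + r • v) (by fun_prop) ?_
    exact Eventually.of_forall fun v => (measurePreserving_add_right volume (r • v)).map_eq
  have := (Measure.measurePreserving_swap.comp h).comp
    (Measure.measurePreserving_swap (μ := (volume : Measure (EuclideanSpace ℝ (Fin N))))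
      (ν := (volume : Measure (EuclideanSpace ℝ (Fin N)))))
  exact this

lemma measurePreserving_rev_volume :
    MeasurePreserving (rev : Phase N → Phase N) volume volume :=
  (MeasurePreserving.id volume).prod (Measure.measurePreserving_neg volume)

lemma measurePreserving_rev (hDo : IsOpen D) :
    MeasurePreserving (rev : Phase N → Phase N) (phaseMeasure D) (phaseMeasure D) :=
  measurePreserving_rev_volume.restrict_preimage (hDo.measurableSet.prod MeasurableSet.univ)

lemma ae_inside (hN : 1 ≤ N) (hDo : IsOpen D) :
    ∀ᵐ z ∂phaseMeasure D, z.1 ∈ D ∧ z.2 ≠ 0 := by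
  have h1 : ∀ᵐ z ∂phaseMeasure D, z.1 ∈ D := by
    filter_upwards [ae_restrict_mem (hDo.measurableSet.prod MeasurableSet.univ)] with z hz
    exact hz.1
  have h2 : ∀ᵐ z ∂phaseMeasure D, z.2 ≠ 0 := by
    apply ae_restrict_of_ae
    have : Nonempty (Fin N) := ⟨⟨0, hN⟩⟩
    have h3 : ∀ᵐ v : EuclideanSpace ℝ (Fin N), v ≠ 0 := by
      simp [ae_iff, measure_singleton]
    exact Measure.quasiMeasurePreserving_snd.ae h3
  filter_upwards [h1, h2] with z ha hb using ⟨ha, hb⟩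

lemma measurable_tau_inv (hDo : IsOpen D) (hDb : Bornology.IsBounded D) :
    Measurable fun z : Phase N => (ENNReal.ofReal (tau D z))⁻¹ :=
  (measurable_tau hDo hDb).ennreal_ofReal.inv

/-- Disintegration of `dx ⊗ dv` along the chords. The factor `1 / τ` in `chordMeasure` compensates
the length of the chord; Fubini and the invariance of Lebesgue measure under free transport give
the formula. -/
theorem lintegral_chord (hN : 1 ≤ N) (hDo : IsOpen D) (hDc : Convex ℝ D)
    (hDb : Bornology.IsBounded D) {F : Phase N → ℝ≥0∞} (hF : Measurable F) :
    ∫⁻ b, (∫⁻ s in Ioo 0 (tau D b), F (flow s b)) ∂chordMeasure D = ∫⁻ z, F z ∂phaseMeasure D := by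
  classical
  have hτ := measurable_tau hDo hDb
  have hτi := measurable_tau_inv hDo hDb
  have hfl := measurable_flow (N := N)
  have hDm : MeasurableSet {z : Phase N | z.1 ∈ D} := hDo.measurableSet.preimage measurable_fst
  set G : Phase N → ℝ → ℝ≥0∞ := fun b s => (Ioo 0 (tau D b)).indicator (fun s => F (flow s b)) s
    with hG
  have hGm : Measurable (Function.uncurry G) := by
    have : Function.uncurry G = {q : Phase N × ℝ | 0 < q.2 ∧ q.2 < tau D q.1}.indicator
        (fun q => F (flow q.2 q.1)) := by
      ext q
      by_cases hq : 0 < q.2 ∧ q.2 < tau D q.1 <;> simp [Function.uncurry, hG, indicator, hq]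
    rw [this]
    refine (hF.comp (hfl.comp measurable_swap)).indicator ?_
    exact (measurableSet_lt measurable_const measurable_snd).inter
      (measurableSet_lt measurable_snd (hτ.comp measurable_fst))
  have e1 : ∫⁻ b, (∫⁻ s in Ioo 0 (tau D b), F (flow s b)) ∂chordMeasure D
      = ∫⁻ z, (ENNReal.ofReal (tau D z))⁻¹ * (∫⁻ s, G (entry D z) s) ∂phaseMeasure D := by
    have : ∀ b, ∫⁻ s in Ioo 0 (tau D b), F (flow s b) = ∫⁻ s, G b s := fun b =>
      (lintegral_indicator measurableSet_Ioo _).symm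
    simp_rw [this]
    have hGi : Measurable fun b => ∫⁻ s, G b s := hGm.lintegral_prod_right'
    rw [chordMeasure, lintegral_map hGi (measurable_entry hDo hDb),
      lintegral_withDensity_eq_lintegral_mul _ hτi]
    · rfl
    · exact hGi.comp (measurable_entry hDo hDb)
  rw [e1]
  -- both sides are the integral of `H` over pairs of points of a common chord: the variable of
  -- integration is one of the two points or the other
  set A : Set (Phase N) := {z | z.1 ∈ D} with hA
  set H : ℝ → Phase N → ℝ≥0∞ := fun r z =>
    A.indicator 1 z * A.indicator 1 (flow r z) * (ENNReal.ofReal (tau D z))⁻¹ * F (flow r z) with hH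
  have hHm : Measurable (Function.uncurry H) := by
    have hi : Measurable (A.indicator (1 : Phase N → ℝ≥0∞)) := measurable_one.indicator hDm
    exact (((hi.comp measurable_snd).mul (hi.comp hfl)).mul
      (hτi.comp measurable_snd)).mul (hF.comp hfl)
  have hph : phaseMeasure D = volume.restrict A := by
    rw [phaseMeasure]; congr 1; ext z; simp [hA]
  have e2 : ∫⁻ z, (ENNReal.ofReal (tau D z))⁻¹ * (∫⁻ s, G (entry D z) s) ∂phaseMeasure D
      = ∫⁻ z, (∫⁻ r, H r z) ∂phaseMeasure D := by
    refine lintegral_congr_ae ?_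
    filter_upwards [ae_inside hN hDo] with z hz
    obtain ⟨b, t, hb, ht0, ht1, rfl⟩ := exists_entrance hDo hDc hDb hz.1 hz.2
    have hGt : Measurable fun r => G b (r + t) :=
      (hGm.of_uncurry_left (x := b)).comp (measurable_id.add_const t)
    rw [hb.entry_flow ht0.le ht1.le, ← lintegral_add_right_eq_self (G b) t,
      ← lintegral_const_mul _ hGt]
    refine lintegral_congr fun r => ?_
    have hm : flow t b ∈ A := hz.1
    by_cases hr : 0 < r + t ∧ r + t < tau D b
    · have h1 : flow r (flow t b) ∈ A := by
        rw [flow_flow]; exact (hb.mem_iff _).2 hr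
      simp only [hH, indicator_of_mem hm, indicator_of_mem h1, hG]
      rw [indicator_of_mem (show r + t ∈ Ioo 0 (tau D b) from hr), flow_flow]
      simp
    · have h1 : flow r (flow t b) ∉ A := by
        rw [flow_flow]; exact fun h => hr ((hb.mem_iff _).1 h)
      simp only [hH, indicator_of_notMem h1, hG]
      rw [indicator_of_notMem (show r + t ∉ Ioo 0 (tau D b) from hr)]
      simp
  have e3 : ∫⁻ z, (∫⁻ r, H r z) ∂phaseMeasure D = ∫⁻ z, ∫⁻ r, H r z := by
    rw [hph, ← lintegral_indicator hDm]
    refine lintegral_congr fun z => ?_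
    by_cases hz : z ∈ A
    · rw [indicator_of_mem hz]
    · rw [indicator_of_notMem hz]
      simp [hH, indicator_of_notMem hz]
  have e4 : ∫⁻ z, ∫⁻ r, H r z = ∫⁻ z, ∫⁻ r, H r (flow (-r) z) := by
    rw [lintegral_lintegral_swap (f := fun z r => H r z) (hHm.comp measurable_swap).aemeasurable]
    have : ∀ r, ∫⁻ z, H r z = ∫⁻ z, H r (flow (-r) z) := fun r =>
      ((measurePreserving_flow (-r)).lintegral_comp (hHm.of_uncurry_left (x := r))).symm
    simp_rw [this]
    rw [lintegral_lintegral_swap]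
    have : Measurable fun q : ℝ × Phase N => (q.1, flow (-q.1) q.2) :=
      measurable_fst.prodMk (hfl.comp (measurable_fst.neg.prodMk measurable_snd))
    exact (hHm.comp this).aemeasurable
  have e5 : ∫⁻ z, ∫⁻ r, H r (flow (-r) z) = ∫⁻ z, (∫⁻ r, H r (flow (-r) z)) ∂phaseMeasure D := by
    rw [hph, ← lintegral_indicator hDm]
    refine lintegral_congr fun z => ?_
    by_cases hz : z ∈ A
    · rw [indicator_of_mem hz]
    · rw [indicator_of_notMem hz]
      simp [hH, flow_flow, indicator_of_notMem hz]
  rw [e2, e3, e4, e5]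
  refine lintegral_congr_ae ?_
  filter_upwards [ae_inside hN hDo] with z hz
  obtain ⟨b, t, hb, ht0, ht1, rfl⟩ := exists_entrance hDo hDc hDb hz.1 hz.2
  have hm : flow t b ∈ A := hz.1
  have : ∀ r, H r (flow (-r) (flow t b)) = (Ioo (t - tau D b) t).indicator
      (fun _ => (ENNReal.ofReal (tau D b))⁻¹ * F (flow t b)) r := by
    intro r
    simp only [hH]
    rw [flow_flow r, add_neg_cancel, flow_zero, flow_flow, indicator_of_mem hm]
    by_cases hr : r ∈ Ioo (t - tau D b) t
    · have h1 : flow (-r + t) b ∈ A := (hb.mem_iff _).2 ⟨by linarith [hr.2], by linarith [hr.1]⟩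
      rw [indicator_of_mem hr, indicator_of_mem h1,
        hb.tau_flow (by linarith [hr.2]) (by linarith [hr.1])]
      simp
    · have h1 : flow (-r + t) b ∉ A := fun h => hr
        ⟨by linarith [((hb.mem_iff _).1 h).2], by linarith [((hb.mem_iff _).1 h).1]⟩
      rw [indicator_of_notMem hr, indicator_of_notMem h1]
      simp
  simp_rw [this]
  rw [lintegral_indicator measurableSet_Ioo, setLIntegral_const, Real.volume_Ioo, mul_right_comm,
    sub_sub_cancel, ENNReal.inv_mul_cancel, one_mul]
  · simpa using hb.tau_pos
  · simp

lemma measurableSet_chord (hDo : IsOpen D) (hDb : Bornology.IsBounded D) :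
    MeasurableSet {q : Phase N × ℝ | 0 < q.2 ∧ q.2 < tau D q.1} :=
  (measurableSet_lt measurable_const measurable_snd).inter
    (measurableSet_lt measurable_snd ((measurable_tau hDo hDb).comp measurable_fst))

lemma measurable_flow_swap : Measurable fun q : Phase N × ℝ => flow q.2 q.1 :=
  measurable_flow.comp measurable_swap

lemma lintegral_chordProd (hDo : IsOpen D) (hDb : Bornology.IsBounded D)
    {F : Phase N × ℝ → ℝ≥0∞} (hF : Measurable F) :
    ∫⁻ q, F q ∂chordProd D = ∫⁻ b, (∫⁻ s in Ioo 0 (tau D b), F (b, s)) ∂chordMeasure D := by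
  rw [chordProd, ← lintegral_indicator (measurableSet_chord hDo hDb), lintegral_prod _
    ((hF.indicator (measurableSet_chord hDo hDb)).aemeasurable)]
  refine lintegral_congr fun b => ?_
  rw [← lintegral_indicator measurableSet_Ioo]
  rfl

/-- The disintegration `lintegral_chord`, as an image measure. -/
theorem map_chordProd (hN : 1 ≤ N) (hDo : IsOpen D) (hDc : Convex ℝ D)
    (hDb : Bornology.IsBounded D) :
    (chordProd D).map (fun q => flow q.2 q.1) = phaseMeasure D := by
  ext A hA
  rw [← lintegral_indicator_one hA, lintegral_map (measurable_one.indicator hA)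
    measurable_flow_swap, ← lintegral_indicator_one hA,
    ← lintegral_chord hN hDo hDc hDb (measurable_one.indicator hA), lintegral_chordProd hDo hDb]
  exact (measurable_one.indicator hA).comp measurable_flow_swap

lemma ae_chordProd_iff (hDo : IsOpen D) (hDb : Bornology.IsBounded D) {P : Phase N × ℝ → Prop} :
    (∀ᵐ q ∂chordProd D, P q) ↔
      ∀ᵐ q ∂(chordMeasure D).prod volume, (0 < q.2 ∧ q.2 < tau D q.1) → P q := by
  rw [chordProd, ae_restrict_iff' (measurableSet_chord hDo hDb)]
  rfl

/-- A property that holds almost everywhere in phase space holds almost everywhere on almost every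
chord. -/
lemma ae_chord_of_ae (hN : 1 ≤ N) (hDo : IsOpen D) (hDc : Convex ℝ D)
    (hDb : Bornology.IsBounded D) {P : Phase N → Prop} (h : ∀ᵐ z ∂phaseMeasure D, P z) :
    ∀ᵐ b ∂chordMeasure D, ∀ᵐ s, s ∈ Ioo 0 (tau D b) → P (flow s b) := by
  rw [← map_chordProd hN hDo hDc hDb] at h
  have h1 := ae_of_ae_map measurable_flow_swap.aemeasurable h
  rw [ae_chordProd_iff hDo hDb] at h1
  exact Measure.ae_ae_of_ae_prod h1

lemma ae_isEntrance (hN : 1 ≤ N) (hDo : IsOpen D) (hDc : Convex ℝ D)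
    (hDb : Bornology.IsBounded D) : ∀ᵐ b ∂chordMeasure D, IsEntrance D b := by
  rw [chordMeasure, ae_map_iff (measurable_entry hDo hDb).aemeasurable
    (measurableSet_isEntrance hDo hDc hDb)]
  refine (withDensity_absolutelyContinuous _ _).ae_le ?_
  filter_upwards [ae_inside hN hDo] with z hz
  exact (isEntrance_entry hDo hDc hDb hz.1 hz.2).1

/-- The reversal of velocities preserves `dx ⊗ dv` and `τ`, and `turn` is the map it induces on the
entrances. -/
lemma measurePreserving_turn (hN : 1 ≤ N) (hDo : IsOpen D) (hDc : Convex ℝ D)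
    (hDb : Bornology.IsBounded D) :
    MeasurePreserving (turn D) (chordMeasure D) (chordMeasure D) := by
  refine ⟨measurable_turn hDo hDb, ?_⟩
  have hτ := measurable_tau hDo hDb
  have hτi := measurable_tau_inv hDo hDb
  set μ := (phaseMeasure D).withDensity (fun z => (ENNReal.ofReal (tau D z))⁻¹) with hμ
  have h1 : MeasurePreserving rev μ μ := by
    refine ⟨measurable_rev, ?_⟩
    ext A hA
    rw [Measure.map_apply measurable_rev hA, hμ, withDensity_apply _ hA,
      withDensity_apply _ (measurable_rev hA), ← lintegral_indicator hA,
      ← lintegral_indicator (measurable_rev hA),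
      ← (measurePreserving_rev hDo).lintegral_comp (hτi.indicator hA)]
    refine lintegral_congr fun z => ?_
    by_cases hz : rev z ∈ A
    · rw [indicator_of_mem hz, indicator_of_mem (show z ∈ rev ⁻¹' A from hz), tau_rev]
    · rw [indicator_of_notMem hz, indicator_of_notMem (show z ∉ rev ⁻¹' A from hz)]
  rw [chordMeasure, Measure.map_map (measurable_turn hDo hDb) (measurable_entry hDo hDb), ← hμ]
  have h2 : turn D ∘ entry D =ᵐ[μ] entry D ∘ rev := by
    refine (withDensity_absolutelyContinuous _ _).ae_le ?_
    filter_upwards [ae_inside hN hDo] with z hz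
    exact (entry_rev hDo hDc hDb hz.1 hz.2).symm
  rw [Measure.map_congr h2, ← Measure.map_map (measurable_entry hDo hDb) measurable_rev, h1.map_eq]

lemma measurePreserving_turn_iterate (hN : 1 ≤ N) (hDo : IsOpen D) (hDc : Convex ℝ D)
    (hDb : Bornology.IsBounded D) (n : ℕ) :
    MeasurePreserving ((turn D)^[n]) (chordMeasure D) (chordMeasure D) :=
  (measurePreserving_turn hN hDo hDc hDb).iterate n

end Disintegration

/-! ### Volumes of tubes over flat patches -/

section Tubes

lemma euclideanHausdorffMeasure_image_le {X Y : Type*} [MetricSpace X] [MeasurableSpace X]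
    [BorelSpace X] [MetricSpace Y] [MeasurableSpace Y] [BorelSpace Y] {K : ℝ≥0} {f : X → Y}
    {s : Set X} (h : LipschitzOnWith K f s) (d : ℕ) :
    (μHE[d] : Measure Y) (f '' s) ≤ (K : ℝ≥0∞) ^ d * (μHE[d] : Measure X) s := by
  have := h.hausdorffMeasure_image_le (d := d) (Nat.cast_nonneg d)
  rw [ENNReal.rpow_natCast] at this
  rw [Measure.euclideanHausdorffMeasure_def, Measure.euclideanHausdorffMeasure_def,
    Measure.smul_apply, Measure.smul_apply, ENNReal.smul_def, ENNReal.smul_def, smul_eq_mul,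
    smul_eq_mul, mul_left_comm]
  gcongr

/-- If `f` expands distances on `s` by at least `1 / K`, then it shrinks the Hausdorff measure by
at most `1 / K ^ d`. -/
lemma euclideanHausdorffMeasure_le_image {X Y : Type*} [MetricSpace X] [MeasurableSpace X]
    [BorelSpace X] [MetricSpace Y] [MeasurableSpace Y] [BorelSpace Y] {K : ℝ≥0} {f : X → Y}
    {s : Set X} (h : ∀ x ∈ s, ∀ y ∈ s, dist x y ≤ K * dist (f x) (f y)) (d : ℕ) :
    (μHE[d] : Measure X) s ≤ (K : ℝ≥0∞) ^ d * (μHE[d] : Measure Y) (f '' s) := by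
  rcases s.eq_empty_or_nonempty with rfl | ⟨x0, hx0⟩
  · simp
  have hne : Nonempty X := ⟨x0⟩
  have hinj : InjOn f s := by
    intro x hx y hy hxy
    have := h x hx y hy
    rw [hxy, dist_self, mul_zero] at this
    exact dist_le_zero.1 this
  have hl : LipschitzOnWith K (Function.invFunOn f s) (f '' s) := by
    apply LipschitzOnWith.of_dist_le_mul
    rintro _ ⟨x, hx, rfl⟩ _ ⟨y, hy, rfl⟩
    rw [hinj.leftInvOn_invFunOn hx, hinj.leftInvOn_invFunOn hy]
    exact h x hx y hy
  have := euclideanHausdorffMeasure_image_le hl d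
  rwa [hinj.leftInvOn_invFunOn.image_image] at this

variable {N : ℕ}

local notation "E" => EuclideanSpace ℝ (Fin N)

/-- Projection along `v` to the hyperplane of height `h` in the direction `e`. -/
def slideTo (e v : EuclideanSpace ℝ (Fin N)) (h : ℝ) (x : EuclideanSpace ℝ (Fin N)) :
    EuclideanSpace ℝ (Fin N) := x + ((h - inner ℝ e x) / inner ℝ e v) • v

/-- `A` is so flat, in the direction `e`, that sliding along `v` distorts distances in `A` by a
factor of at most `2`. -/
def IsFlat (e v : EuclideanSpace ℝ (Fin N)) (A : Set (EuclideanSpace ℝ (Fin N))) : Prop :=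
  ∀ x ∈ A, ∀ y ∈ A, |inner ℝ e (x - y)| * ‖v‖ ≤ |inner ℝ e v| * ‖x - y‖ / 2

lemma IsFlat.slideTo_sub {e v : E} {A : Set E} (hA : IsFlat e v A) (hv : inner ℝ e v ≠ 0) (h : ℝ)
    {x y : E} (hx : x ∈ A) (hy : y ∈ A) :
    ‖(slideTo e v h x - slideTo e v h y) - (x - y)‖ ≤ ‖x - y‖ / 2 := by
  have : (slideTo e v h x - slideTo e v h y) - (x - y)
      = (-(inner ℝ e (x - y)) / inner ℝ e v) • v := by
    have h1 : (h - inner ℝ e x) / inner ℝ e v - (h - inner ℝ e y) / inner ℝ e v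
        = -(inner ℝ e (x - y)) / inner ℝ e v := by
      rw [inner_sub_right]; ring
    rw [← h1, slideTo, slideTo]
    module
  rw [this, norm_smul, norm_div, norm_neg, Real.norm_eq_abs, Real.norm_eq_abs, div_mul_eq_mul_div,
    div_le_iff₀ (abs_pos.2 hv)]
  linarith [hA x hx y hy]

lemma IsFlat.measure_slideTo_le {e v : E} {A : Set E} (hA : IsFlat e v A) (hv : inner ℝ e v ≠ 0)
    (h : ℝ) (d : ℕ) :
    (μHE[d] : Measure E) (slideTo e v h '' A) ≤ 2 ^ d * (μHE[d] : Measure E) A := by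
  refine euclideanHausdorffMeasure_image_le (K := 2) (LipschitzOnWith.of_dist_le_mul ?_) d
  intro x hx y hy
  rw [dist_eq_norm, dist_eq_norm]
  have h1 := hA.slideTo_sub hv h hx hy
  have h2 := norm_sub_norm_le (slideTo e v h x - slideTo e v h y) (x - y)
  have : (0 : ℝ) ≤ ‖x - y‖ := norm_nonneg _
  push_cast
  linarith

lemma IsFlat.le_measure_slideTo {e v : E} {A : Set E} (hA : IsFlat e v A) (hv : inner ℝ e v ≠ 0)
    (h : ℝ) (d : ℕ) :
    (μHE[d] : Measure E) A ≤ 2 ^ d * (μHE[d] : Measure E) (slideTo e v h '' A) := by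
  refine euclideanHausdorffMeasure_le_image (K := 2) ?_ d
  intro x hx y hy
  rw [dist_eq_norm, dist_eq_norm]
  have h1 := hA.slideTo_sub hv h hx hy
  have h2 := norm_sub_norm_le (x - y) (slideTo e v h x - slideTo e v h y)
  rw [norm_sub_rev (x - y)] at h2
  push_cast
  linarith

/-- The tube of length `δ` over `A` in the direction `v`. -/
def tube (A : Set (EuclideanSpace ℝ (Fin N))) (v : EuclideanSpace ℝ (Fin N)) (δ : ℝ) :
    Set (EuclideanSpace ℝ (Fin N)) := {y | ∃ x ∈ A, ∃ s : ℝ, 0 < s ∧ s < δ ∧ y = x + s • v}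

/-- The integral over all heights `h` of the area of the part of `A` that slides along `v` to the
height `h` within the time `δ`: each point of `A` reaches an interval of heights of length
`|e · v| δ`. -/
lemma lintegral_tube_heights {e v : E} (hv : inner ℝ e v ≠ 0) {A : Set E}
    (hfin : (μHE[N - 1] : Measure E) A ≠ ⊤) {δ : ℝ} :
    ∫⁻ h : ℝ, (μHE[N - 1] : Measure E) (A ∩ {x | 0 < (h - inner ℝ e x) / inner ℝ e v ∧
        (h - inner ℝ e x) / inner ℝ e v < δ})
      = ENNReal.ofReal (|inner ℝ e v| * δ) * (μHE[N - 1] : Measure E) A := by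
  have : IsFiniteMeasure ((μHE[N - 1] : Measure E).restrict A) :=
    ⟨by rw [Measure.restrict_apply_univ]; exact hfin.lt_top⟩
  set S : Set (ℝ × E) := {q | 0 < (q.1 - inner ℝ e q.2) / inner ℝ e v ∧
    (q.1 - inner ℝ e q.2) / inner ℝ e v < δ} with hS
  have hg : Measurable fun q : ℝ × E => (q.1 - inner ℝ e q.2) / inner ℝ e v := by fun_prop
  have hSm : MeasurableSet S :=
    (measurableSet_lt measurable_const hg).inter (measurableSet_lt hg measurable_const)
  have h1 : ∀ h : ℝ, (μHE[N - 1] : Measure E) (A ∩ {x | 0 < (h - inner ℝ e x) / inner ℝ e v ∧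
      (h - inner ℝ e x) / inner ℝ e v < δ})
      = ((μHE[N - 1] : Measure E).restrict A) (Prod.mk h ⁻¹' S) := by
    intro h
    rw [Measure.restrict_apply (measurable_prodMk_left hSm), inter_comm]
    rfl
  simp_rw [h1]
  rw [← Measure.prod_apply hSm, Measure.prod_apply_symm hSm]
  have h2 : ∀ x : E, volume ((fun h : ℝ => (h, x)) ⁻¹' S) = ENNReal.ofReal (|inner ℝ e v| * δ) := by
    intro x
    rcases lt_or_gt_of_ne hv with hneg | hpos
    · have : (fun h : ℝ => (h, x)) ⁻¹' S = Ioo (inner ℝ e x + inner ℝ e v * δ) (inner ℝ e x) := by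
        ext h
        simp only [hS, mem_preimage, mem_ofPred_eq, mem_Ioo]
        rw [lt_div_iff_of_neg hneg, div_lt_iff_of_neg hneg]
        constructor <;> rintro ⟨h1, h2⟩ <;> constructor <;> linarith
      rw [this, Real.volume_Ioo, abs_of_neg hneg]
      congr 1; ring
    · have : (fun h : ℝ => (h, x)) ⁻¹' S = Ioo (inner ℝ e x) (inner ℝ e x + inner ℝ e v * δ) := by
        ext h
        simp only [hS, mem_preimage, mem_ofPred_eq, mem_Ioo]
        rw [lt_div_iff₀ hpos, div_lt_iff₀ hpos]
        constructor <;> rintro ⟨h1, h2⟩ <;> constructor <;> linarith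
      rw [this, Real.volume_Ioo, abs_of_pos hpos]
      congr 1; ring
  simp_rw [h2]
  rw [lintegral_const, Measure.restrict_apply_univ]

/-- The slice at height `h` of the tube over `A` consists of the points of `A` that reach this
height along `v` within the time `δ`. -/
lemma tube_slice {e v : E} (he : ‖e‖ = 1) (hv : inner ℝ e v ≠ 0) (A : Set E) (δ h : ℝ) :
    tube A v δ ∩ AffineSubspace.mk' (h • e +ᵥ (0 : E)) (ℝ ∙ e)ᗮ =
      slideTo e v h '' (A ∩ {x | 0 < (h - inner ℝ e x) / inner ℝ e v ∧
        (h - inner ℝ e x) / inner ℝ e v < δ}) := by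
  have hmem : ∀ y : E, y ∈ AffineSubspace.mk' (h • e +ᵥ (0 : E)) (ℝ ∙ e)ᗮ ↔ inner ℝ e y = h := by
    intro y
    rw [AffineSubspace.mem_mk', Submodule.mem_orthogonal_singleton_iff_inner_right]
    simp only [vadd_eq_add, add_zero, vsub_eq_sub, inner_sub_right, real_inner_smul_right,
      real_inner_self_eq_norm_sq, he]
    constructor <;> intro h <;> linarith
  ext y
  simp only [mem_inter_iff, SetLike.mem_coe, hmem, mem_image, mem_ofPred_eq]
  constructor
  · rintro ⟨⟨x, hx, s, hs0, hs1, rfl⟩, hy⟩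
    have : (h - inner ℝ e x) / inner ℝ e v = s := by
      rw [← hy, inner_add_right, real_inner_smul_right]
      field_simp
      ring
    exact ⟨x, ⟨hx, by rwa [this], by rwa [this]⟩, by rw [slideTo, this]⟩
  · rintro ⟨x, ⟨hx, h1, h2⟩, rfl⟩
    refine ⟨⟨x, hx, _, h1, h2, rfl⟩, ?_⟩
    rw [slideTo, inner_add_right, real_inner_smul_right, div_mul_cancel₀ _ hv]
    ring

/-- Lebesgue measure by slices orthogonal to the unit vector `e`. -/
lemma volume_eq_lintegral_slices {e : E} (he : ‖e‖ = 1) {T : Set E} (hT : MeasurableSet T) :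
    volume T = ∫⁻ h : ℝ, (μHE[N - 1] : Measure E)
      (T ∩ AffineSubspace.mk' (h • e +ᵥ (0 : E)) (ℝ ∙ e)ᗮ) := by
  have he0 : e ≠ 0 := by rintro rfl; simp at he
  have := EuclideanGeometry.euclideanHausdorffMeasure_eq_lintegral (0 : E) he0 hT
  rw [finrank_euclideanSpace, Fintype.card_fin,
    EuclideanSpace.euclideanHausdorffMeasure_eq_volume] at this
  rw [this, enorm_eq_nnnorm, show ‖e‖₊ = 1 from NNReal.eq he, ENNReal.coe_one, one_mul]

lemma IsFlat.mono {e v : E} {A B : Set E} (hA : IsFlat e v A) (h : B ⊆ A) : IsFlat e v B :=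
  fun x hx y hy => hA x (h hx) y (h hy)

lemma IsFlat.volume_tube_le {e v : E} (he : ‖e‖ = 1) (hv : inner ℝ e v ≠ 0) {A : Set E}
    (hflat : IsFlat e v A) (hfin : (μHE[N - 1] : Measure E) A ≠ ⊤) {δ : ℝ}
    (hT : MeasurableSet (tube A v δ)) :
    volume (tube A v δ) ≤
      2 ^ (N - 1) * (ENNReal.ofReal (|inner ℝ e v| * δ) * (μHE[N - 1] : Measure E) A) := by
  rw [volume_eq_lintegral_slices he hT, ← lintegral_tube_heights hv hfin,
    ← lintegral_const_mul' _ _ (by simp)]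
  refine lintegral_mono fun h => ?_
  rw [tube_slice he hv]
  exact (hflat.mono inter_subset_left).measure_slideTo_le hv h _

lemma IsFlat.le_volume_tube {e v : E} (he : ‖e‖ = 1) (hv : inner ℝ e v ≠ 0) {A : Set E}
    (hflat : IsFlat e v A) (hfin : (μHE[N - 1] : Measure E) A ≠ ⊤) {δ : ℝ}
    (hT : MeasurableSet (tube A v δ)) :
    ENNReal.ofReal (|inner ℝ e v| * δ) * (μHE[N - 1] : Measure E) A ≤
      2 ^ (N - 1) * volume (tube A v δ) := by
  rw [volume_eq_lintegral_slices he hT, ← lintegral_tube_heights hv hfin,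
    ← lintegral_const_mul' _ _ (by simp)]
  refine lintegral_mono fun h => ?_
  rw [tube_slice he hv]
  exact (hflat.mono inter_subset_left).le_measure_slideTo hv h _

/-- A flat bounded patch has finite surface measure: it is bi-Lipschitz to a bounded subset of a
hyperplane. -/
lemma measure_lt_top_of_flat {e : E} (he : ‖e‖ = 1) {A : Set E} (hflat : IsFlat e e A)
    (hb : Bornology.IsBounded A) : (μHE[N - 1] : Measure E) A < ⊤ := by
  have he0 : e ≠ 0 := by rintro rfl; simp at he
  -- sliding along `e` to height `0` is the orthogonal projection to the hyperplane `eᗮ`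
  set T : Submodule ℝ E := (ℝ ∙ e)ᗮ with hT
  have hN : Module.finrank ℝ T = N - 1 := by
    have h1 : Module.finrank ℝ (ℝ ∙ e) + Module.finrank ℝ T = Module.finrank ℝ E :=
      (ℝ ∙ e).finrank_add_finrank_orthogonal
    rw [finrank_span_singleton he0, finrank_euclideanSpace, Fintype.card_fin] at h1
    omega
  set P : E → T := fun x => T.orthogonalProjectionOnto x with hP
  have hlip : LipschitzWith 1 P := T.lipschitzWith_orthogonalProjectionOnto
  have hval : ∀ x, ((P x : T) : E) = slideTo e e 0 x := by
    intro x
    have : ((P x : T) : E) = x - (inner ℝ e x) • e := by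
      have := Submodule.starProjection_orthogonal_val (K := ℝ ∙ e) x
      rw [Submodule.starProjection_unit_singleton ℝ he] at this
      exact this
    rw [this, slideTo, real_inner_self_eq_norm_sq, he]
    simp [sub_eq_add_neg]
  have h1 : (μHE[N - 1] : Measure E) A ≤ (2 : ℝ≥0) ^ (N - 1) * (μHE[N - 1] : Measure T) (P '' A) := by
    refine euclideanHausdorffMeasure_le_image (K := 2) ?_ _
    intro x hx y hy
    have hv : inner ℝ e e ≠ 0 := by rw [real_inner_self_eq_norm_sq, he]; norm_num
    have h1 := hflat.slideTo_sub hv 0 hx hy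
    have h2 := norm_sub_norm_le (x - y) (slideTo e e 0 x - slideTo e e 0 y)
    rw [norm_sub_rev (x - y)] at h2
    rw [Subtype.dist_eq, hval, hval, dist_eq_norm, dist_eq_norm]
    push_cast
    linarith
  refine h1.trans_lt (ENNReal.mul_lt_top (by simp) ?_)
  have hfin : Bornology.IsBounded (P '' A) := hlip.isBounded_image hb
  rw [← hN]
  exact hfin.measure_lt_top

end Tubes

/-! ### The outward normal -/

section Normal

variable {N : ℕ} {D : Set (EuclideanSpace ℝ (Fin N))}

local notation "E" => EuclideanSpace ℝ (Fin N)

lemma IsDefiningFunctionAt.hasStrictFDerivAt {x : E} {ρ : E → ℝ}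
    (h : IsDefiningFunctionAt D x ρ) : HasStrictFDerivAt ρ (innerSL ℝ (gradient ρ x)) x := by
  obtain ⟨W, hWo, hxW, hρ, -, -, -⟩ := h
  have h1 : ContDiffAt ℝ ∞ ρ x := hρ.contDiffAt (hWo.mem_nhds hxW)
  have h2 := h1.hasStrictFDerivAt (by simp)
  have h3 : fderiv ℝ ρ x = innerSL ℝ (gradient ρ x) := by
    have := (h2.hasFDerivAt.differentiableAt.hasGradientAt).hasFDerivAt.fderiv
    rw [this]
    ext y
    simp
  rwa [h3] at h2

lemma IsDefiningFunctionAt.hasDerivAt_line {x : E} {ρ : E → ℝ}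
    (h : IsDefiningFunctionAt D x ρ) (w : E) :
    HasDerivAt (fun s : ℝ => ρ (x + s • w)) (inner ℝ (gradient ρ x) w) 0 := by
  have h1 : HasFDerivAt ρ (innerSL ℝ (gradient ρ x)) (x + (0 : ℝ) • w) := by
    simpa using h.hasStrictFDerivAt.hasFDerivAt
  have h2 : HasDerivAt (fun s : ℝ => x + s • w) w 0 := by
    simpa using ((hasDerivAt_id (0 : ℝ)).smul_const w).const_add x
  have h3 := h1.comp_hasDerivAt 0 h2
  rw [innerSL_apply_apply] at h3
  exact h3

/-- A direction along which the defining function decreases points into the domain. -/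
lemma IsDefiningFunctionAt.mem_of_inner_neg {x : E} {ρ : E → ℝ}
    (h : IsDefiningFunctionAt D x ρ) {w : E} (hw : inner ℝ (gradient ρ x) w < 0) :
    ∀ᶠ s in 𝓝[>] (0 : ℝ), x + s • w ∈ D := by
  have h1 := (h.hasDerivAt_line w)
  obtain ⟨W, hWo, hxW, -, hx0, -, hW⟩ := h
  have h2 : ∀ᶠ s in 𝓝 (0 : ℝ), x + s • w ∈ W := by
    have : Continuous fun s : ℝ => x + s • w := by fun_prop
    exact this.continuousAt.preimage_mem_nhds (by simpa using hWo.mem_nhds hxW)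
  have h3 := h1.hasDerivWithinAt (s := Ioi 0)
  rw [hasDerivWithinAt_iff_tendsto_slope' (by simp)] at h3
  filter_upwards [h3.eventually_lt_const hw, nhdsWithin_le_nhds h2, self_mem_nhdsWithin]
    with s hs1 hs2 hs3
  rw [hW _ hs2]
  rw [slope_def_field] at hs1
  simp only [zero_smul, add_zero, hx0, sub_zero] at hs1
  have : (0 : ℝ) < s := hs3
  rw [div_lt_iff₀ this] at hs1
  linarith

/-- A direction that points into the domain at arbitrarily small times makes an obtuse or right angle
with the gradient of the defining function. -/
lemma IsDefiningFunctionAt.inner_nonpos {x : E} {ρ : E → ℝ}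
    (h : IsDefiningFunctionAt D x ρ) {w : E} (hw : ∃ᶠ s in 𝓝[>] (0 : ℝ), x + s • w ∈ D) :
    inner ℝ (gradient ρ x) w ≤ 0 := by
  have h1 := (h.hasDerivAt_line w)
  obtain ⟨W, hWo, hxW, -, hx0, -, hW⟩ := h
  have h2 : ∀ᶠ s in 𝓝 (0 : ℝ), x + s • w ∈ W := by
    have : Continuous fun s : ℝ => x + s • w := by fun_prop
    exact this.continuousAt.preimage_mem_nhds (by simpa using hWo.mem_nhds hxW)
  have h3 := h1.hasDerivWithinAt (s := Ioi 0)
  rw [hasDerivWithinAt_iff_tendsto_slope' (by simp)] at h3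
  by_contra! hlt
  obtain ⟨s, hs, h4, h5, h6⟩ := (hw.and_eventually ((h3.eventually_const_lt hlt).and
    ((h2.filter_mono nhdsWithin_le_nhds).and self_mem_nhdsWithin))).exists
  rw [hW _ h5] at hs
  rw [slope_def_field] at h4
  simp only [zero_smul, add_zero, hx0, sub_zero] at h4
  have : (0 : ℝ) < s := h6
  have := div_neg_of_neg_of_pos hs this
  linarith

lemma IsDefiningFunctionAt.norm_normal {x : E} {ρ : E → ℝ} (h : IsDefiningFunctionAt D x ρ) :
    ‖‖gradient ρ x‖⁻¹ • gradient ρ x‖ = 1 := by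
  obtain ⟨W, -, -, -, -, hg, -⟩ := h
  rw [norm_smul, norm_inv, norm_norm, inv_mul_cancel₀ (norm_ne_zero_iff.2 hg)]

/-- The normal does not depend on the defining function: the half-spaces of inward directions
coincide. -/
lemma IsDefiningFunctionAt.outwardNormal_eq {x : E} {ρ : E → ℝ}
    (h : IsDefiningFunctionAt D x ρ) : outwardNormal D x = ‖gradient ρ x‖⁻¹ • gradient ρ x := by
  have hex : ∃ ρ, IsDefiningFunctionAt D x ρ := ⟨ρ, h⟩
  have h' := hex.choose_spec
  rw [outwardNormal, dif_pos hex]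
  set ρ' := hex.choose
  set n := ‖gradient ρ x‖⁻¹ • gradient ρ x with hn
  set n' := ‖gradient ρ' x‖⁻¹ • gradient ρ' x with hn'
  by_contra hne
  have h1 : inner ℝ n' n < (1 : ℝ) :=
    inner_lt_one_iff_real_of_norm_eq_one h'.norm_normal h.norm_normal |>.2 hne
  have hpos : 0 < ‖gradient ρ x‖⁻¹ := by
    obtain ⟨W, -, -, -, -, hg, -⟩ := h
    exact inv_pos.2 (norm_pos_iff.2 hg)
  have hpos' : 0 < ‖gradient ρ' x‖⁻¹ := by
    obtain ⟨W, -, -, -, -, hg, -⟩ := h'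
    exact inv_pos.2 (norm_pos_iff.2 hg)
  have h2 : inner ℝ n' (n - n') = inner ℝ n' n - 1 := by
    rw [inner_sub_right, real_inner_self_eq_norm_sq, h'.norm_normal]; ring
  have h3 : inner ℝ n (n - n') = 1 - inner ℝ n' n := by
    rw [inner_sub_right, real_inner_self_eq_norm_sq, h.norm_normal, real_inner_comm]; ring
  have h4 : inner ℝ (gradient ρ' x) (n - n') < 0 := by
    have : inner ℝ n' (n - n') < 0 := by rw [h2]; linarith
    rw [hn', real_inner_smul_left, ← hn'] at this
    exact (pos_iff_neg_of_mul_neg this).1 hpos'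
  have h5 := h.inner_nonpos (h'.mem_of_inner_neg h4).frequently
  have h6 : 0 < inner ℝ n (n - n') := by rw [h3]; linarith
  rw [hn, real_inner_smul_left, ← hn] at h6
  have := (pos_iff_pos_of_mul_pos h6).1 hpos
  linarith

lemma IsDefiningFunctionAt.exists_eq {x : E} {ρ : E → ℝ} (h : IsDefiningFunctionAt D x ρ) :
    ∃ c : ℝ, 0 < c ∧ outwardNormal D x = c • gradient ρ x := by
  refine ⟨‖gradient ρ x‖⁻¹, ?_, h.outwardNormal_eq⟩
  obtain ⟨W, -, -, -, -, hg, -⟩ := h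
  exact inv_pos.2 (norm_pos_iff.2 hg)

lemma norm_outwardNormal (hDs : HasSmoothBoundary D) {x : E} (hx : x ∈ frontier D) :
    ‖outwardNormal D x‖ = 1 := by
  obtain ⟨ρ, hρ⟩ := hDs x hx
  rw [hρ.outwardNormal_eq, hρ.norm_normal]

lemma IsDefiningFunctionAt.eventually (hDo : IsOpen D) {x : E} {ρ : E → ℝ}
    (h : IsDefiningFunctionAt D x ρ) :
    ∀ᶠ y in 𝓝[frontier D] x, ρ y = 0 ∧ IsDefiningFunctionAt D y ρ := by
  obtain ⟨W, hWo, hxW, hρ, hx0, hg, hW⟩ := h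
  have hcg : ContinuousAt (gradient ρ) x := by
    have h1 : ContinuousOn (fderiv ℝ ρ) W := hρ.continuousOn_fderiv_of_isOpen hWo (by simp)
    have h2 : ContinuousAt (fderiv ℝ ρ) x := h1.continuousAt (hWo.mem_nhds hxW)
    exact ((InnerProductSpace.toDual ℝ E).symm.continuous.continuousAt).comp h2
  filter_upwards [nhdsWithin_le_nhds (hWo.mem_nhds hxW), nhdsWithin_le_nhds
    (hcg.eventually_ne hg), self_mem_nhdsWithin] with y hyW hyg hy
  have hy0 : ρ y = 0 := by
    apply le_antisymm
    · by_contra! hlt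
      have h1 : ContinuousAt ρ y := hρ.continuousOn.continuousAt (hWo.mem_nhds hyW)
      have h2 : ∀ᶠ w in 𝓝 y, w ∉ D := by
        filter_upwards [h1.eventually_const_lt hlt, hWo.mem_nhds hyW] with w hw hwW hwD
        exact absurd ((hW w hwW).1 hwD) (not_lt.2 hw.le)
      have h3 := mem_closure_iff_frequently.1 (frontier_subset_closure hy)
      exact h3 h2
    · by_contra! hlt
      rw [hDo.frontier_eq] at hy
      exact hy.2 ((hW y hyW).2 hlt)
  exact ⟨hy0, W, hWo, hyW, hρ, hy0, hyg, hW⟩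

lemma continuousOn_outwardNormal (hDo : IsOpen D) (hDs : HasSmoothBoundary D) :
    ContinuousOn (outwardNormal D) (frontier D) := by
  intro x hx
  obtain ⟨ρ, hρ⟩ := hDs x hx
  have h1 : (fun y => ‖gradient ρ y‖⁻¹ • gradient ρ y) =ᶠ[𝓝[frontier D] x] outwardNormal D := by
    filter_upwards [hρ.eventually hDo] with y hy using hy.2.outwardNormal_eq.symm
  have h2 : ContinuousAt (fun y => ‖gradient ρ y‖⁻¹ • gradient ρ y) x := by
    obtain ⟨W, hWo, hxW, hs, hx0, hg, hW⟩ := hρ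
    have h1 : ContinuousOn (fderiv ℝ ρ) W := hs.continuousOn_fderiv_of_isOpen hWo (by simp)
    have h2 : ContinuousAt (fderiv ℝ ρ) x := h1.continuousAt (hWo.mem_nhds hxW)
    have hcg : ContinuousAt (gradient ρ) x :=
      ((InnerProductSpace.toDual ℝ E).symm.continuous.continuousAt).comp h2
    exact (hcg.norm.inv₀ (norm_ne_zero_iff.2 hg)).smul hcg
  exact h2.continuousWithinAt.congr_of_eventuallyEq h1.symm hρ.outwardNormal_eq

/-- Near a boundary point the boundary is almost orthogonal to the normal at that point. -/
lemma frontier_flat (hDo : IsOpen D) (hDs : HasSmoothBoundary D) {x : E} (hx : x ∈ frontier D)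
    {ε : ℝ} (hε : 0 < ε) :
    ∃ O : Set E, IsOpen O ∧ x ∈ O ∧ Bornology.IsBounded O ∧
      ∀ y ∈ O ∩ frontier D, ∀ w ∈ O ∩ frontier D,
      |inner ℝ (outwardNormal D x) (y - w)| ≤ ε * ‖y - w‖ := by
  obtain ⟨ρ, hρ⟩ := hDs x hx
  obtain ⟨c, hc, hn⟩ := hρ.exists_eq
  have h1 := hρ.hasStrictFDerivAt.isLittleO.def (div_pos hε hc)
  have h2 := hρ.eventually hDo
  rw [eventually_nhdsWithin_iff] at h2
  rw [nhds_prod_eq] at h1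
  obtain ⟨p, hp, q, hq, h3⟩ := eventually_prod_iff.1 h1
  obtain ⟨O, hO, hOo, hxO⟩ := eventually_nhds_iff.1 (hp.and (hq.and h2))
  refine ⟨O ∩ Metric.ball x 1, hOo.inter Metric.isOpen_ball, ⟨hxO, Metric.mem_ball_self one_pos⟩,
    Metric.isBounded_ball.subset inter_subset_right, ?_⟩
  rintro y ⟨⟨hy, -⟩, hyf⟩ w ⟨⟨hw, -⟩, hwf⟩
  have h4 := h3 (hO y hy).1 (hO w hw).2.1
  simp only [((hO y hy).2.2 hyf).1, ((hO w hw).2.2 hwf).1, sub_self, zero_sub, norm_neg,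
    innerSL_apply_apply, Real.norm_eq_abs] at h4
  rw [hn, real_inner_smul_left, abs_mul, abs_of_pos hc]
  calc c * |inner ℝ (gradient ρ x) (y - w)| ≤ c * (ε / c * ‖y - w‖) := by gcongr
    _ = ε * ‖y - w‖ := by field_simp

/-- The tangent hyperplane of a convex domain supports it strictly. -/
lemma inner_outwardNormal_neg (hDo : IsOpen D) (hDc : Convex ℝ D) (hDs : HasSmoothBoundary D)
    {x y : E} (hx : x ∈ frontier D) (hy : y ∈ D) : inner ℝ (outwardNormal D x) (y - x) < 0 := by
  obtain ⟨ρ, hρ⟩ := hDs x hx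
  obtain ⟨c, hc, hn⟩ := hρ.exists_eq
  have hle : ∀ y ∈ D, inner ℝ (outwardNormal D x) (y - x) ≤ 0 := by
    intro y hy
    rw [hn, real_inner_smul_left]
    refine mul_nonpos_of_nonneg_of_nonpos hc.le (hρ.inner_nonpos (Eventually.frequently ?_))
    filter_upwards [self_mem_nhdsWithin, nhdsWithin_le_nhds (eventually_lt_nhds one_pos)]
      with s hs0 hs1
    have hs0 : (0 : ℝ) < s := hs0
    have := hDc.combo_interior_closure_mem_interior (by rwa [hDo.interior_eq])
      (frontier_subset_closure hx) hs0 (sub_nonneg.2 hs1.le) (add_sub_cancel s 1)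
    rw [hDo.interior_eq] at this
    convert this using 1
    module
  have hcont : Continuous fun s : ℝ => y + s • outwardNormal D x := by fun_prop
  have h1 : ∀ᶠ s in 𝓝[>] (0 : ℝ), y + s • outwardNormal D x ∈ D :=
    nhdsWithin_le_nhds (hcont.continuousAt.preimage_mem_nhds (hDo.mem_nhds (by simpa using hy)))
  obtain ⟨s, hs, hs0⟩ := (h1.and self_mem_nhdsWithin).exists
  have hs0 : (0 : ℝ) < s := hs0
  have h2 := hle _ hs
  rw [show y + s • outwardNormal D x - x = (y - x) + s • outwardNormal D x by abel,
    inner_add_right, real_inner_smul_right, real_inner_self_eq_norm_sq,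
    norm_outwardNormal hDs hx] at h2
  linarith

/-- The entrances are the incoming boundary pairs that are not tangential. -/
lemma isEntrance_iff_inner_neg (hDo : IsOpen D) (hDc : Convex ℝ D) (hDb : Bornology.IsBounded D)
    (hDs : HasSmoothBoundary D) (b : Phase N) :
    IsEntrance D b ↔ b.1 ∈ frontier D ∧ inner ℝ b.2 (outwardNormal D b.1) < 0 := by
  constructor
  · intro h
    have hb : b.1 ∈ frontier D := by
      rw [hDo.frontier_eq]
      refine ⟨?_, ((isEntrance_iff hDo hDc hDb b).1 h).2.1⟩
      have h1 : Tendsto (fun s : ℝ => b.1 + s • b.2) (𝓝[>] 0) (𝓝 b.1) := by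
        have : Continuous fun s : ℝ => b.1 + s • b.2 := by fun_prop
        simpa using (this.tendsto 0).mono_left nhdsWithin_le_nhds
      refine mem_closure_of_tendsto h1 ?_
      filter_upwards [self_mem_nhdsWithin, nhdsWithin_le_nhds (eventually_lt_nhds h.tau_pos)]
        with s hs0 hs1
      exact (h.mem_iff s).2 ⟨hs0, hs1⟩
    refine ⟨hb, ?_⟩
    have h1 : b.1 + (tau D b / 2) • b.2 ∈ D :=
      (h.mem_iff _).2 ⟨half_pos h.tau_pos, half_lt_self h.tau_pos⟩
    have h2 := inner_outwardNormal_neg hDo hDc hDs hb h1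
    rw [add_sub_cancel_left, real_inner_smul_right, real_inner_comm] at h2
    exact (pos_iff_neg_of_mul_neg h2).1 (half_pos h.tau_pos)
  · rintro ⟨hb, hneg⟩
    have hb' : b.1 ∉ D := by rw [hDo.frontier_eq] at hb; exact hb.2
    have hv : b.2 ≠ 0 := by intro h; simp [h] at hneg
    obtain ⟨ρ, hρ⟩ := hDs _ hb
    obtain ⟨c, hc, hn⟩ := hρ.exists_eq
    rw [hn, real_inner_smul_right, real_inner_comm] at hneg
    have h1 := hρ.mem_of_inner_neg ((pos_iff_neg_of_mul_neg hneg).1 hc)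
    obtain ⟨δ, hδ, h2⟩ := (nhdsGT_basis (0 : ℝ)).eventually_iff.1 h1
    exact (isEntrance_of_not_mem hDo hDc hDb hb' hv (half_pos hδ) fun s hs0 hs1 =>
      h2 ⟨hs0, by linarith⟩).1

/-- Entering pairs near a given one stay inside the domain for a uniform time. -/
lemma exists_lt_tau (hDo : IsOpen D) {b : Phase N} (hb : IsEntrance D b) :
    ∃ δ > 0, ∀ᶠ c in 𝓝 b, IsEntrance D c → δ < tau D c := by
  refine ⟨tau D b / 2, half_pos hb.tau_pos, ?_⟩
  have h1 : b.1 + (tau D b / 2) • b.2 ∈ D :=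
    (hb.mem_iff _).2 ⟨half_pos hb.tau_pos, half_lt_self hb.tau_pos⟩
  have h2 : ContinuousAt (fun c : Phase N => c.1 + (tau D b / 2) • c.2) b := by fun_prop
  filter_upwards [h2.preimage_mem_nhds (hDo.mem_nhds h1)] with c hc hce
  exact ((hce.mem_iff _).1 hc).2

end Normal

/-! ### Comparison of the flux measure with the chord measure -/

section Flux

variable {N : ℕ} {D : Set (EuclideanSpace ℝ (Fin N))}

local notation "E" => EuclideanSpace ℝ (Fin N)

/-- Surface measure on the boundary of `D`. -/
def surfaceMeasure (D : Set (EuclideanSpace ℝ (Fin N))) : Measure (EuclideanSpace ℝ (Fin N)) :=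
  (μHE[N - 1] : Measure (EuclideanSpace ℝ (Fin N))).restrict (frontier D)

lemma measure_frontier_lt_top (hDo : IsOpen D) (hDb : Bornology.IsBounded D)
    (hDs : HasSmoothBoundary D) : (μHE[N - 1] : Measure E) (frontier D) < ⊤ := by
  have hcomp : IsCompact (frontier D) :=
    Metric.isCompact_of_isClosed_isBounded isClosed_frontier
      (hDb.closure.subset frontier_subset_closure)
  refine hcomp.measure_lt_top_of_nhdsWithin fun x hx => ?_
  obtain ⟨O, hO, hxO, hOb, hfl⟩ := frontier_flat hDo hDs hx (ε := 1 / 2) (by norm_num)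
  refine ⟨O ∩ frontier D, inter_mem (mem_nhdsWithin_of_mem_nhds (hO.mem_nhds hxO))
    self_mem_nhdsWithin, ?_⟩
  have he := norm_outwardNormal hDs hx
  refine measure_lt_top_of_flat he ?_ (hOb.subset inter_subset_left)
  intro y hy w hw
  have := hfl y hy w hw
  rw [he, real_inner_self_eq_norm_sq, he]
  norm_num
  linarith

lemma isFiniteMeasure_surfaceMeasure (hDo : IsOpen D) (hDb : Bornology.IsBounded D)
    (hDs : HasSmoothBoundary D) : IsFiniteMeasure (surfaceMeasure D) :=
  ⟨by rw [surfaceMeasure, Measure.restrict_apply_univ]; exact measure_frontier_lt_top hDo hDb hDs⟩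

/-- The normal, extended by zero to a Borel function. -/
def normalExt (D : Set (EuclideanSpace ℝ (Fin N))) :
    EuclideanSpace ℝ (Fin N) → EuclideanSpace ℝ (Fin N) := (frontier D).indicator (outwardNormal D)

lemma measurable_normalExt (hDo : IsOpen D) (hDs : HasSmoothBoundary D) :
    Measurable (normalExt D) := by
  classical
  have := (continuousOn_outwardNormal hDo hDs).measurable_piecewise
    (continuousOn_const (c := (0 : E))) isClosed_frontier.measurableSet
  convert this using 1
  exact Set.piecewise_eq_indicator.symm

lemma measurable_fluxDensity (hDo : IsOpen D) (hDs : HasSmoothBoundary D) :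
    Measurable fun z : Phase N => ENNReal.ofReal |inner ℝ z.2 (normalExt D z.1)| := by
  have : Measurable fun z : Phase N => normalExt D z.1 :=
    (measurable_normalExt hDo hDs).comp measurable_fst
  exact (continuous_abs.measurable.comp (measurable_snd.inner this)).ennreal_ofReal

lemma fluxMeasure_eq : fluxMeasure D = ((surfaceMeasure D).prod volume).withDensity
    (fun z => ENNReal.ofReal |inner ℝ z.2 (normalExt D z.1)|) := by
  rw [fluxMeasure, ← surfaceMeasure]
  refine withDensity_congr_ae ?_
  have h1 : ∀ᵐ x ∂surfaceMeasure D, x ∈ frontier D :=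
    ae_restrict_mem isClosed_frontier.measurableSet
  have h2 : ∀ᵐ z ∂(surfaceMeasure D).prod (volume : Measure E), z.1 ∈ frontier D :=
    Measure.quasiMeasurePreserving_fst.ae h1
  filter_upwards [h2] with z hz
  rw [normalExt, indicator_of_mem hz]

lemma fluxMeasure_apply (hDo : IsOpen D) (hDb : Bornology.IsBounded D)
    (hDs : HasSmoothBoundary D) {A : Set (Phase N)} (hA : MeasurableSet A) :
    fluxMeasure D A = ∫⁻ v, ∫⁻ x in {x | (x, v) ∈ A},
      ENNReal.ofReal |inner ℝ v (normalExt D x)| ∂surfaceMeasure D := by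
  have := isFiniteMeasure_surfaceMeasure hDo hDb hDs
  rw [fluxMeasure_eq, withDensity_apply _ hA, ← lintegral_indicator hA, lintegral_prod_symm _
    ((measurable_fluxDensity hDo hDs).indicator hA).aemeasurable]
  refine lintegral_congr fun v => ?_
  have hAv : MeasurableSet {x | (x, v) ∈ A} := measurable_prodMk_right hA
  rw [← lintegral_indicator hAv]
  rfl

/-- Pairs on the chord starting in `A`, up to the time `δ`. -/
def flowTube (D : Set (EuclideanSpace ℝ (Fin N))) (A : Set (Phase N)) (δ : ℝ) : Set (Phase N) :=
  {z | (z.1 ∈ D ∧ z.2 ≠ 0) ∧ entry D z ∈ A ∧ tMinus D z < δ}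

lemma measurableSet_flowTube (hDo : IsOpen D) (hDb : Bornology.IsBounded D) {A : Set (Phase N)}
    (hA : MeasurableSet A) (δ : ℝ) : MeasurableSet (flowTube D A δ) :=
  (((hDo.measurableSet.preimage measurable_fst).inter
    ((measurableSet_singleton 0).preimage measurable_snd).compl)).inter
    ((hA.preimage (measurable_entry hDo hDb)).inter
      (measurableSet_lt (measurable_tMinus hDo hDb) measurable_const))

lemma flowTube_section (hDo : IsOpen D) (hDc : Convex ℝ D) (hDb : Bornology.IsBounded D)
    {A : Set (Phase N)} {δ : ℝ} (hA : ∀ b ∈ A, IsEntrance D b ∧ δ < tau D b) (v : E) :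
    {x | (x, v) ∈ flowTube D A δ} = tube {x | (x, v) ∈ A} v δ := by
  ext y
  constructor
  · rintro ⟨hin, h1, h2⟩
    obtain ⟨h3, h4, h5, h6, h7⟩ := isEntrance_entry hDo hDc hDb hin.1 hin.2
    refine ⟨(entry D (y, v)).1, h1, tMinus D (y, v), h6, h2, ?_⟩
    exact (congrArg Prod.fst h5).symm
  · rintro ⟨x, hx, s, hs0, hs1, rfl⟩
    obtain ⟨h1, h2⟩ := hA _ hx
    have h3 : s ≤ tau D (x, v) := hs1.le.trans h2.le
    refine ⟨⟨(h1.mem_iff s).2 ⟨hs0, hs1.trans h2⟩, h1.snd_ne_zero⟩, ?_, ?_⟩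
    · change entry D (flow s (x, v)) ∈ A
      rw [h1.entry_flow hs0.le h3]; exact hx
    · change tMinus D (flow s (x, v)) < δ
      rwa [h1.tMinus_flow hs0.le h3]

/-- The chord measure of a set of entrances whose chords last longer than `δ` is the volume of the
tube of duration `δ` over it, divided by `δ`. -/
lemma chordMeasure_mul (hN : 1 ≤ N) (hDo : IsOpen D) (hDc : Convex ℝ D)
    (hDb : Bornology.IsBounded D) {A : Set (Phase N)} (hA : MeasurableSet A) {δ : ℝ}
    (hAe : ∀ b ∈ A, IsEntrance D b ∧ δ < tau D b) :
    ENNReal.ofReal δ * chordMeasure D A = volume (flowTube D A δ) := by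
  have hm := measurableSet_flowTube hDo hDb hA δ
  have h1 : volume (flowTube D A δ) = ∫⁻ z, (flowTube D A δ).indicator 1 z ∂phaseMeasure D := by
    rw [lintegral_indicator_one hm, phaseMeasure, Measure.restrict_apply hm]
    congr 1
    ext z
    simp only [mem_inter_iff, mem_prod, mem_univ, and_true]
    exact ⟨fun h => ⟨h, h.1.1⟩, fun h => h.1⟩
  rw [h1, ← lintegral_chord hN hDo hDc hDb (measurable_one.indicator hm)]
  have h2 : ENNReal.ofReal δ * chordMeasure D A
      = ∫⁻ b, A.indicator (fun _ => ENNReal.ofReal δ) b ∂chordMeasure D := by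
    rw [lintegral_indicator hA, setLIntegral_const]
  rw [h2]
  refine lintegral_congr_ae ?_
  filter_upwards [ae_isEntrance hN hDo hDc hDb] with b hb
  by_cases hbA : b ∈ A
  · rw [indicator_of_mem hbA, ← lintegral_indicator measurableSet_Ioo]
    have : ∀ s, (Ioo 0 (tau D b)).indicator
        (fun s => (flowTube D A δ).indicator (1 : Phase N → ℝ≥0∞) (flow s b)) s
        = (Ioo 0 δ).indicator (fun _ => 1) s := by
      intro s
      by_cases hs : s ∈ Ioo 0 (tau D b)
      · rw [indicator_of_mem hs]
        have h3 : flow s b ∈ flowTube D A δ ↔ s ∈ Ioo 0 δ := by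
          have h4 : entry D (flow s b) = b := hb.entry_flow hs.1.le hs.2.le
          have h5 : tMinus D (flow s b) = s := hb.tMinus_flow hs.1.le hs.2.le
          constructor
          · rintro ⟨-, -, h⟩; exact ⟨hs.1, by rwa [h5] at h⟩
          · intro h
            exact ⟨⟨(hb.mem_iff s).2 hs, hb.snd_ne_zero⟩, by rwa [h4], by rw [h5]; exact h.2⟩
        by_cases h : s ∈ Ioo 0 δ
        · rw [indicator_of_mem h, indicator_of_mem (h3.2 h)]; rfl
        · rw [indicator_of_notMem h, indicator_of_notMem (fun h' => h (h3.1 h'))]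
      · rw [indicator_of_notMem hs, indicator_of_notMem]
        exact fun h => hs ⟨h.1, h.2.trans (hAe b hbA).2⟩
    simp_rw [this]
    rw [lintegral_indicator measurableSet_Ioo, setLIntegral_const, Real.volume_Ioo, sub_zero,
      one_mul]
  · rw [indicator_of_notMem hbA]
    symm
    rw [← lintegral_indicator measurableSet_Ioo]
    have : ∀ s, (Ioo 0 (tau D b)).indicator
        (fun s => (flowTube D A δ).indicator (1 : Phase N → ℝ≥0∞) (flow s b)) s = 0 := by
      intro s
      by_cases hs : s ∈ Ioo 0 (tau D b)
      · rw [indicator_of_mem hs, indicator_of_notMem]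
        rintro ⟨-, h, -⟩
        rw [hb.entry_flow hs.1.le hs.2.le] at h
        exact hbA h
      · rw [indicator_of_notMem hs]
    simp_rw [this]
    simp

/-- The constant in the comparison of the flux measure and the chord measure. -/
def fluxConst (N : ℕ) : ℝ≥0∞ := 2 ^ (N - 1) * 2

lemma fluxConst_ne_top : fluxConst N ≠ ⊤ := by
  unfold fluxConst
  exact ENNReal.mul_ne_top (by simp) (by simp)

/-- Near an entrance, the flux of a set of entrances is comparable with the volume of a short tube
over it, hence with its chord measure. -/
lemma flux_local (hN : 1 ≤ N) (hDo : IsOpen D) (hDc : Convex ℝ D) (hDb : Bornology.IsBounded D)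
    (hDs : HasSmoothBoundary D) {b : Phase N} (hb : IsEntrance D b) :
    ∃ O ∈ 𝓝 b, ∀ A ⊆ O, MeasurableSet A → (∀ c ∈ A, IsEntrance D c) →
      fluxMeasure D A ≤ fluxConst N * chordMeasure D A ∧
      chordMeasure D A ≤ fluxConst N * fluxMeasure D A := by
  obtain ⟨hbf, hneg⟩ := (isEntrance_iff_inner_neg hDo hDc hDb hDs b).1 hb
  set e := outwardNormal D b.1 with he_def
  have he : ‖e‖ = 1 := norm_outwardNormal hDs hbf
  set κ : ℝ := |inner ℝ b.2 e| with hκ_def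
  have hκ : 0 < κ := abs_pos.2 hneg.ne
  obtain ⟨δ, hδ, hδτ⟩ := exists_lt_tau hDo hb
  -- with this `ε` the boundary near `b` is flat in the sense of `IsFlat`, for all velocities `v`
  -- with `‖v‖ < ‖b.2‖ + 1` and `3 / 4 * κ < |v · e|`
  set ε : ℝ := κ / (4 * (‖b.2‖ + 1)) with hε_def
  have hε : 0 < ε := by positivity
  obtain ⟨O₁, hO₁, hbO₁, -, hflat⟩ := frontier_flat hDo hDs hbf hε
  have hn1 : ∀ᶠ c in 𝓝 b, ‖c.2‖ < ‖b.2‖ + 1 :=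
    continuous_snd.norm.continuousAt.eventually_lt_const (by simp)
  have hn2 : ∀ᶠ c in 𝓝 b, c.1 ∈ O₁ := continuous_fst.continuousAt.preimage_mem_nhds
    (hO₁.mem_nhds hbO₁)
  have hc3 : ContinuousAt (fun c : Phase N => |inner ℝ c.2 e|) b := by fun_prop
  have hn3 : ∀ᶠ c in 𝓝 b, |inner ℝ c.2 e| ∈ Ioo (3 / 4 * κ) (5 / 4 * κ) :=
    hc3.eventually_mem (Ioo_mem_nhds (by linarith) (by linarith))
  have hc4 : ContinuousWithinAt (fun c : Phase N => |inner ℝ c.2 (outwardNormal D c.1)|)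
      (frontier D ×ˢ univ) b := by
    have h1 : ContinuousWithinAt (fun c : Phase N => outwardNormal D c.1) (frontier D ×ˢ univ) b :=
      (continuousOn_outwardNormal hDo hDs b.1 hbf).comp continuous_fst.continuousWithinAt
        (fun c hc => hc.1)
    exact (continuous_snd.continuousWithinAt.inner h1).abs
  have hn4 : ∀ᶠ c in 𝓝 b, c ∈ frontier D ×ˢ univ →
      |inner ℝ c.2 (outwardNormal D c.1)| ∈ Ioo (3 / 4 * κ) (5 / 4 * κ) := by
    rw [← eventually_nhdsWithin_iff]
    exact hc4.eventually_mem (Ioo_mem_nhds (by linarith) (by linarith))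
  refine ⟨_, hδτ.and (hn1.and (hn2.and (hn3.and hn4))), ?_⟩
  intro A hAO hA hAe
  have hAτ : ∀ c ∈ A, IsEntrance D c ∧ δ < tau D c := fun c hc =>
    ⟨hAe c hc, (hAO hc).1 (hAe c hc)⟩
  have hfr : ∀ c ∈ A, c.1 ∈ frontier D := fun c hc =>
    ((isEntrance_iff_inner_neg hDo hDc hDb hDs c).1 (hAe c hc)).1
  have hTm := measurableSet_flowTube hDo hDb hA δ
  have hvol := chordMeasure_mul hN hDo hDc hDb hA hAτ
  rw [Measure.volume_eq_prod, Measure.prod_apply_symm hTm] at hvol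
  have hsec : ∀ v, volume ((fun x : E => (x, v)) ⁻¹' flowTube D A δ)
      = volume (tube {x | (x, v) ∈ A} v δ) := fun v => by
    rw [← flowTube_section hDo hDc hDb hAτ v]; rfl
  simp_rw [hsec] at hvol
  have hflux := fluxMeasure_apply hDo hDb hDs hA
  have hδ0 : ENNReal.ofReal δ ≠ 0 := by simpa using hδ
  have hδt : ENNReal.ofReal δ ≠ ⊤ := ENNReal.ofReal_ne_top
  -- comparison on the section of constant velocity
  have key : ∀ v, ENNReal.ofReal δ * (∫⁻ x in {x | (x, v) ∈ A},
        ENNReal.ofReal |inner ℝ v (normalExt D x)| ∂surfaceMeasure D)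
          ≤ fluxConst N * volume (tube {x | (x, v) ∈ A} v δ) ∧
      volume (tube {x | (x, v) ∈ A} v δ) ≤ fluxConst N * (ENNReal.ofReal δ *
        (∫⁻ x in {x | (x, v) ∈ A}, ENNReal.ofReal |inner ℝ v (normalExt D x)| ∂surfaceMeasure D)) := by
    intro v
    set Av : Set E := {x | (x, v) ∈ A} with hAv
    have hAvm : MeasurableSet Av := measurable_prodMk_right hA
    rcases Av.eq_empty_or_nonempty with hemp | ⟨x₀, hx₀⟩
    · rw [hemp]
      simp [tube]
    obtain ⟨-, hv1, -, hv3, -⟩ := hAO hx₀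
    have hv3 : |inner ℝ v e| ∈ Ioo (3 / 4 * κ) (5 / 4 * κ) := hv3
    have hv1 : ‖v‖ < ‖b.2‖ + 1 := hv1
    rw [real_inner_comm] at hv3
    have hev : inner ℝ e v ≠ 0 := by
      intro h
      rw [h, abs_zero] at hv3
      linarith [hv3.1]
    have hsub : Av ⊆ frontier D := fun x hx => hfr _ hx
    have hμ : surfaceMeasure D Av = (μHE[N - 1] : Measure E) Av := by
      rw [surfaceMeasure, Measure.restrict_apply hAvm, inter_eq_left.2 hsub]
    have hfin : (μHE[N - 1] : Measure E) Av ≠ ⊤ :=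
      ((measure_mono hsub).trans_lt (measure_frontier_lt_top hDo hDb hDs)).ne
    have hfl : IsFlat e v Av := by
      intro x hx y hy
      have h1 := hflat x ⟨(hAO hx).2.2.1, hsub hx⟩ y ⟨(hAO hy).2.2.1, hsub hy⟩
      have h2 : ε * (‖b.2‖ + 1) = κ / 4 := by
        rw [hε_def]; field_simp
      calc |inner ℝ e (x - y)| * ‖v‖ ≤ (ε * ‖x - y‖) * (‖b.2‖ + 1) := by gcongr
        _ = κ / 4 * ‖x - y‖ := by rw [← h2]; ring
        _ ≤ |inner ℝ e v| * ‖x - y‖ / 2 := by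
          nlinarith [hv3.1, norm_nonneg (x - y)]
    have htm : MeasurableSet (tube Av v δ) := by
      rw [hAv, ← flowTube_section hDo hDc hDb hAτ v]
      exact measurable_prodMk_right hTm
    have ht1 := hfl.volume_tube_le he hev hfin htm
    have ht2 := hfl.le_volume_tube he hev hfin htm
    have hI1 : ∫⁻ x in Av, ENNReal.ofReal |inner ℝ v (normalExt D x)| ∂surfaceMeasure D
        ≤ ENNReal.ofReal (2 * |inner ℝ e v|) * (μHE[N - 1] : Measure E) Av := by
      rw [← hμ, ← setLIntegral_const]
      refine setLIntegral_mono' hAvm fun x hx => ENNReal.ofReal_le_ofReal ?_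
      have := (hAO hx).2.2.2.2 ⟨hsub hx, trivial⟩
      rw [normalExt, indicator_of_mem (hsub hx)]
      simp only at this
      linarith [this.2, hv3.1]
    have hI2 : ENNReal.ofReal (|inner ℝ e v| / 2) * (μHE[N - 1] : Measure E) Av
        ≤ ∫⁻ x in Av, ENNReal.ofReal |inner ℝ v (normalExt D x)| ∂surfaceMeasure D := by
      rw [← hμ, ← setLIntegral_const]
      refine setLIntegral_mono' hAvm fun x hx => ENNReal.ofReal_le_ofReal ?_
      have := (hAO hx).2.2.2.2 ⟨hsub hx, trivial⟩
      rw [normalExt, indicator_of_mem (hsub hx)]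
      simp only at this
      linarith [this.1, hv3.2]
    have ha : 0 ≤ |inner ℝ e v| := abs_nonneg _
    constructor
    · calc ENNReal.ofReal δ * _
          ≤ ENNReal.ofReal δ * (ENNReal.ofReal (2 * |inner ℝ e v|) *
            (μHE[N - 1] : Measure E) Av) := by gcongr
        _ = 2 * (ENNReal.ofReal (|inner ℝ e v| * δ) * (μHE[N - 1] : Measure E) Av) := by
          rw [ENNReal.ofReal_mul two_pos.le, ENNReal.ofReal_mul ha, ENNReal.ofReal_ofNat]; ring
        _ ≤ 2 * (2 ^ (N - 1) * volume (tube Av v δ)) := by gcongr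
        _ = fluxConst N * volume (tube Av v δ) := by unfold fluxConst; ring
    · calc volume (tube Av v δ)
          ≤ 2 ^ (N - 1) * (ENNReal.ofReal (|inner ℝ e v| * δ) * (μHE[N - 1] : Measure E) Av) := ht1
        _ = fluxConst N * (ENNReal.ofReal δ * (ENNReal.ofReal (|inner ℝ e v| / 2) *
              (μHE[N - 1] : Measure E) Av)) := by
          have : ENNReal.ofReal (|inner ℝ e v| * δ)
              = 2 * (ENNReal.ofReal δ * ENNReal.ofReal (|inner ℝ e v| / 2)) := by
            rw [← ENNReal.ofReal_mul hδ.le, show |inner ℝ e v| * δ = 2 * (δ * (|inner ℝ e v| / 2)) by ring,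
              ENNReal.ofReal_mul two_pos.le, ENNReal.ofReal_ofNat]
          rw [this]; unfold fluxConst; ring
        _ ≤ _ := by gcongr
  constructor
  · rw [← ENNReal.mul_le_mul_iff_right hδ0 hδt, mul_left_comm, hvol, hflux,
      ← lintegral_const_mul' _ _ hδt, ← lintegral_const_mul' _ _ fluxConst_ne_top]
    exact lintegral_mono fun v => (key v).1
  · rw [← ENNReal.mul_le_mul_iff_right hδ0 hδt, mul_left_comm, hvol, hflux,
      ← lintegral_const_mul' _ _ hδt, ← lintegral_const_mul' _ _ fluxConst_ne_top]
    exact lintegral_mono fun v => (key v).2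

/-- A local comparison of two measures on subsets of `B` globalizes. -/
lemma measure_le_of_local {α : Type*} [TopologicalSpace α] [SecondCountableTopology α]
    [MeasurableSpace α] [BorelSpace α] {μ ν : Measure α} {B : Set α} {C : ℝ≥0∞}
    (h : ∀ b ∈ B, ∃ O ∈ 𝓝 b, ∀ A ⊆ O, MeasurableSet A → A ⊆ B → μ A ≤ C * ν A)
    {A : Set α} (hA : MeasurableSet A) (hAB : A ⊆ B) : μ A ≤ C * ν A := by
  have h' : ∀ b, ∃ O, IsOpen O ∧ (b ∈ B → b ∈ O) ∧
      ∀ A ⊆ O, MeasurableSet A → A ⊆ B → μ A ≤ C * ν A := by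
    intro b
    by_cases hb : b ∈ B
    · obtain ⟨O, hO, hOA⟩ := h b hb
      obtain ⟨O', hO'O, hO', hbO'⟩ := mem_nhds_iff.1 hO
      exact ⟨O', hO', fun _ => hbO', fun A hA => hOA A (hA.trans hO'O)⟩
    · refine ⟨∅, isOpen_empty, fun h => absurd h hb, fun A hA _ _ => ?_⟩
      rw [subset_empty_iff.1 hA]; simp
  choose O hOo hbO hO using h'
  obtain ⟨t, htB, htc, hcov⟩ := TopologicalSpace.countable_cover_nhdsWithin (s := B) (f := O)
    fun b hb => nhdsWithin_le_nhds ((hOo b).mem_nhds (hbO b hb))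
  rcases t.eq_empty_or_nonempty with rfl | htn
  · have : A = ∅ := by
      rw [← subset_empty_iff]; simpa using hAB.trans hcov
    simp [this]
  obtain ⟨f, rfl⟩ := htc.exists_eq_range htn
  have hAU : A = ⋃ n, A ∩ disjointed (fun n => O (f n)) n := by
    rw [← inter_iUnion, iUnion_disjointed]
    symm
    rw [inter_eq_left]
    simpa using hAB.trans hcov
  have hm : ∀ n, MeasurableSet (A ∩ disjointed (fun n => O (f n)) n) := fun n =>
    hA.inter (MeasurableSet.disjointed (fun n => (hOo _).measurableSet) n)
  have hd : Pairwise (Function.onFun Disjoint fun n => A ∩ disjointed (fun n => O (f n)) n) :=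
    fun i j hij => (disjoint_disjointed (fun n => O (f n)) hij).mono inter_subset_right
      inter_subset_right
  rw [hAU, measure_iUnion hd hm, measure_iUnion hd hm, ← ENNReal.tsum_mul_left]
  refine ENNReal.tsum_le_tsum fun n => hO (f n) _ ?_ (hm n) (inter_subset_left.trans hAB)
  exact inter_subset_right.trans (disjointed_subset _ _)

lemma fluxMeasure_tangential (hDo : IsOpen D) (hDs : HasSmoothBoundary D) :
    fluxMeasure D {z | inner ℝ z.2 (normalExt D z.1) = 0} = 0 := by
  have hm : MeasurableSet {z : Phase N | inner ℝ z.2 (normalExt D z.1) = 0} :=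
    measurableSet_eq_fun (measurable_snd.inner
      ((measurable_normalExt hDo hDs).comp measurable_fst)) measurable_const
  rw [fluxMeasure_eq, withDensity_apply _ hm]
  rw [setLIntegral_congr_fun hm (g := fun _ => 0)]
  · simp
  · intro z hz
    have : inner ℝ z.2 (normalExt D z.1) = 0 := hz
    simp [this]

lemma ae_incoming_isEntrance (hDo : IsOpen D) (hDc : Convex ℝ D) (hDb : Bornology.IsBounded D)
    (hDs : HasSmoothBoundary D) : ∀ᵐ b ∂incomingMeasure D, IsEntrance D b := by
  have hB := measurableSet_isEntrance hDo hDc hDb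
  rw [ae_iff, incomingMeasure]
  change (fluxMeasure D).restrict (incoming D) {b | IsEntrance D b}ᶜ = 0
  rw [Measure.restrict_apply hB.compl]
  refine measure_mono_null ?_ (fluxMeasure_tangential hDo hDs)
  rintro z ⟨h1, h2⟩
  have h3 : ¬ inner ℝ z.2 (outwardNormal D z.1) < 0 := fun h =>
    h1 ((isEntrance_iff_inner_neg hDo hDc hDb hDs z).2 ⟨h2.1, h⟩)
  have h4 : inner ℝ z.2 (normalExt D z.1) = inner ℝ z.2 (outwardNormal D z.1) := by
    rw [normalExt, indicator_of_mem h2.1]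
  exact h4.trans (le_antisymm h2.2 (not_lt.1 h3))

/-- The flux measure is at most a constant times the chord measure; tangential pairs, which are not
entrances, carry no flux. -/
theorem incomingMeasure_le (hN : 1 ≤ N) (hDo : IsOpen D) (hDc : Convex ℝ D)
    (hDb : Bornology.IsBounded D) (hDs : HasSmoothBoundary D) :
    incomingMeasure D ≤ fluxConst N • chordMeasure D := by
  have hB := measurableSet_isEntrance hDo hDc hDb
  refine Measure.le_iff.2 fun A hA => ?_
  have h1 : incomingMeasure D A = incomingMeasure D (A ∩ {b | IsEntrance D b}) := by
    refine measure_congr ?_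
    filter_upwards [ae_incoming_isEntrance hDo hDc hDb hDs] with b hb
    apply propext
    exact ⟨fun h => ⟨h, hb⟩, fun h => h.1⟩
  rw [h1, Measure.smul_apply, smul_eq_mul]
  calc incomingMeasure D (A ∩ {b | IsEntrance D b}) ≤ fluxMeasure D (A ∩ {b | IsEntrance D b}) :=
        Measure.restrict_apply_le _ _
    _ ≤ fluxConst N * chordMeasure D (A ∩ {b | IsEntrance D b}) := by
        refine measure_le_of_local (B := {b | IsEntrance D b}) ?_ (hA.inter hB) inter_subset_right
        intro b hb
        obtain ⟨O, hO, h⟩ := flux_local hN hDo hDc hDb hDs hb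
        exact ⟨O, hO, fun A hAO hA hAB => (h A hAO hA hAB).1⟩
    _ ≤ _ := by gcongr; exact inter_subset_left

theorem chordMeasure_absolutelyContinuous (hN : 1 ≤ N) (hDo : IsOpen D) (hDc : Convex ℝ D)
    (hDb : Bornology.IsBounded D) (hDs : HasSmoothBoundary D) :
    chordMeasure D ≪ incomingMeasure D := by
  have hB := measurableSet_isEntrance hDo hDc hDb
  refine Measure.AbsolutelyContinuous.mk fun A hA hA0 => ?_
  have h1 : chordMeasure D A = chordMeasure D (A ∩ {b | IsEntrance D b}) := by
    refine measure_congr ?_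
    filter_upwards [ae_isEntrance hN hDo hDc hDb] with b hb
    apply propext
    exact ⟨fun h => ⟨h, hb⟩, fun h => h.1⟩
  have h2 : fluxMeasure D (A ∩ {b | IsEntrance D b}) = 0 := by
    rw [incomingMeasure, Measure.restrict_apply hA] at hA0
    refine measure_mono_null (inter_subset_inter_right _ ?_) hA0
    intro b hb
    have := (isEntrance_iff_inner_neg hDo hDc hDb hDs b).1 hb
    exact ⟨this.1, this.2.le⟩
  rw [h1]
  refine le_antisymm ?_ bot_le
  calc chordMeasure D (A ∩ {b | IsEntrance D b})
      ≤ fluxConst N * fluxMeasure D (A ∩ {b | IsEntrance D b}) := by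
        refine measure_le_of_local (B := {b | IsEntrance D b}) ?_ (hA.inter hB) inter_subset_right
        intro b hb
        obtain ⟨O, hO, h⟩ := flux_local hN hDo hDc hDb hDs hb
        exact ⟨O, hO, fun A hAO hA hAB => (h A hAO hA hAB).2⟩
    _ = 0 := by rw [h2, mul_zero]

lemma measurableEmbedding_rev : MeasurableEmbedding (rev : Phase N → Phase N) :=
  MeasurableEquiv.measurableEmbedding
    { toFun := rev, invFun := rev, left_inv := rev_rev, right_inv := rev_rev,
      measurable_toFun := measurable_rev, measurable_invFun := measurable_rev }

/-- Reversal of the velocity exchanges incoming and outgoing flux. -/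
lemma measurePreserving_rev_incoming (hDo : IsOpen D) (hDb : Bornology.IsBounded D)
    (hDs : HasSmoothBoundary D) :
    MeasurePreserving rev (incomingMeasure D) (outgoingMeasure D) := by
  have := isFiniteMeasure_surfaceMeasure hDo hDb hDs
  have h1 : MeasurePreserving (rev : Phase N → Phase N) (fluxMeasure D) (fluxMeasure D) := by
    have h0 : MeasurePreserving (rev : Phase N → Phase N) ((surfaceMeasure D).prod volume)
        ((surfaceMeasure D).prod volume) :=
      (MeasurePreserving.id _).prod (Measure.measurePreserving_neg volume)
    have hd := measurable_fluxDensity hDo hDs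
    refine ⟨measurable_rev, ?_⟩
    ext A hA
    rw [Measure.map_apply measurable_rev hA, fluxMeasure_eq,
      withDensity_apply _ hA, withDensity_apply _ (measurable_rev hA), ← lintegral_indicator hA,
      ← lintegral_indicator (measurable_rev hA), ← h0.lintegral_comp (hd.indicator hA)]
    refine lintegral_congr fun z => ?_
    by_cases hz : rev z ∈ A
    · rw [indicator_of_mem hz, indicator_of_mem (show z ∈ rev ⁻¹' A from hz)]
      simp [inner_neg_left]
    · rw [indicator_of_notMem hz, indicator_of_notMem (show z ∉ rev ⁻¹' A from hz)]
  have h2 := h1.restrict_preimage_emb measurableEmbedding_rev (outgoing D)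
  have h3 : rev ⁻¹' outgoing D = incoming D := by
    ext z
    simp [outgoing, incoming, inner_neg_left]
  rwa [h3] at h2

end Flux

/-! ### Strongly continuous semigroups: orbits, resolvent and generator -/

section Semigroup

variable {𝕜 Y : Type*} [RCLike 𝕜] [NormedAddCommGroup Y] [NormedSpace 𝕜 Y]
  {U : ℝ≥0 → Y →L[𝕜] Y}

lemma IsC0Semigroup.comm (hU : IsC0Semigroup U) (s t : ℝ≥0) (y : Y) : U s (U t y) = U t (U s y) := by
  rw [← ContinuousLinearMap.comp_apply, ← hU.add, add_comm, hU.add, ContinuousLinearMap.comp_apply]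

lemma IsC0Semigroup.add_apply (hU : IsC0Semigroup U) (s t : ℝ≥0) (y : Y) :
    U (s + t) y = U s (U t y) := by rw [hU.add, ContinuousLinearMap.comp_apply]

section Resolvent

variable [NormedSpace ℝ Y]

/-- The resolvent at `1`, i.e. the Laplace transform of the semigroup. -/
def resolvent (U : ℝ≥0 → Y →L[𝕜] Y) (f : Y) : Y :=
  ∫ t in Ioi (0 : ℝ), Real.exp (-t) • U t.toNNReal f

lemma norm_resolvent_le {M : ℝ} (hM : ∀ t, ‖U t‖ ≤ M) (f : Y) :
    ‖resolvent U f‖ ≤ M * ‖f‖ := by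
  have h1 : ‖resolvent U f‖ ≤ ∫ t in Ioi (0 : ℝ), M * ‖f‖ * Real.exp (-t) := by
    refine norm_integral_le_of_norm_le ((integrableOn_exp_neg_Ioi 0).const_mul _)
      (Eventually.of_forall fun t => ?_)
    rw [norm_smul, Real.norm_eq_abs, Real.abs_exp, mul_comm]
    gcongr
    exact (U _).le_of_opNorm_le (hM _) f
  rwa [integral_const_mul, integral_exp_neg_Ioi_zero, mul_one] at h1

variable [IsScalarTower ℝ 𝕜 Y]

lemma real_coe_smul (r : ℝ) (y : Y) : ((r : ℝ) : 𝕜) • y = r • y := by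
  rw [← algebraMap_smul 𝕜 r y]

lemma map_real_smul (L : Y →L[𝕜] Y) (r : ℝ) (y : Y) : L (r • y) = r • L y := by
  rw [← real_coe_smul (𝕜 := 𝕜), map_smul, real_coe_smul]

lemma resolvent_smul (r : ℝ) (f : Y) : resolvent U (r • f) = r • resolvent U f := by
  rw [resolvent, resolvent, ← integral_smul]
  simp_rw [map_real_smul, smul_comm r]

end Resolvent

variable [CompleteSpace Y]

/-- By the uniform boundedness principle a strongly continuous semigroup is bounded near zero. -/
lemma IsC0Semigroup.exists_bound_near_zero (hU : IsC0Semigroup U) :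
    ∃ δ > 0, ∃ M, ∀ t ≤ δ, ‖U t‖ ≤ M := by
  by_contra! h
  have h1 : ∀ n : ℕ, ∃ t : ℝ≥0, t ≤ 1 / ((n : ℝ≥0) + 1) ∧ (n : ℝ) < ‖U t‖ := fun n =>
    h (1 / ((n : ℝ≥0) + 1)) (by positivity) n
  choose t ht hn using h1
  have ht0 : Tendsto t atTop (𝓝 0) :=
    tendsto_of_tendsto_of_tendsto_of_le_of_le tendsto_const_nhds
      tendsto_one_div_add_atTop_nhds_zero_nat (fun _ => bot_le) ht
  obtain ⟨C, hC⟩ := banach_steinhaus (g := fun n => U (t n)) fun y => by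
    have h2 := ((hU.continuousAt_zero y).comp ht0).norm
    obtain ⟨C, hC⟩ := h2.bddAbove_range
    exact ⟨C, fun n => hC ⟨n, rfl⟩⟩
  obtain ⟨n, hn'⟩ := exists_nat_gt C
  exact absurd (hC n) (not_le.2 (hn'.trans (hn n)))

lemma IsC0Semigroup.exists_bound (hU : IsC0Semigroup U) (T : ℝ≥0) :
    ∃ M, ∀ t ≤ T, ‖U t‖ ≤ M := by
  obtain ⟨δ, hδ, M, hM⟩ := hU.exists_bound_near_zero
  have hM0 : 0 ≤ M := (norm_nonneg _).trans (hM 0 bot_le)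
  have key : ∀ n : ℕ, ∃ C, ∀ t ≤ (n : ℝ≥0) * δ, ‖U t‖ ≤ C := by
    intro n
    induction n with
    | zero => exact ⟨M, fun t ht => hM t (ht.trans (by simp))⟩
    | succ n ih =>
      obtain ⟨C, hC⟩ := ih
      refine ⟨max M (M * C), fun t ht => ?_⟩
      rcases le_total t δ with h | h
      · exact (hM t h).trans (le_max_left _ _)
      · have h1 : t = δ + (t - δ) := (add_tsub_cancel_of_le h).symm
        rw [h1, hU.add]
        refine ((U δ).opNorm_comp_le _).trans ((mul_le_mul (hM δ le_rfl) (hC _ ?_)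
          (norm_nonneg _) hM0).trans (le_max_right _ _))
        rw [tsub_le_iff_left]
        refine ht.trans (le_of_eq ?_)
        push_cast; ring
  obtain ⟨n, hn⟩ := exists_nat_ge (T / δ)
  obtain ⟨C, hC⟩ := key n
  exact ⟨C, fun t ht => hC t (ht.trans (by rwa [div_le_iff₀ hδ] at hn))⟩

lemma IsC0Semigroup.continuous_orbit (hU : IsC0Semigroup U) (y : Y) :
    Continuous fun t => U t y := by
  refine continuous_iff_continuousAt.2 fun t₀ => ?_
  obtain ⟨M, hM⟩ := hU.exists_bound (t₀ + 1)
  have hM0 : 0 ≤ M := (norm_nonneg _).trans (hM 0 bot_le)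
  rw [ContinuousAt, tendsto_iff_norm_sub_tendsto_zero]
  -- both one-sided increments are `U r (U |t - t₀| y - y)` with `r ≤ t₀`
  have h1 : ∀ t, ‖U t y - U t₀ y‖ ≤ M * ‖U ((t - t₀) + (t₀ - t)) y - y‖ := by
    intro t
    rcases le_total t t₀ with h | h
    · rw [tsub_eq_zero_of_le h, zero_add]
      have : U t₀ y = U t (U (t₀ - t) y) := by
        rw [← hU.add_apply, add_tsub_cancel_of_le h]
      rw [this, ← map_sub, norm_sub_rev (U (t₀ - t) y)]
      exact ((U t).le_opNorm _).trans (mul_le_mul_of_nonneg_right (hM t (h.trans (by simp)))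
        (norm_nonneg _))
    · rw [tsub_eq_zero_of_le h, add_zero]
      have : U t y = U t₀ (U (t - t₀) y) := by
        rw [← hU.add_apply, add_tsub_cancel_of_le h]
      rw [this, ← map_sub]
      exact ((U t₀).le_opNorm _).trans (mul_le_mul_of_nonneg_right (hM t₀ (by simp))
        (norm_nonneg _))
  have h2 : Tendsto (fun t : ℝ≥0 => (t - t₀) + (t₀ - t)) (𝓝 t₀) (𝓝 0) := by
    have : Continuous fun t : ℝ≥0 => (t - t₀) + (t₀ - t) := by fun_prop
    simpa using this.tendsto t₀
  have h3 := ((hU.continuousAt_zero y).comp h2)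
  rw [tendsto_iff_norm_sub_tendsto_zero] at h3
  refine squeeze_zero (fun _ => norm_nonneg _) h1 ?_
  simpa using h3.const_mul M

variable [NormedSpace ℝ Y]

lemma IsC0Semigroup.continuous_integrand (hU : IsC0Semigroup U) (f : Y) :
    Continuous fun t : ℝ => Real.exp (-t) • U t.toNNReal f := by
  have := (hU.continuous_orbit f).comp continuous_real_toNNReal
  exact (Real.continuous_exp.comp continuous_neg).smul this

lemma IsC0Semigroup.integrableOn (hU : IsC0Semigroup U) {M : ℝ} (hM : ∀ t, ‖U t‖ ≤ M) (f : Y) :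
    IntegrableOn (fun t : ℝ => Real.exp (-t) • U t.toNNReal f) (Ioi 0) := by
  refine Integrable.mono' ((integrableOn_exp_neg_Ioi 0).const_mul (M * ‖f‖))
    (hU.continuous_integrand f).aestronglyMeasurable (Eventually.of_forall fun t => ?_)
  rw [norm_smul, Real.norm_eq_abs, Real.abs_exp, mul_comm]
  gcongr
  exact (U _).le_of_opNorm_le (hM _) f

lemma IsC0Semigroup.resolvent_sub (hU : IsC0Semigroup U) {M : ℝ} (hM : ∀ t, ‖U t‖ ≤ M) (f g : Y) :
    resolvent U (f - g) = resolvent U f - resolvent U g := by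
  rw [resolvent, resolvent, resolvent, ← integral_sub (hU.integrableOn hM f) (hU.integrableOn hM g)]
  simp [smul_sub]

variable [IsScalarTower ℝ 𝕜 Y]

lemma IsC0Semigroup.map_resolvent (hU : IsC0Semigroup U) {M : ℝ} (hM : ∀ t, ‖U t‖ ≤ M)
    (h : ℝ≥0) (f : Y) : U h (resolvent U f) = resolvent U (U h f) := by
  let L : Y →L[ℝ] Y :=
    { toFun := U h, map_add' := map_add _, map_smul' := map_real_smul _, cont := (U h).cont }
  have := L.integral_comp_comm (hU.integrableOn hM f)
  change _ = U h (resolvent U f) at this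
  rw [← this, resolvent]
  refine integral_congr_ae (Eventually.of_forall fun t => ?_)
  change U h _ = _
  simp only
  rw [map_real_smul, hU.comm]

/-- Splitting the Laplace transform at time `h`. -/
lemma IsC0Semigroup.map_resolvent_eq (hU : IsC0Semigroup U) {M : ℝ} (hM : ∀ t, ‖U t‖ ≤ M)
    (h : ℝ≥0) (f : Y) : U h (resolvent U f) =
      Real.exp h • (resolvent U f - ∫ t in (0 : ℝ)..h, Real.exp (-t) • U t.toNNReal f) := by
  have h1 := intervalIntegral.integral_interval_add_Ioi (a := 0) (b := (h : ℝ))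
    (hU.integrableOn hM f) ((hU.integrableOn hM f).mono_set (Ioi_subset_Ioi h.2))
  rw [hU.map_resolvent hM, resolvent, resolvent, ← h1, add_sub_cancel_left, ← integral_smul]
  have h2 := (measurePreserving_add_right (volume : Measure ℝ) (h : ℝ)).setIntegral_preimage_emb
    (MeasurableEquiv.addRight (h : ℝ)).measurableEmbedding
    (fun t => Real.exp h • Real.exp (-t) • U t.toNNReal f) (Ioi (h : ℝ))
  rw [← h2]
  have h3 : (fun x : ℝ => x + h) ⁻¹' Ioi (h : ℝ) = Ioi 0 := by ext x; simp
  rw [h3]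
  refine setIntegral_congr_fun measurableSet_Ioi fun t ht => ?_
  have ht : (0 : ℝ) < t := ht
  rw [smul_smul, ← Real.exp_add, Real.toNNReal_add ht.le h.coe_nonneg, Real.toNNReal_coe, hU.add_apply]
  congr 2
  ring

/-- The range of the resolvent `R` is in the domain of the generator, which maps `R f` to `R f - f`. -/
lemma IsC0Semigroup.tendsto_resolvent (hU : IsC0Semigroup U) {M : ℝ} (hM : ∀ t, ‖U t‖ ≤ M) (f : Y) :
    Tendsto (fun h : ℝ≥0 => (h : ℝ)⁻¹ • (U h (resolvent U f) - resolvent U f)) (𝓝[>] 0)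
      (𝓝 (resolvent U f - f)) := by
  have hc := hU.continuous_integrand f
  have h1 : HasDerivAt (fun h : ℝ => ∫ t in (0 : ℝ)..h, Real.exp (-t) • U t.toNNReal f) f 0 := by
    have := intervalIntegral.integral_hasDerivAt_right (hc.intervalIntegrable 0 0)
      hc.stronglyMeasurable.stronglyMeasurableAtFilter hc.continuousAt
    simpa [hU.zero] using this
  have h2 := (Real.hasDerivAt_exp 0).smul (h1.const_sub (resolvent U f))
  simp only [intervalIntegral.integral_same, sub_zero, Real.exp_zero, one_smul] at h2
  rw [hasDerivAt_iff_tendsto_slope] at h2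
  have h3 : Tendsto (fun h : ℝ≥0 => (h : ℝ)) (𝓝[>] 0) (𝓝[≠] 0) := by
    refine tendsto_nhdsWithin_of_tendsto_nhds_of_eventually_within _ ?_ ?_
    · exact (NNReal.continuous_coe.tendsto 0).mono_left nhdsWithin_le_nhds
    · filter_upwards [self_mem_nhdsWithin] with h hh
      have : (0 : ℝ≥0) < h := hh
      exact (NNReal.coe_pos.2 this).ne'
  have h4 := h2.comp h3
  rw [show resolvent U f - f = -f + resolvent U f by abel]
  refine h4.congr fun h => ?_
  simp only [Function.comp_apply, slope_def_module, sub_zero]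
  rw [hU.map_resolvent_eq hM]
  simp

/-- The generator is `1 - R⁻¹`, where `R` is the resolvent at `1`. -/
theorem IsC0Semigroup.mem_generatorGraph_iff (hU : IsC0Semigroup U) {M : ℝ}
    (hM : ∀ t, ‖U t‖ ≤ M) (a : Y × Y) :
    a ∈ generatorGraph U ↔ resolvent U (a.1 - a.2) = a.1 := by
  have hgen : a ∈ generatorGraph U ↔
      Tendsto (fun h : ℝ≥0 => (h : ℝ)⁻¹ • (U h a.1 - a.1)) (𝓝[>] 0) (𝓝 a.2) := by
    rw [generatorGraph, mem_ofPred_eq]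
    simp_rw [← RCLike.ofReal_inv, real_coe_smul]
  rw [hgen]
  constructor
  · intro h
    have h1 : Tendsto (fun h : ℝ≥0 => resolvent U ((h : ℝ)⁻¹ • (U h a.1 - a.1))) (𝓝[>] 0)
        (𝓝 (resolvent U a.2)) := by
      rw [tendsto_iff_norm_sub_tendsto_zero] at h ⊢
      refine squeeze_zero (fun _ => norm_nonneg _) (fun t => ?_) (by simpa using h.const_mul M)
      rw [← hU.resolvent_sub hM]
      exact norm_resolvent_le hM _
    have h2 := hU.tendsto_resolvent hM a.1
    have h3 : ∀ h : ℝ≥0, (h : ℝ)⁻¹ • (U h (resolvent U a.1) - resolvent U a.1)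
        = resolvent U ((h : ℝ)⁻¹ • (U h a.1 - a.1)) := fun h => by
      rw [resolvent_smul, hU.resolvent_sub hM, hU.map_resolvent hM]
    simp_rw [h3] at h2
    have := tendsto_nhds_unique h1 h2
    rw [hU.resolvent_sub hM, this]
    abel
  · intro h
    have h1 := hU.tendsto_resolvent hM (a.1 - a.2)
    rw [h] at h1
    simpa using h1

lemma IsC0Semigroup.dense_domain (hU : IsC0Semigroup U) {M : ℝ} (hM : ∀ t, ‖U t‖ ≤ M) :
    Dense {y | ∃ w, (y, w) ∈ generatorGraph U} := by
  intro f
  have hc := hU.continuous_integrand f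
  have h1 : HasDerivAt (fun h : ℝ => ∫ t in (0 : ℝ)..h, Real.exp (-t) • U t.toNNReal f) f 0 := by
    have := intervalIntegral.integral_hasDerivAt_right (hc.intervalIntegrable 0 0)
      hc.stronglyMeasurable.stronglyMeasurableAtFilter hc.continuousAt
    simpa [hU.zero] using this
  have h2 := h1.hasDerivWithinAt (s := Ioi 0)
  rw [hasDerivWithinAt_iff_tendsto_slope' (by simp)] at h2
  refine mem_closure_of_tendsto h2 ?_
  filter_upwards [self_mem_nhdsWithin] with h hh
  have hh : (0 : ℝ) < h := hh
  lift h to ℝ≥0 using hh.le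
  -- the mean of the orbit over `[0, h]` is in the range of the resolvent
  have h3 : slope (fun h : ℝ => ∫ t in (0 : ℝ)..h, Real.exp (-t) • U t.toNNReal f) 0 h
      = resolvent U ((h : ℝ)⁻¹ • (f - Real.exp (-h) • U h f)) := by
    have h4 := hU.map_resolvent_eq hM h f
    have h5 : Real.exp (-h) • U h (resolvent U f)
        = resolvent U f - ∫ t in (0 : ℝ)..h, Real.exp (-t) • U t.toNNReal f := by
      rw [h4, smul_smul, ← Real.exp_add, neg_add_cancel, Real.exp_zero, one_smul]
    rw [resolvent_smul, hU.resolvent_sub hM, resolvent_smul, ← hU.map_resolvent hM, h5,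
      slope_def_module]
    simp
  rw [h3]
  set g := (h : ℝ)⁻¹ • (f - Real.exp (-h) • U h f)
  refine ⟨resolvent U g - g, ?_⟩
  rw [hU.mem_generatorGraph_iff hM]
  simp

/-- A semigroup is determined by its generator: for `y` in the domain, the derivative of
`s ↦ U (t - s) (U' s y)` vanishes. -/
theorem IsC0Semigroup.eq_of_generatorGraph_eq {U' : ℝ≥0 → Y →L[𝕜] Y} (hU : IsC0Semigroup U)
    {M : ℝ} (hM : ∀ t, ‖U t‖ ≤ M) (hU' : IsC0Semigroup U')
    (h : generatorGraph U' = generatorGraph U) : U' = U := by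
  have hM0 : 0 ≤ M := (norm_nonneg _).trans (hM 0)
  funext t
  refine ContinuousLinearMap.coeFn_injective ?_
  refine (U' t).continuous.ext_on (hU.dense_domain hM) (U t).continuous ?_
  rintro y ⟨w, hw⟩
  rw [← h] at hw
  set F : ℝ → Y := fun s => U ((t : ℝ) - s).toNNReal (U' s.toNNReal y) with hF
  have hcU' : Continuous fun s : ℝ => U' s.toNNReal y :=
    (hU'.continuous_orbit y).comp continuous_real_toNNReal
  have hcF : Continuous F := by
    refine continuous_iff_continuousAt.2 fun s₀ => ?_
    rw [ContinuousAt, tendsto_iff_norm_sub_tendsto_zero]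
    have hc2 : Continuous fun s : ℝ => U ((t : ℝ) - s).toNNReal (U' s₀.toNNReal y) :=
      (hU.continuous_orbit _).comp (continuous_real_toNNReal.comp (by fun_prop))
    have h1 : ∀ s, ‖F s - F s₀‖ ≤ M * ‖U' s.toNNReal y - U' s₀.toNNReal y‖
        + ‖U ((t : ℝ) - s).toNNReal (U' s₀.toNNReal y) - F s₀‖ := by
      intro s
      have : F s - F s₀ = U ((t : ℝ) - s).toNNReal (U' s.toNNReal y - U' s₀.toNNReal y)
          + (U ((t : ℝ) - s).toNNReal (U' s₀.toNNReal y) - F s₀) := by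
        rw [map_sub]; simp only [hF]; abel
      rw [this]
      refine (norm_add_le _ _).trans ?_
      gcongr
      exact (U _).le_of_opNorm_le (hM _) _
    refine squeeze_zero (fun _ => norm_nonneg _) h1 ?_
    have h2 := tendsto_iff_norm_sub_tendsto_zero.1 (hcU'.tendsto s₀)
    have h3 := tendsto_iff_norm_sub_tendsto_zero.1 (hc2.tendsto s₀)
    simpa using (h2.const_mul M).add h3
  have hder : ∀ s ∈ Ico (0 : ℝ) t, HasDerivWithinAt F 0 (Ici s) s := by
    intro s hs
    rw [← hasDerivWithinAt_Ioi_iff_Ici, hasDerivWithinAt_iff_tendsto_slope' (by simp)]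
    -- the orbit stays in the common domain, where both difference quotients have the same limit
    have hx : (U' s.toNNReal y, U' s.toNNReal w) ∈ generatorGraph U' := by
      have h1 := ((U' s.toNNReal).continuous.tendsto w).comp hw
      refine Tendsto.congr (fun r => ?_) h1
      simp only [Function.comp_apply]
      rw [map_smul, map_sub, hU'.comm]
    have hx2 := h ▸ hx
    have h3 := tendsto_iff_norm_sub_tendsto_zero.1 (hx.sub hx2)
    simp only [sub_self, sub_zero] at h3
    have h4 : Tendsto (fun r : ℝ => (r - s).toNNReal) (𝓝[>] s) (𝓝[>] 0) := by
      refine tendsto_nhdsWithin_of_tendsto_nhds_of_eventually_within _ ?_ ?_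
      · have : Continuous fun r : ℝ => (r - s).toNNReal :=
          continuous_real_toNNReal.comp (by fun_prop)
        simpa using (this.tendsto s).mono_left nhdsWithin_le_nhds
      · filter_upwards [self_mem_nhdsWithin] with r hr
        have hr : s < r := hr
        simpa using hr
    have h5 := (h3.comp h4).const_mul M
    rw [mul_zero] at h5
    rw [tendsto_zero_iff_norm_tendsto_zero]
    refine squeeze_zero' (Eventually.of_forall fun _ => norm_nonneg _) ?_ h5
    filter_upwards [self_mem_nhdsWithin, nhdsWithin_le_nhds (eventually_lt_nhds hs.2)] with r hr hrt
    have hr : s < r := hr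
    set x := U' s.toNNReal y with hx_def
    set k := (r - s).toNNReal with hk
    have hkr : (k : ℝ) = r - s := Real.coe_toNNReal _ (by linarith)
    have e1 : F r = U ((t : ℝ) - r).toNNReal (U' k x) := by
      simp only [hF]
      rw [hx_def, ← hU'.add_apply, hk, ← Real.toNNReal_add (by linarith) hs.1, sub_add_cancel]
    have e2 : F s = U ((t : ℝ) - r).toNNReal (U k x) := by
      simp only [hF]
      rw [← hx_def, ← hU.add_apply, hk, ← Real.toNNReal_add (by linarith) (by linarith)]
      congr 3; ring
    have e3 : slope F s r = U ((t : ℝ) - r).toNNReal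
        (((k : ℝ) : 𝕜)⁻¹ • (U' k x - x) - ((k : ℝ) : 𝕜)⁻¹ • (U k x - x)) := by
      rw [← smul_sub, sub_sub_sub_cancel_right, map_smul, map_sub, ← RCLike.ofReal_inv,
        real_coe_smul, hkr, slope_def_module, e1, e2]
    rw [e3]
    exact (U _).le_of_opNorm_le (hM _) _
  have := constant_of_has_deriv_right_zero hcF.continuousOn hder t ⟨t.2, le_rfl⟩
  simp only [hF, sub_self, Real.toNNReal_zero, hU.zero, Real.toNNReal_coe, sub_zero, hU'.zero] at this
  exact this

end Semigroup

/-! ### Unfolding the reflections along a chord -/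

section Unfold

variable {N : ℕ} {D : Set (EuclideanSpace ℝ (Fin N))} {𝕜 : Type*} [RCLike 𝕜]

/-- The number of reflections on the way back from the chord with entrance `b` to the unfolded
position `y < τ(b)`: the `n` with `0 ≤ y + n τ(b) < τ(b)`. -/
def bounces (D : Set (EuclideanSpace ℝ (Fin N))) (b : Phase N) (y : ℝ) : ℕ := ⌈-y / tau D b⌉₊

/-- The position with unfolded coordinate `y` after `n` reflections of the chord with
entrance `b`. -/
def place (D : Set (EuclideanSpace ℝ (Fin N))) (b : Phase N) (n : ℕ) (y : ℝ) : Phase N :=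
  flow (y + n * tau D b) ((turn D)^[n] b)

/-- The function `f`, damped by `γ` at each reflection, along the unfolded trajectory that arrives
at the entrance `b`; the chord itself corresponds to `0 ≤ y < τ(b)` and its past to `y < 0`. -/
def unfold (D : Set (EuclideanSpace ℝ (Fin N))) (γ : ℝ) (f : Phase N → 𝕜) (b : Phase N) (y : ℝ) :
    𝕜 :=
  ((γ ^ bounces D b y : ℝ) : 𝕜) * f (place D b (bounces D b y) y)

/-- The explicit solution at time `t` of the transport equation with bounce-back. -/
def evolve (D : Set (EuclideanSpace ℝ (Fin N))) (σ : EuclideanSpace ℝ (Fin N) → ℝ) (γ t : ℝ)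
    (f : Phase N → 𝕜) (z : Phase N) : 𝕜 :=
  (Real.exp (-(σ z.2 * t)) : 𝕜) * unfold D γ f (entry D z) (tMinus D z - t)

lemma IsEntrance.bounces_spec {b : Phase N} (hb : IsEntrance D b) {y : ℝ} (hy : y < tau D b) :
    0 ≤ y + bounces D b y * tau D b ∧ y + bounces D b y * tau D b < tau D b := by
  have hτ := hb.tau_pos
  constructor
  · have := Nat.le_ceil (-y / tau D b)
    rw [div_le_iff₀ hτ] at this
    unfold bounces
    linarith
  · rcases le_or_gt 0 y with h | h
    · have : bounces D b y = 0 := by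
        rw [bounces, Nat.ceil_eq_zero]
        exact div_nonpos_of_nonpos_of_nonneg (by linarith) hτ.le
      rw [this]; simpa using hy
    · have := Nat.ceil_lt_add_one (div_nonneg (by linarith : 0 ≤ -y) hτ.le)
      have h2 : (⌈-y / tau D b⌉₊ : ℝ) * tau D b < (-y / tau D b + 1) * tau D b := by gcongr
      rw [add_mul, div_mul_cancel₀ _ hτ.ne'] at h2
      unfold bounces
      linarith

lemma IsEntrance.bounces_eq {b : Phase N} (hb : IsEntrance D b) {y : ℝ} {n : ℕ}
    (h0 : 0 ≤ y + n * tau D b) (h1 : y + n * tau D b < tau D b) : bounces D b y = n := by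
  have hτ := hb.tau_pos
  have hy : y < tau D b := by
    have : (0 : ℝ) ≤ n * tau D b := by positivity
    linarith
  obtain ⟨h2, h3⟩ := hb.bounces_spec hy
  set m := bounces D b y
  have h4 : (m : ℝ) < n + 1 := by
    by_contra! h
    have : ((n : ℝ) + 1) * tau D b ≤ m * tau D b := by gcongr
    linarith
  have h5 : (n : ℝ) < m + 1 := by
    by_contra! h
    have : ((m : ℝ) + 1) * tau D b ≤ n * tau D b := by gcongr
    linarith
  have h6 : m < n + 1 := by exact_mod_cast h4
  have h7 : n < m + 1 := by exact_mod_cast h5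
  omega

lemma IsEntrance.unfold_eq {b : Phase N} (hb : IsEntrance D b) (γ : ℝ) (f : Phase N → 𝕜) {y : ℝ}
    {n : ℕ} (h0 : 0 ≤ y + n * tau D b) (h1 : y + n * tau D b < tau D b) :
    unfold D γ f b y = ((γ ^ n : ℝ) : 𝕜) * f (place D b n y) := by
  rw [unfold, hb.bounces_eq h0 h1]

lemma IsEntrance.unfold_chord {b : Phase N} (hb : IsEntrance D b) (γ : ℝ) (f : Phase N → 𝕜) {y : ℝ}
    (h0 : 0 ≤ y) (h1 : y < tau D b) : unfold D γ f b y = f (flow y b) := by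
  rw [hb.unfold_eq γ f (n := 0) (by simpa) (by simpa)]
  simp [place]

/-- Crossing the entrance backwards means a reflection. -/
lemma IsEntrance.unfold_turn {b : Phase N} (hb : IsEntrance D b) (γ : ℝ) (f : Phase N → 𝕜) {y : ℝ}
    (hy : y < 0) : unfold D γ f b y = (γ : 𝕜) * unfold D γ f (BounceBack.turn D b) (y + tau D b) := by
  have hτ := hb.tau_pos
  have hy' : y + tau D b < tau D (BounceBack.turn D b) := by rw [hb.tau_turn]; linarith
  obtain ⟨h0, h1⟩ := hb.turn.bounces_spec hy'
  set k := bounces D (BounceBack.turn D b) (y + tau D b) with hk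
  rw [hb.tau_turn] at h0 h1
  have e : y + tau D b + k * tau D b = y + ((k + 1 : ℕ) : ℝ) * tau D b := by push_cast; ring
  rw [e] at h0 h1
  rw [hb.unfold_eq γ f h0 h1, unfold, ← hk, place, place, hb.tau_turn, e,
    Function.iterate_succ_apply, pow_succ]
  push_cast
  ring

lemma IsEntrance.unfold_iterate {b : Phase N} (hb : IsEntrance D b) (γ : ℝ) (f : Phase N → 𝕜)
    {y : ℝ} {k : ℕ} (hy : y + k * tau D b < tau D b) :
    unfold D γ f b y = ((γ ^ k : ℝ) : 𝕜) * unfold D γ f ((BounceBack.turn D)^[k] b) (y + k * tau D b) := by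
  induction k with
  | zero => simp
  | succ k ih =>
    have hτ := hb.tau_pos
    push_cast at hy
    have h1 : y + k * tau D b < 0 := by linarith
    rw [ih (by linarith), (hb.turn_iterate k).unfold_turn γ f h1, hb.tau_turn_iterate,
      Function.iterate_succ_apply']
    push_cast
    rw [show y + k * tau D b + tau D b = y + (k + 1) * tau D b by ring]
    ring

lemma turn_iterate_snd (b : Phase N) (n : ℕ) :
    ((turn D)^[n] b).2 = b.2 ∨ ((turn D)^[n] b).2 = -b.2 := by
  induction n with
  | zero => exact Or.inl rfl
  | succ n ih =>
    rw [Function.iterate_succ_apply', turn_snd]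
    rcases ih with h | h
    · right; rw [h]
    · left; rw [h, neg_neg]

lemma even_turn_iterate {σ : EuclideanSpace ℝ (Fin N) → ℝ} (hσ : ∀ v, σ (-v) = σ v) (b : Phase N)
    (n : ℕ) : σ ((turn D)^[n] b).2 = σ b.2 := by
  rcases turn_iterate_snd (D := D) b n with h | h
  · rw [h]
  · rw [h, hσ]

lemma IsEntrance.evolve_flow {b : Phase N} (hb : IsEntrance D b) (σ : EuclideanSpace ℝ (Fin N) → ℝ)
    (γ t : ℝ) (f : Phase N → 𝕜) {s : ℝ} (h0 : 0 ≤ s) (h1 : s ≤ tau D b) :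
    evolve D σ γ t f (flow s b)
      = (Real.exp (-(σ b.2 * t)) : 𝕜) * unfold D γ f b (s - t) := by
  rw [evolve, hb.entry_flow h0 h1, hb.tMinus_flow h0 h1, flow_snd]

/-- The backward trajectory from `z` is not on the boundary at time `t`. There the closed intervals
`reflectionInterval` overlap at their end points, so that two terms of the series could be
non-zero. -/
def IsGeneric (D : Set (EuclideanSpace ℝ (Fin N))) (t : ℝ) (z : Phase N) : Prop :=
  ∀ n : ℕ, tMinus D z - t + n * tau D z ≠ 0

/-- The semigroup law: in the unfolded coordinate both sides are translations. The evenness of the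
collision frequency makes the absorption independent of the direction of travel. -/
lemma evolve_evolve {b : Phase N} (hb : IsEntrance D b) {σ : EuclideanSpace ℝ (Fin N) → ℝ}
    (hσ : ∀ v, σ (-v) = σ v) (γ : ℝ) (f : Phase N → 𝕜) {r s t : ℝ} (hr0 : 0 ≤ r)
    (hr1 : r < tau D b) (hs : 0 ≤ s) (ht : 0 ≤ t) :
    evolve D σ γ s (evolve D σ γ t f) (flow r b) = evolve D σ γ (s + t) f (flow r b) := by
  obtain ⟨h0, h1⟩ := hb.bounces_spec (y := r - s) (by linarith)
  rw [hb.evolve_flow _ _ _ _ hr0 hr1.le, hb.evolve_flow _ _ _ _ hr0 hr1.le, unfold, place]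
  set k := bounces D b (r - s)
  have hbk := hb.turn_iterate k
  rw [hbk.evolve_flow _ _ _ _ h0 (by rw [hb.tau_turn_iterate]; exact h1.le),
    even_turn_iterate hσ, hb.unfold_iterate γ f (y := r - (s + t)) (k := k) (by linarith)]
  rw [show r - s + k * tau D b - t = r - (s + t) + k * tau D b by ring,
    show -(σ b.2 * (s + t)) = -(σ b.2 * s) + -(σ b.2 * t) by ring, Real.exp_add]
  push_cast
  ring

/-- In the unfolded coordinate the `n`-th term of the series is the part of the solution with
exactly `n` reflections. -/
lemma IsEntrance.seriesTerm_flow {b : Phase N} (hb : IsEntrance D b)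
    (σ : EuclideanSpace ℝ (Fin N) → ℝ) (γ : ℝ) (f : Phase N → 𝕜) {s t : ℝ} (ht : 0 ≤ t)
    (hs0 : 0 < s) (hs1 : s < tau D b) (hgen : IsGeneric D t (flow s b)) (n : ℕ) :
    seriesTerm D σ γ t f n (flow s b) =
      if bounces D b (s - t) = n then
        ((γ ^ n * Real.exp (-(σ b.2 * t)) : ℝ) : 𝕜) * f (place D b n (s - t)) else 0 := by
  have hτ := hb.tau_pos
  have hm : tMinus D (flow s b) = s := hb.tMinus_flow hs0.le hs1.le
  have hta : tau D (flow s b) = tau D b := hb.tau_flow hs0.le hs1.le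
  have hgen : ∀ n : ℕ, s - t + n * tau D b ≠ 0 := by
    intro n; have := hgen n; rwa [hm, hta] at this
  obtain ⟨h0, h1⟩ := hb.bounces_spec (y := s - t) (by linarith)
  cases n with
  | zero =>
    rw [seriesTerm, hm]
    by_cases h : t < s
    · rw [if_pos h, if_pos (hb.bounces_eq (by simp; linarith) (by simp; linarith))]
      simp [place, flow, sub_smul, add_sub_assoc]
    · rw [if_neg h, if_neg]
      intro h'
      rw [h'] at h0 h1
      have := hgen 0
      simp only [CharP.cast_eq_zero, zero_mul, add_zero] at h0 this
      exact this (le_antisymm (by linarith) h0)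
  | succ k =>
    have hcond : t ∈ reflectionInterval D k (flow s b) ↔ bounces D b (s - t) = k + 1 := by
      rw [reflectionInterval, hm, hta, mem_Icc]
      constructor
      · rintro ⟨h2, h3⟩
        refine hb.bounces_eq (by push_cast; linarith) (lt_of_le_of_ne (by push_cast; linarith) ?_)
        intro h4
        apply hgen k
        push_cast at h4
        linarith
      · intro h
        rw [h] at h0 h1
        push_cast at h0 h1
        constructor <;> linarith
    have hval : (if Even k then
            f ((flow s b).1 + t • (flow s b).2 - (2 * tMinus D (flow s b)) • (flow s b).2
              - (k * tau D (flow s b)) • (flow s b).2, -(flow s b).2)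
          else
            f ((flow s b).1 - t • (flow s b).2 + ((k + 1) * tau D (flow s b)) • (flow s b).2,
              (flow s b).2)) = f (place D b (k + 1) (s - t)) := by
      rw [hm, hta, place]
      rcases Nat.even_or_odd k with hk | hk
      · rw [if_pos hk, Function.iterate_succ_apply', hb.turn_iterate_even hk, flow_turn]
        congr 1
        ext1
        · simp only [flow_fst, flow_snd, rev_fst]
          push_cast
          module
        · rfl
      · rw [if_neg (Nat.not_even_iff_odd.2 hk), hb.turn_iterate_even hk.add_one]
        congr 1
        ext1
        · simp only [flow_fst, flow_snd]
          push_cast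
          module
        · rfl
    rw [seriesTerm, hval]
    by_cases h : bounces D b (s - t) = k + 1
    · rw [if_pos (hcond.2 h), if_pos h, flow_snd]
    · rw [if_neg (fun h' => h (hcond.1 h')), if_neg h]

/-! ### Measurability of the explicit solution -/

lemma measurable_turn_iterate (hDo : IsOpen D) (hDb : Bornology.IsBounded D) (n : ℕ) :
    Measurable ((turn D)^[n] : Phase N → Phase N) :=
  (measurable_turn hDo hDb).iterate n

lemma measurable_bounces (hDo : IsOpen D) (hDb : Bornology.IsBounded D) :
    Measurable fun q : Phase N × ℝ => bounces D q.1 q.2 :=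
  Nat.measurable_ceil.comp (measurable_snd.neg.div ((measurable_tau hDo hDb).comp measurable_fst))

lemma measurable_place (hDo : IsOpen D) (hDb : Bornology.IsBounded D) (n : ℕ) :
    Measurable fun q : Phase N × ℝ => place D q.1 n q.2 :=
  measurable_flow.comp ((measurable_snd.add (measurable_const.mul
    ((measurable_tau hDo hDb).comp measurable_fst))).prodMk
    ((measurable_turn_iterate hDo hDb n).comp measurable_fst))

lemma measurable_unfold (hDo : IsOpen D) (hDb : Bornology.IsBounded D) (γ : ℝ) {f : Phase N → 𝕜}
    (hf : Measurable f) : Measurable fun q : Phase N × ℝ => unfold D γ f q.1 q.2 := by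
  have h1 : Measurable fun w : (Phase N × ℝ) × ℕ =>
      ((γ ^ w.2 : ℝ) : 𝕜) * f (place D w.1.1 w.2 w.1.2) :=
    measurable_from_prod_countable_left fun n => by
      have h2 : Measurable fun q : Phase N × ℝ => f (place D q.1 n q.2) :=
        hf.comp (measurable_place hDo hDb n)
      exact h2.const_mul ((γ ^ n : ℝ) : 𝕜)
  exact h1.comp (measurable_id.prodMk (measurable_bounces hDo hDb))

lemma measurable_evolve (hDo : IsOpen D) (hDb : Bornology.IsBounded D)
    {σ : EuclideanSpace ℝ (Fin N) → ℝ} (hσ : Measurable σ) (γ : ℝ) {f : Phase N → 𝕜}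
    (hf : Measurable f) : Measurable fun q : Phase N × ℝ => evolve D σ γ q.2 f q.1 := by
  have h0 : Measurable fun q : Phase N × ℝ => σ q.1.2 :=
    hσ.comp (measurable_snd.comp measurable_fst)
  have h1 : Measurable fun q : Phase N × ℝ => ((Real.exp (-(σ q.1.2 * q.2)) : ℝ) : 𝕜) :=
    RCLike.measurable_ofReal.comp (Real.measurable_exp.comp (h0.mul measurable_snd).neg)
  have h2 : Measurable fun q : Phase N × ℝ => (entry D q.1, tMinus D q.1 - q.2) :=
    ((measurable_entry hDo hDb).comp measurable_fst).prodMk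
      (((measurable_tMinus hDo hDb).comp measurable_fst).sub measurable_snd)
  have h3 := (measurable_unfold hDo hDb γ hf).comp h2
  simp only [Function.comp_def] at h3
  simp only [evolve]
  exact h1.mul h3

/-! ### Null sets along the chords -/

/-- A measurable property that holds almost everywhere on almost every chord holds almost everywhere
in phase space. -/
lemma ae_of_chord (hN : 1 ≤ N) (hDo : IsOpen D) (hDc : Convex ℝ D)
    (hDb : Bornology.IsBounded D) {P : Phase N → Prop} (hP : MeasurableSet {z | P z})
    (h : ∀ᵐ b ∂chordMeasure D, ∀ᵐ s, s ∈ Ioo 0 (tau D b) → P (flow s b)) :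
    ∀ᵐ z ∂phaseMeasure D, P z := by
  rw [← map_chordProd hN hDo hDc hDb, ae_map_iff measurable_flow_swap.aemeasurable hP,
    ae_chordProd_iff hDo hDb]
  rw [Measure.ae_prod_iff_ae_ae]
  · exact h
  · have h1 : MeasurableSet {q : Phase N × ℝ | P (flow q.2 q.1)} := measurable_flow_swap hP
    have h2 := measurableSet_chord hDo hDb
    convert h2.compl.union h1 using 1
    ext q
    simp only [mem_union, mem_compl_iff, mem_ofPred_eq]
    tauto

lemma ae_isGeneric (hN : 1 ≤ N) (hDo : IsOpen D) (hDc : Convex ℝ D)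
    (hDb : Bornology.IsBounded D) (t : ℝ) : ∀ᵐ z ∂phaseMeasure D, IsGeneric D t z := by
  have hm : MeasurableSet {z : Phase N | IsGeneric D t z} := by
    have : {z : Phase N | IsGeneric D t z} =
        ⋂ n : ℕ, {z | tMinus D z - t + n * tau D z = 0}ᶜ := by
      ext z; simp [IsGeneric]
    rw [this]
    exact MeasurableSet.iInter fun n => (measurableSet_eq_fun (((measurable_tMinus hDo hDb).sub_const
      t).add ((measurable_tau hDo hDb).const_mul _)) measurable_const).compl
  refine ae_of_chord hN hDo hDc hDb hm ?_
  filter_upwards [ae_isEntrance hN hDo hDc hDb] with b hb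
  have hc : (range fun n : ℕ => t - n * tau D b).Countable := countable_range _
  filter_upwards [hc.ae_notMem volume] with s hs hs' n h
  rw [hb.tMinus_flow hs'.1.le hs'.2.le, hb.tau_flow hs'.1.le hs'.2.le] at h
  exact hs ⟨n, by simp only; linarith⟩

/-! ### Transport of the phase measure by reflected trajectories -/

/-- Tracing the trajectories with `n` reflections back over the time `t` does not increase the
phase measure: on each chord it is a translation of the unfolded coordinate. -/
lemma lintegral_place_le (hN : 1 ≤ N) (hDo : IsOpen D) (hDc : Convex ℝ D)
    (hDb : Bornology.IsBounded D) {t : ℝ} (ht : 0 ≤ t) (n : ℕ) {h : Phase N → ℝ≥0∞}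
    (hh : Measurable h) :
    ∫⁻ z in {z | bounces D (entry D z) (tMinus D z - t) = n},
        h (place D (entry D z) n (tMinus D z - t)) ∂phaseMeasure D
      ≤ ∫⁻ z, h z ∂phaseMeasure D := by
  have hpair : Measurable fun z : Phase N => (entry D z, tMinus D z - t) :=
    (measurable_entry hDo hDb).prodMk ((measurable_tMinus hDo hDb).sub_const t)
  have hP : MeasurableSet {z | bounces D (entry D z) (tMinus D z - t) = n} :=
    ((measurable_bounces hDo hDb).comp hpair) (measurableSet_singleton n)
  have hFm : Measurable fun z => h (place D (entry D z) n (tMinus D z - t)) :=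
    hh.comp ((measurable_place hDo hDb n).comp hpair)
  rw [← lintegral_indicator hP, ← lintegral_chord hN hDo hDc hDb hh,
    ← lintegral_chord hN hDo hDc hDb (hFm.indicator hP)]
  have hGm : Measurable fun b => ∫⁻ s in Ioo 0 (tau D b), h (flow s b) := by
    have h1 : Measurable ({q : Phase N × ℝ | 0 < q.2 ∧ q.2 < tau D q.1}.indicator
        fun q => h (flow q.2 q.1)) :=
      (hh.comp measurable_flow_swap).indicator (measurableSet_chord hDo hDb)
    have h2 : ∀ b, ∫⁻ s in Ioo 0 (tau D b), h (flow s b)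
        = ∫⁻ s, {q : Phase N × ℝ | 0 < q.2 ∧ q.2 < tau D q.1}.indicator
        (fun q => h (flow q.2 q.1)) (b, s) := fun b => by
      rw [← lintegral_indicator measurableSet_Ioo]; rfl
    simp_rw [h2]
    exact h1.lintegral_prod_right'
  rw [← (measurePreserving_turn_iterate hN hDo hDc hDb n).lintegral_comp hGm]
  refine lintegral_mono_ae ?_
  filter_upwards [ae_isEntrance hN hDo hDc hDb] with b hb
  rw [hb.tau_turn_iterate]
  set c : ℝ := n * tau D b - t with hc
  calc ∫⁻ s in Ioo 0 (tau D b), {z | bounces D (entry D z) (tMinus D z - t) = n}.indicator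
          (fun z => h (place D (entry D z) n (tMinus D z - t))) (flow s b)
      ≤ ∫⁻ s, (Ico 0 (tau D b)).indicator (fun y => h (flow y ((turn D)^[n] b))) (s + c) := by
        rw [← lintegral_indicator measurableSet_Ioo]
        refine lintegral_mono fun s => ?_
        by_cases hs : s ∈ Ioo 0 (tau D b)
        · rw [indicator_of_mem hs]
          by_cases hbn' : flow s b ∈ {z | bounces D (entry D z) (tMinus D z - t) = n}
          · rw [indicator_of_mem hbn']
            have h1 : bounces D (entry D (flow s b)) (tMinus D (flow s b) - t) = n := hbn'
            rw [hb.entry_flow hs.1.le hs.2.le, hb.tMinus_flow hs.1.le hs.2.le] at h1 ⊢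
            obtain ⟨h2, h3⟩ := hb.bounces_spec (y := s - t) (by linarith [hs.2])
            rw [h1] at h2 h3
            have e : s - t + n * tau D b = s + c := by rw [hc]; ring
            rw [e] at h2 h3
            rw [indicator_of_mem (show s + c ∈ Ico 0 (tau D b) from ⟨h2, h3⟩), place, e]
          · rw [indicator_of_notMem hbn']; exact bot_le
        · rw [indicator_of_notMem hs]; exact bot_le
    _ = ∫⁻ y in Ico 0 (tau D b), h (flow y ((turn D)^[n] b)) := by
        rw [lintegral_add_right_eq_self, lintegral_indicator measurableSet_Ico]
    _ = ∫⁻ y in Ioo 0 (tau D b), h (flow y ((turn D)^[n] b)) := by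
        rw [restrict_Ioo_eq_restrict_Ico]

end Unfold

/-! ### Weighted composition operators -/

section Weighted

variable {α : Type*} [MeasurableSpace α] {μ : Measure α} {𝕜 : Type*} [RCLike 𝕜] {p : ℝ≥0∞}

/-- Multiplication by a function bounded by `C` and composition with a map that does not increase the
measure have norm at most `C` on `L^p`. -/
lemma memLp_indicator_mul_comp {P : Set α} (hP : MeasurableSet P) {Φ : α → α} (hΦ : Measurable Φ)
    (hle : (μ.restrict P).map Φ ≤ μ) {c : α → 𝕜} (hc : Measurable c) {C : ℝ≥0}
    (hC : ∀ z, ‖c z‖ ≤ C) {φ : α → 𝕜} (hφ : MemLp φ p μ) :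
    MemLp (P.indicator fun z => c z * φ (Φ z)) p μ ∧
      eLpNorm (P.indicator fun z => c z * φ (Φ z)) p μ ≤ C * eLpNorm φ p μ := by
  have hφ' : AEStronglyMeasurable φ ((μ.restrict P).map Φ) :=
    hφ.aestronglyMeasurable.mono_ac (Measure.absolutelyContinuous_of_le hle)
  have h1 : AEStronglyMeasurable (fun z => c z * φ (Φ z)) (μ.restrict P) :=
    hc.aestronglyMeasurable.mul (hφ'.comp_measurable hΦ)
  have h2 : eLpNorm (P.indicator fun z => c z * φ (Φ z)) p μ ≤ C * eLpNorm φ p μ := by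
    rw [eLpNorm_indicator_eq_eLpNorm_restrict hP]
    calc eLpNorm (fun z => c z * φ (Φ z)) p (μ.restrict P)
        ≤ C * eLpNorm (φ ∘ Φ) p (μ.restrict P) := by
          rw [← smul_eq_mul, ← ENNReal.smul_def]
          refine eLpNorm_le_nnreal_smul_eLpNorm_of_ae_le_mul (Eventually.of_forall fun z => ?_) p
          rw [nnnorm_mul]
          exact mul_le_mul_of_nonneg_right (hC z) bot_le
      _ = C * eLpNorm φ p ((μ.restrict P).map Φ) := by
          rw [eLpNorm_map_measure hφ' hΦ.aemeasurable]
      _ ≤ C * eLpNorm φ p μ := by gcongr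
  exact ⟨⟨(aestronglyMeasurable_indicator_iff hP).2 h1,
    h2.trans_lt (ENNReal.mul_lt_top ENNReal.coe_lt_top hφ.2)⟩, h2⟩

/-- Weighted composition operators on `L^p`. -/
lemma exists_weightedComp [Fact (1 ≤ p)] {P : Set α} (hP : MeasurableSet P) {Φ : α → α}
    (hΦ : Measurable Φ) (hle : (μ.restrict P).map Φ ≤ μ) {c : α → 𝕜} (hc : Measurable c) {C : ℝ≥0}
    (hC : ∀ z, ‖c z‖ ≤ C) :
    ∃ W : Lp 𝕜 p μ →L[𝕜] Lp 𝕜 p μ, ‖W‖ ≤ C ∧ ∀ (φ : α → 𝕜) (hφ : MemLp φ p μ),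
      W (hφ.toLp φ) =ᵐ[μ] P.indicator fun z => c z * φ (Φ z) := by
  have key := fun {φ : α → 𝕜} (hφ : MemLp φ p μ) => memLp_indicator_mul_comp hP hΦ hle hc hC hφ
  have hae : ∀ {Q : α → Prop}, (∀ᵐ z ∂μ, Q z) → ∀ᵐ z ∂μ, z ∈ P → Q (Φ z) := by
    intro Q hQ
    rw [← ae_restrict_iff' hP]
    exact ae_of_ae_map hΦ.aemeasurable ((Measure.absolutelyContinuous_of_le hle).ae_le hQ)
  let W₀ : Lp 𝕜 p μ →ₗ[𝕜] Lp 𝕜 p μ :=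
    { toFun := fun f => (key (Lp.memLp f)).1.toLp _
      map_add' := fun f g => by
        rw [← MemLp.toLp_add]
        refine MemLp.toLp_congr _ _ ?_
        filter_upwards [hae (Lp.coeFn_add f g)] with z hz
        by_cases h : z ∈ P
        · simp only [indicator_of_mem h, Pi.add_apply, hz h]; ring
        · simp [indicator_of_notMem h]
      map_smul' := fun a f => by
        simp only [RingHom.id_apply]
        rw [← MemLp.toLp_const_smul]
        refine MemLp.toLp_congr _ _ ?_
        filter_upwards [hae (Lp.coeFn_smul a f)] with z hz
        by_cases h : z ∈ P
        · simp only [indicator_of_mem h, Pi.smul_apply, hz h, smul_eq_mul]; ring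
        · simp [indicator_of_notMem h] }
  have hb : ∀ f, ‖W₀ f‖ ≤ C * ‖f‖ := by
    intro f
    have h1 := (key (Lp.memLp f)).2
    change ‖(key (Lp.memLp f)).1.toLp _‖ ≤ _
    rw [Lp.norm_toLp, Lp.norm_def, ← ENNReal.coe_toReal, ← ENNReal.toReal_mul]
    exact ENNReal.toReal_mono (ENNReal.mul_ne_top ENNReal.coe_ne_top (Lp.memLp f).2.ne) h1
  refine ⟨W₀.mkContinuous C hb, LinearMap.mkContinuous_norm_le _ C.2 _, fun φ hφ => ?_⟩
  have h1 : W₀.mkContinuous C hb (hφ.toLp φ) = (key (Lp.memLp (hφ.toLp φ))).1.toLp _ := rfl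
  rw [h1]
  refine (MemLp.coeFn_toLp _).trans ?_
  filter_upwards [hae hφ.coeFn_toLp] with z hz
  by_cases h : z ∈ P
  · simp only [indicator_of_mem h, hz h]
  · simp [indicator_of_notMem h]

/-- Dominated convergence in `L^p` for filters that are countably generated. -/
lemma tendsto_eLpNorm_zero_of_dominated {ι : Type*} {l : Filter ι} [l.IsCountablyGenerated]
    (hp0 : p ≠ 0) (hp : p ≠ ⊤) {F : ι → α → 𝕜} {B : α → ℝ}
    (hF : ∀ i, AEStronglyMeasurable (F i) μ) (hB : MemLp B p μ)
    (hbound : ∀ᶠ i in l, ∀ᵐ z ∂μ, ‖F i z‖ ≤ B z)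
    (hlim : ∀ᵐ z ∂μ, Tendsto (fun i => F i z) l (𝓝 0)) :
    Tendsto (fun i => eLpNorm (F i) p μ) l (𝓝 0) := by
  have hp' : 0 < p.toReal := ENNReal.toReal_pos hp0 hp
  have h1 : Tendsto (fun i => ∫⁻ z, ‖F i z‖ₑ ^ p.toReal ∂μ) l (𝓝 (∫⁻ _, 0 ∂μ)) := by
    refine tendsto_lintegral_filter_of_dominated_convergence' (fun z => ‖B z‖ₑ ^ p.toReal)
      (Eventually.of_forall fun i => (hF i).enorm.pow_const _) ?_ ?_ ?_
    · filter_upwards [hbound] with i hi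
      filter_upwards [hi] with z hz
      gcongr
      exact enorm_le_iff_norm_le.2 (hz.trans (le_abs_self _))
    · exact (lintegral_rpow_enorm_lt_top_of_eLpNorm_lt_top hp0 hp hB.2).ne
    · filter_upwards [hlim] with z hz
      have h2 : Tendsto (fun i => ‖F i z‖ₑ) l (𝓝 0) := by
        simpa using hz.enorm
      simpa [hp', Function.comp_def] using (ENNReal.continuous_rpow_const (y := p.toReal)).tendsto 0 |>.comp h2
  have h2 : Tendsto (fun i => (∫⁻ z, ‖F i z‖ₑ ^ p.toReal ∂μ) ^ (1 / p.toReal)) l (𝓝 0) := by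
    have h3 := ((ENNReal.continuous_rpow_const (y := 1 / p.toReal)).tendsto _).comp h1
    simpa [hp', Function.comp_def] using h3
  refine h2.congr fun i => ?_
  rw [eLpNorm_eq_lintegral_rpow_enorm_toReal hp0 hp]

end Weighted

/-! ### The semigroup of the explicit solution -/

section Semigroup

variable {N : ℕ} {D : Set (EuclideanSpace ℝ (Fin N))} {𝕜 : Type*} [RCLike 𝕜] {p : ℝ≥0∞}
  {σ : EuclideanSpace ℝ (Fin N) → ℝ} {γ : ℝ}

/-- Almost everywhere the `n`-th term of the series is the value carried by trajectories with exactly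
`n` reflections. -/
lemma seriesTerm_ae (hN : 1 ≤ N) (hDo : IsOpen D) (hDc : Convex ℝ D)
    (hDb : Bornology.IsBounded D) (σ : EuclideanSpace ℝ (Fin N) → ℝ) (γ : ℝ) {t : ℝ} (ht : 0 ≤ t)
    (φ : Phase N → 𝕜) :
    ∀ᵐ z ∂phaseMeasure D, ∀ n, seriesTerm D σ γ t φ n z =
      if bounces D (entry D z) (tMinus D z - t) = n then
        ((γ ^ n * Real.exp (-(σ z.2 * t)) : ℝ) : 𝕜) * φ (place D (entry D z) n (tMinus D z - t))
      else 0 := by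
  filter_upwards [ae_inside hN hDo, ae_isGeneric hN hDo hDc hDb t] with z hz hg n
  obtain ⟨hb, hτ, hfl, h0, h1⟩ := isEntrance_entry hDo hDc hDb hz.1 hz.2
  have h2 := hb.seriesTerm_flow σ γ φ ht h0 (by rw [hτ]; exact h1) (by rw [hfl]; exact hg) n
  rwa [hfl, entry_snd] at h2

/-- The terms of the series are bounded operators; the reflections give the bound `γ ^ n`. -/
lemma exists_term (hN : 1 ≤ N) (hDo : IsOpen D) (hDc : Convex ℝ D)
    (hDb : Bornology.IsBounded D) [Fact (1 ≤ p)] (hσm : Measurable σ) (hσ0 : ∀ v, 0 ≤ σ v)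
    (hγ0 : 0 < γ) {t : ℝ} (ht : 0 ≤ t) (n : ℕ) :
    ∃ V : X 𝕜 p D →L[𝕜] X 𝕜 p D, ‖V‖ ≤ γ ^ n ∧
      ∀ (φ : Phase N → 𝕜) (hφ : MemLp φ p (phaseMeasure D)),
        V (hφ.toLp φ) =ᵐ[phaseMeasure D] seriesTerm D σ γ t φ n := by
  have hpair : Measurable fun z : Phase N => (entry D z, tMinus D z - t) :=
    (measurable_entry hDo hDb).prodMk ((measurable_tMinus hDo hDb).sub_const t)
  have hP : MeasurableSet {z | bounces D (entry D z) (tMinus D z - t) = n} :=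
    ((measurable_bounces hDo hDb).comp hpair) (measurableSet_singleton n)
  have hΦ : Measurable fun z => place D (entry D z) n (tMinus D z - t) :=
    (measurable_place hDo hDb n).comp hpair
  have hle : ((phaseMeasure D).restrict
      {z | bounces D (entry D z) (tMinus D z - t) = n}).map
        (fun z => place D (entry D z) n (tMinus D z - t)) ≤ phaseMeasure D := by
    refine Measure.le_iff.2 fun A hA => ?_
    have h1 := lintegral_place_le hN hDo hDc hDb ht n (h := A.indicator 1)
      (measurable_one.indicator hA)
    rw [lintegral_indicator_one hA] at h1
    refine le_trans (le_of_eq ?_) h1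
    rw [← lintegral_indicator_one hA, lintegral_map (measurable_one.indicator hA) hΦ]
  have hc : Measurable fun z : Phase N => ((γ ^ n * Real.exp (-(σ z.2 * t)) : ℝ) : 𝕜) := by
    have h1 : Measurable fun z : Phase N => σ z.2 := hσm.comp measurable_snd
    exact RCLike.measurable_ofReal.comp
      ((Real.measurable_exp.comp (h1.mul_const t).neg).const_mul (γ ^ n))
  obtain ⟨W, hW, hW'⟩ := exists_weightedComp (μ := phaseMeasure D) (p := p) hP hΦ hle hc
    (C := ⟨γ ^ n, by positivity⟩) (by
      intro z
      rw [RCLike.norm_ofReal, abs_of_nonneg (by positivity)]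
      refine mul_le_of_le_one_right (by positivity) (Real.exp_le_one_iff.2 ?_)
      have := mul_nonneg (hσ0 z.2) ht
      linarith)
  refine ⟨W, hW, fun φ hφ => (hW' φ hφ).trans ?_⟩
  filter_upwards [seriesTerm_ae hN hDo hDc hDb σ γ ht φ] with z hz
  rw [hz n, indicator_apply]
  rfl

/-- Almost everywhere the series has a single non-zero term, the value of the explicit solution. -/
lemma evolve_ae (hN : 1 ≤ N) (hDo : IsOpen D) (hDc : Convex ℝ D)
    (hDb : Bornology.IsBounded D) (σ : EuclideanSpace ℝ (Fin N) → ℝ) (γ : ℝ) {t : ℝ} (ht : 0 ≤ t)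
    (φ : Phase N → 𝕜) :
    ∀ᵐ z ∂phaseMeasure D, HasSum (fun n => seriesTerm D σ γ t φ n z) (evolve D σ γ t φ z) := by
  filter_upwards [seriesTerm_ae hN hDo hDc hDb σ γ ht φ] with z hz
  have h1 : evolve D σ γ t φ z
      = seriesTerm D σ γ t φ (bounces D (entry D z) (tMinus D z - t)) z := by
    rw [hz, if_pos rfl, evolve, unfold]
    push_cast
    ring
  rw [h1]
  refine hasSum_single _ fun n hn => ?_
  rw [hz, if_neg (Ne.symm hn)]

lemma norm_evolve_le (hσ0 : ∀ v, 0 ≤ σ v) (hγ0 : 0 < γ) (hγ1 : γ < 1) {t : ℝ} (ht : 0 ≤ t)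
    (φ : Phase N → 𝕜) (z : Phase N) :
    ‖evolve D σ γ t φ z‖ ≤ ‖φ (place D (entry D z) (bounces D (entry D z) (tMinus D z - t))
      (tMinus D z - t))‖ := by
  rw [evolve, unfold, ← mul_assoc, norm_mul, norm_mul, RCLike.norm_ofReal, RCLike.norm_ofReal,
    abs_of_nonneg (Real.exp_pos _).le, abs_of_nonneg (by positivity)]
  refine mul_le_of_le_one_left (norm_nonneg _) (mul_le_one₀ ?_ (by positivity)
    (pow_le_one₀ hγ0.le hγ1.le))
  rw [Real.exp_le_one_iff]
  have := mul_nonneg (hσ0 z.2) ht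
  linarith

lemma tendsto_evolve (hDo : IsOpen D) (hDc : Convex ℝ D) (hDb : Bornology.IsBounded D)
    {φ : Phase N → 𝕜} (hφ : Continuous φ) {z : Phase N} (hz : z.1 ∈ D) (hv : z.2 ≠ 0) :
    Tendsto (fun t : ℝ≥0 => evolve D σ γ t φ z) (𝓝 0) (𝓝 (φ z)) := by
  obtain ⟨hb, hτ, hfl, h0, h1⟩ := isEntrance_entry hDo hDc hDb hz hv
  have h2 : Tendsto (fun t : ℝ≥0 => (Real.exp (-(σ z.2 * t)) : 𝕜) * φ (flow (-(t : ℝ)) z)) (𝓝 0)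
      (𝓝 (φ z)) := by
    have h3 : Continuous fun t : ℝ≥0 => (Real.exp (-(σ z.2 * t)) : 𝕜) * φ (flow (-(t : ℝ)) z) := by
      refine Continuous.mul (RCLike.continuous_ofReal.comp (by fun_prop)) (hφ.comp ?_)
      unfold flow
      fun_prop
    have h4 := h3.tendsto 0
    simpa using h4
  refine h2.congr' ?_
  have h3 : ∀ᶠ t : ℝ≥0 in 𝓝 0, (t : ℝ) < tMinus D z := by
    have : Tendsto (fun t : ℝ≥0 => (t : ℝ)) (𝓝 0) (𝓝 0) := NNReal.continuous_coe.tendsto 0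
    exact this.eventually_lt_const h0
  filter_upwards [h3] with t ht
  rw [evolve, hb.unfold_chord γ φ (by linarith) (by rw [hτ]; have := t.coe_nonneg; linarith), sub_eq_neg_add,
    ← flow_flow, hfl]

/-- Strong continuity at `0` on continuous functions with compact support, by dominated
convergence: the speeds stay in a fixed ball, and the domain is bounded. -/
lemma tendsto_evolve_Lp (hN : 1 ≤ N) (hDo : IsOpen D) (hDc : Convex ℝ D)
    (hDb : Bornology.IsBounded D) (hp0 : p ≠ 0) (hp : p ≠ ⊤) (hσm : Measurable σ)
    (hσ0 : ∀ v, 0 ≤ σ v) (hγ0 : 0 < γ) (hγ1 : γ < 1) {φ : Phase N → 𝕜} (hφ : Continuous φ)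
    (hφc : HasCompactSupport φ) :
    Tendsto (fun t : ℝ≥0 => eLpNorm (fun z => evolve D σ γ t φ z - φ z) p (phaseMeasure D)) (𝓝 0)
      (𝓝 0) := by
  obtain ⟨R, hR⟩ := hφc.isCompact.isBounded.subset_closedBall (0 : Phase N)
  obtain ⟨K, hK⟩ := hφ.bounded_above_of_compact_support hφc
  have hsupp : ∀ z : Phase N, R < ‖z.2‖ → φ z = 0 := by
    intro z hz
    by_contra h
    have h1 := hR (subset_tsupport φ h)
    rw [mem_closedBall_zero_iff] at h1
    linarith [norm_snd_le z]
  have hS : MeasurableSet {z : Phase N | ‖z.2‖ ≤ R} :=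
    measurableSet_le measurable_snd.norm measurable_const
  have hSf : phaseMeasure D {z : Phase N | ‖z.2‖ ≤ R} ≠ ⊤ := by
    rw [phaseMeasure, Measure.restrict_apply hS]
    refine ((measure_mono (t := D ×ˢ Metric.closedBall 0 R) ?_).trans_lt ?_).ne
    · intro z hz
      exact ⟨hz.2.1, by simpa using hz.1⟩
    · rw [Measure.volume_eq_prod, Measure.prod_prod]
      exact ENNReal.mul_lt_top hDb.measure_lt_top Metric.isBounded_closedBall.measure_lt_top
  refine tendsto_eLpNorm_zero_of_dominated hp0 hp
    (B := {z : Phase N | ‖z.2‖ ≤ R}.indicator fun _ => 2 * K) ?_ ?_ ?_ ?_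
  · intro t
    have h1 : Measurable fun z : Phase N => (z, (t : ℝ)) := measurable_prodMk_right
    have h2 := (measurable_evolve hDo hDb hσm γ hφ.measurable).comp h1
    exact (h2.sub hφ.measurable).aestronglyMeasurable
  · exact memLp_indicator_const p hS _ (Or.inr hSf)
  · refine Eventually.of_forall fun t => Eventually.of_forall fun z => ?_
    by_cases hz : z ∈ {z : Phase N | ‖z.2‖ ≤ R}
    · rw [indicator_of_mem hz]
      calc ‖evolve D σ γ t φ z - φ z‖ ≤ ‖evolve D σ γ t φ z‖ + ‖φ z‖ := norm_sub_le _ _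
        _ ≤ K + K := add_le_add ((norm_evolve_le hσ0 hγ0 hγ1 t.coe_nonneg φ z).trans (hK _)) (hK _)
        _ = 2 * K := by ring
    · have hz' : R < ‖z.2‖ := by simpa using hz
      have h1 : evolve D σ γ t φ z = 0 := by
        rw [← norm_le_zero_iff]
        refine (norm_evolve_le hσ0 hγ0 hγ1 t.coe_nonneg φ z).trans ?_
        rw [hsupp, norm_zero]
        rw [place, flow_snd]
        rcases turn_iterate_snd (D := D) (entry D z)
          (bounces D (entry D z) (tMinus D z - t)) with h | h <;> rw [h] <;> simpa using hz'
      rw [indicator_of_notMem hz, h1, hsupp z hz', sub_zero, norm_zero]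
  · filter_upwards [ae_inside hN hDo] with z hz
    have h1 := (tendsto_evolve (σ := σ) (γ := γ) hDo hDc hDb hφ hz.1 hz.2).sub_const (φ z)
    simpa using h1

/-- The explicit formula defines a bounded `C₀`-semigroup, the sum in operator norm of the
series. -/
theorem exists_semigroup (hN : 1 ≤ N) (hDo : IsOpen D) (hDc : Convex ℝ D)
    (hDb : Bornology.IsBounded D) [Fact (1 ≤ p)] (hp : p ≠ ⊤) (hσm : Measurable σ)
    (hσ0 : ∀ v, 0 ≤ σ v) (hσe : ∀ v, σ (-v) = σ v) (hγ0 : 0 < γ) (hγ1 : γ < 1) :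
    ∃ U : ℝ≥0 → X 𝕜 p D →L[𝕜] X 𝕜 p D, IsC0Semigroup U ∧ (∀ t, ‖U t‖ ≤ (1 - γ)⁻¹) ∧
      (∀ (t : ℝ≥0) (φ : Phase N → 𝕜) (hφ : MemLp φ p (phaseMeasure D)),
        U t (hφ.toLp φ) =ᵐ[phaseMeasure D] evolve D σ γ t φ) ∧
      ∀ t : ℝ≥0, ∃ V : ℕ → X 𝕜 p D →L[𝕜] X 𝕜 p D,
        (∀ (n : ℕ) (φ : Phase N → 𝕜) (hφ : MemLp φ p (phaseMeasure D)),
          V n (hφ.toLp φ) =ᵐ[phaseMeasure D] seriesTerm D σ γ (t : ℝ) φ n) ∧ HasSum V (U t) := by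
  choose V hV hVae using fun (t : ℝ≥0) (n : ℕ) =>
    exists_term (𝕜 := 𝕜) (p := p) hN hDo hDc hDb hσm hσ0 hγ0 t.coe_nonneg n
  have hgeo := hasSum_geometric_of_lt_one hγ0.le hγ1
  have hsum : ∀ t, Summable (V t) := fun t =>
    Summable.of_norm_bounded hgeo.summable (hV t)
  have hU : ∀ t, ‖∑' n, V t n‖ ≤ (1 - γ)⁻¹ := fun t => tsum_of_norm_bounded hgeo (hV t)
  have hae : ∀ (t : ℝ≥0) (φ : Phase N → 𝕜) (hφ : MemLp φ p (phaseMeasure D)),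
      (∑' n, V t n) (hφ.toLp φ) =ᵐ[phaseMeasure D] evolve D σ γ t φ := by
    intro t φ hφ
    -- a subsequence of the partial sums converges almost everywhere
    have h1 : Tendsto (fun m => ∑ n ∈ Finset.range m, V t n (hφ.toLp φ)) atTop
        (𝓝 ((∑' n, V t n) (hφ.toLp φ))) := by
      have h2 := ((ContinuousLinearMap.apply 𝕜 (X 𝕜 p D) (hφ.toLp φ)).hasSum
        (hsum t).hasSum).tendsto_sum_nat
      simpa using h2
    obtain ⟨k, hk, hk'⟩ := (tendstoInMeasure_of_tendsto_Lp h1).exists_seq_tendsto_ae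
    have h3 : ∀ᵐ z ∂phaseMeasure D, ∀ m, (∑ n ∈ Finset.range m, V t n (hφ.toLp φ) : X 𝕜 p D) z
        = ∑ n ∈ Finset.range m, seriesTerm D σ γ t φ n z := by
      rw [ae_all_iff]
      intro m
      have h4 : ∀ᵐ z ∂phaseMeasure D, ∀ n, V t n (hφ.toLp φ) z = seriesTerm D σ γ t φ n z :=
        ae_all_iff.2 fun n => hVae t n φ hφ
      filter_upwards [h4, Lp.coeFn_finsetSum (Finset.range m) fun n => V t n (hφ.toLp φ)]
        with z hz hz'
      rw [hz', Finset.sum_apply]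
      exact Finset.sum_congr rfl fun n _ => hz n
    filter_upwards [hk', h3, evolve_ae hN hDo hDc hDb σ γ t.coe_nonneg φ] with z hz h3z hez
    simp only [h3z] at hz
    exact tendsto_nhds_unique hz (hez.tendsto_sum_nat.comp hk.tendsto_atTop)
  have hae' : ∀ (t : ℝ≥0) (f : X 𝕜 p D),
      (∑' n, V t n) f =ᵐ[phaseMeasure D] evolve D σ γ t f := by
    intro t f
    have h1 := hae t f (Lp.memLp f)
    rwa [Lp.toLp_coeFn] at h1
  refine ⟨fun t => ∑' n, V t n, ⟨?_, ?_, ?_⟩, hU, hae, fun t => ⟨V t, hVae t, (hsum t).hasSum⟩⟩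
  · ext1 f
    refine Lp.ext ((hae' 0 f).trans ?_)
    filter_upwards [ae_inside hN hDo] with z hz
    obtain ⟨hb, hτ, hfl, h0, h1⟩ := isEntrance_entry hDo hDc hDb hz.1 hz.2
    rw [evolve, hb.unfold_chord γ f (by simpa using h0.le) (by simpa [hτ] using h1)]
    simp [hfl]
  · intro s t
    ext1 f
    refine Lp.ext ((hae' (s + t) f).trans ?_)
    have h1 := (Lp.memLp ((∑' n, V t n) f)).ae_eq (hae' t f)
    have h2 : (∑' n, V t n) f = h1.toLp _ := by
      conv_lhs => rw [← Lp.toLp_coeFn ((∑' n, V t n) f) (Lp.memLp _)]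
      exact MemLp.toLp_congr _ _ (hae' t f)
    rw [ContinuousLinearMap.comp_apply, h2]
    refine EventuallyEq.trans ?_ (hae s _ h1).symm
    filter_upwards [ae_inside hN hDo] with z hz
    obtain ⟨hb, hτ, hfl, h0, h3⟩ := isEntrance_entry hDo hDc hDb hz.1 hz.2
    have h4 := evolve_evolve hb hσe γ f h0.le (by rw [hτ]; exact h3) s.coe_nonneg t.coe_nonneg
    rw [hfl] at h4
    exact h4.symm
  -- strong continuity, by approximation with continuous functions of compact support
  · intro f
    rw [Metric.tendsto_nhds]
    intro ε hε
    have hM : 0 < (1 - γ)⁻¹ := inv_pos.2 (by linarith)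
    set M := (1 - γ)⁻¹
    obtain ⟨δ, hδ, hδ'⟩ : ∃ δ : ℝ, 0 < δ ∧ (M + 2) * δ = ε :=
      ⟨ε / (M + 2), by positivity, by field_simp⟩
    have : (phaseMeasure D).Regular := by unfold phaseMeasure; infer_instance
    obtain ⟨φ, hφc, hfφ, hφ, hφL⟩ := (Lp.memLp f).exists_hasCompactSupport_eLpNorm_sub_le hp
      (ε := ENNReal.ofReal δ) (by simpa using hδ)
    have hp0 : p ≠ 0 := (zero_lt_one.trans_le (Fact.out : 1 ≤ p)).ne'
    have h1 := tendsto_evolve_Lp (σ := σ) (γ := γ) hN hDo hDc hDb hp0 hp hσm hσ0 hγ0 hγ1 hφ hφc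
    have h2 : ‖f - hφL.toLp φ‖ ≤ δ := by
      have h3 : f - hφL.toLp φ = ((Lp.memLp f).sub hφL).toLp _ := by
        rw [MemLp.toLp_sub (Lp.memLp f) hφL, Lp.toLp_coeFn]
      rw [h3, Lp.norm_toLp]
      exact ENNReal.toReal_le_of_le_ofReal hδ.le hfφ
    filter_upwards [h1.eventually_lt_const (ENNReal.ofReal_pos.2 hδ)] with t ht
    have h4 : ‖(∑' n, V t n) (hφL.toLp φ) - hφL.toLp φ‖ < δ := by
      rw [Lp.norm_def]
      refine (ENNReal.toReal_lt_of_lt_ofReal ?_)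
      refine lt_of_eq_of_lt (eLpNorm_congr_ae ?_) ht
      filter_upwards [Lp.coeFn_sub ((∑' n, V t n) (hφL.toLp φ)) (hφL.toLp φ), hae t φ hφL,
        hφL.coeFn_toLp] with z hz1 hz2 hz3
      rw [hz1, Pi.sub_apply, hz2, hz3]
    rw [dist_eq_norm]
    calc ‖(∑' n, V t n) f - f‖
        = ‖(∑' n, V t n) (f - hφL.toLp φ) + ((∑' n, V t n) (hφL.toLp φ) - hφL.toLp φ)
            - (f - hφL.toLp φ)‖ := by rw [map_sub]; congr 1; abel
      _ ≤ ‖(∑' n, V t n) (f - hφL.toLp φ)‖ + ‖(∑' n, V t n) (hφL.toLp φ) - hφL.toLp φ‖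
            + ‖f - hφL.toLp φ‖ := (norm_sub_le _ _).trans (by gcongr; exact norm_add_le _ _)
      _ < M * δ + δ + δ := by
          have h5 : ‖(∑' n, V t n) (f - hφL.toLp φ)‖ ≤ M * δ :=
            ((∑' n, V t n).le_of_opNorm_le (hU t) _).trans (by gcongr)
          linarith
      _ = ε := by rw [← hδ']; ring

end Semigroup

/-! ### Vector-valued integrals and exponential averages -/

section Pointwise

variable {α : Type*} [MeasurableSpace α] {μ : Measure α} {𝕜 : Type*} [RCLike 𝕜] {p : ℝ≥0∞}

/-- On a set of finite measure, the `L^p` norm controls the integral of the norm. -/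
lemma setIntegral_norm_le [Fact (1 ≤ p)] {s : Set α} (hs : μ s ≠ ⊤) (f : Lp 𝕜 p μ) :
    IntegrableOn f s μ ∧
      ∫ z in s, ‖f z‖ ∂μ ≤ (μ s ^ (1 - 1 / p.toReal)).toReal * ‖f‖ := by
  have h1p : 1 ≤ p := Fact.out
  have hf : AEStronglyMeasurable f (μ.restrict s) := (Lp.aestronglyMeasurable f).restrict
  have hC : μ s ^ (1 - 1 / p.toReal) ≠ ⊤ := by
    refine ENNReal.rpow_ne_top_of_nonneg ?_ hs
    rcases eq_or_ne p ⊤ with h | h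
    · simp [h]
    · have : 1 ≤ p.toReal := by simpa using ENNReal.toReal_mono h h1p
      rw [sub_nonneg, div_le_one (by linarith)]
      exact this
  have h1 : eLpNorm f 1 (μ.restrict s) ≤ eLpNorm f p μ * μ s ^ (1 - 1 / p.toReal) := by
    have h2 := eLpNorm_le_eLpNorm_mul_rpow_measure_univ (μ := μ.restrict s) h1p hf
    simp only [Measure.restrict_apply_univ, ENNReal.toReal_one, div_one] at h2
    refine h2.trans ?_
    gcongr
    exact Measure.restrict_le_self
  have h3 : eLpNorm f p μ * μ s ^ (1 - 1 / p.toReal) ≠ ⊤ :=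
    ENNReal.mul_ne_top (Lp.memLp f).2.ne hC
  have h4 : MemLp f 1 (μ.restrict s) := ⟨hf, h1.trans_lt h3.lt_top⟩
  refine ⟨memLp_one_iff_integrable.1 h4, ?_⟩
  rw [integral_norm_eq_lintegral_enorm hf, ← eLpNorm_one_eq_lintegral_enorm, Lp.norm_def, mul_comm,
    ← ENNReal.toReal_mul]
  exact ENNReal.toReal_mono h3 h1

/-- The Bochner integral of an `L^p`-valued function is computed pointwise. -/
lemma coeFn_integral_ae {β : Type*} [MeasurableSpace β] [SigmaFinite μ] [Fact (1 ≤ p)]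
    {ρ : Measure β} [SFinite ρ] {F : β → Lp 𝕜 p μ} {G : α × β → 𝕜} (hG : Measurable G)
    (hF : Integrable F ρ) (hFG : ∀ᵐ t ∂ρ, F t =ᵐ[μ] fun z => G (z, t)) :
    (∫ t, F t ∂ρ : Lp 𝕜 p μ) =ᵐ[μ] fun z => ∫ t, G (z, t) ∂ρ := by
  have key : ∀ s : Set α, MeasurableSet s → μ s < ⊤ →
      Integrable G ((μ.restrict s).prod ρ) := by
    intro s hs hsf
    rw [integrable_prod_iff' hG.aestronglyMeasurable]
    constructor
    · filter_upwards [hFG] with t ht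
      exact (setIntegral_norm_le hsf.ne (F t)).1.congr (ae_restrict_of_ae ht)
    · refine (hF.norm.const_mul ((μ s ^ (1 - 1 / p.toReal)).toReal)).mono ?_ ?_
      · exact (hG.norm.stronglyMeasurable.integral_prod_left').aestronglyMeasurable
      · filter_upwards [hFG] with t ht
        have h1 : ∫ z in s, ‖G (z, t)‖ ∂μ = ∫ z in s, ‖F t z‖ ∂μ :=
          integral_congr_ae (ae_restrict_of_ae (ht.mono fun z hz => by simp only [hz]))
        rw [h1, Real.norm_of_nonneg (integral_nonneg fun _ => norm_nonneg _)]
        exact (setIntegral_norm_le hsf.ne (F t)).2.trans (le_abs_self _)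
  refine ae_eq_of_forall_setIntegral_eq_of_sigmaFinite
    (fun s _ hs => (setIntegral_norm_le hs.ne _).1)
    (fun s hs hsf => (key s hs hsf).integral_prod_left) fun s hs hsf => ?_
  -- integration over a set of finite measure is a bounded functional
  let L : Lp 𝕜 p μ →L[𝕜] 𝕜 := LinearMap.mkContinuous
    { toFun := fun f => ∫ z in s, f z ∂μ
      map_add' := fun f g => by
        rw [← integral_add (setIntegral_norm_le hsf.ne f).1 (setIntegral_norm_le hsf.ne g).1]
        exact integral_congr_ae (ae_restrict_of_ae (Lp.coeFn_add f g))
      map_smul' := fun a f => by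
        rw [RingHom.id_apply, ← integral_smul]
        exact integral_congr_ae (ae_restrict_of_ae (Lp.coeFn_smul a f)) }
    ((μ s ^ (1 - 1 / p.toReal)).toReal)
    (fun f => (norm_integral_le_integral_norm _).trans (setIntegral_norm_le hsf.ne f).2)
  calc ∫ z in s, (∫ t, F t ∂ρ : Lp 𝕜 p μ) z ∂μ = L (∫ t, F t ∂ρ) := rfl
    _ = ∫ t, L (F t) ∂ρ := (L.integral_comp_comm hF).symm
    _ = ∫ t, (∫ z in s, G (z, t) ∂μ) ∂ρ := by
        refine integral_congr_ae ?_
        filter_upwards [hFG] with t ht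
        exact integral_congr_ae (ae_restrict_of_ae ht)
    _ = ∫ z in s, (∫ t, G (z, t) ∂ρ) ∂μ :=
        (integral_integral_swap (f := fun z t => G (z, t)) (key s hs hsf)).symm

end Pointwise

section Average

variable {𝕜 : Type*} [RCLike 𝕜] {κ q T : ℝ} {u : ℝ → 𝕜}

/-- The solution of `w' + κ w = u` that is given by an exponential average of the past of `u`. -/
def expAverage (κ : ℝ) (u : ℝ → 𝕜) (s : ℝ) : 𝕜 := ∫ t in Ioi 0, Real.exp (-(κ * t)) • u (s - t)

/-- The exponential probability density on the half-line. -/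
def expDensity (κ t : ℝ) : ℝ≥0∞ := ENNReal.ofReal (κ * Real.exp (-(κ * t)))

lemma measurable_expDensity (κ : ℝ) : Measurable (expDensity κ) := by
  unfold expDensity; fun_prop

lemma lintegral_expDensity (hκ : 0 < κ) : ∫⁻ t in Ioi 0, expDensity κ t = 1 := by
  have h1 := integral_exp_mul_Ioi (a := -κ) (by linarith) 0
  have h2 := integrableOn_exp_mul_Ioi (a := -κ) (by linarith) 0
  unfold expDensity
  rw [← ofReal_integral_eq_lintegral_ofReal, integral_const_mul]
  · simp only [← neg_mul]
    rw [h1]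
    simp [hκ.ne']
  · simp only [← neg_mul]
    exact h2.const_mul κ
  · exact Eventually.of_forall fun t => by positivity

/-- Jensen's inequality for the exponential average. -/
lemma enorm_expAverage_rpow_le (hκ : 0 < κ) (hq : 1 ≤ q) (hu : Measurable u) (s : ℝ) :
    ‖(κ : 𝕜) * expAverage κ u s‖ₑ ^ q ≤ ∫⁻ t in Ioi 0, expDensity κ t * ‖u (s - t)‖ₑ ^ q := by
  set m : Measure ℝ := (volume.restrict (Ioi 0)).withDensity (expDensity κ) with hm
  have : IsProbabilityMeasure m := ⟨by
    rw [hm, withDensity_apply _ MeasurableSet.univ, Measure.restrict_univ, lintegral_expDensity hκ]⟩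
  have hus : Measurable fun t => u (s - t) := hu.comp (measurable_const.sub measurable_id)
  have h1 : ‖(κ : 𝕜) * expAverage κ u s‖ₑ ≤ ∫⁻ t, ‖u (s - t)‖ₑ ∂m := by
    rw [hm, lintegral_withDensity_eq_lintegral_mul _ (measurable_expDensity κ) hus.enorm,
      expAverage, ← integral_const_mul]
    refine (enorm_integral_le_lintegral_enorm _).trans (lintegral_mono fun t => ?_)
    rw [enorm_mul, enorm_smul, ← mul_assoc]
    refine le_of_eq ?_
    simp only [Pi.mul_apply]
    congr 1
    rw [expDensity, ENNReal.ofReal_mul hκ.le, Real.enorm_of_nonneg (Real.exp_pos _).le,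
      ← ofReal_norm, RCLike.norm_ofReal, abs_of_pos hκ]
  have hq0 : 0 < q := by linarith
  have h2 := eLpNorm'_le_eLpNorm'_of_exponent_le zero_lt_one hq m
    hus.aestronglyMeasurable
  simp only [eLpNorm', ENNReal.rpow_one, ne_eq, one_ne_zero, not_false_eq_true, div_self] at h2
  calc ‖(κ : 𝕜) * expAverage κ u s‖ₑ ^ q ≤ ((∫⁻ t, ‖u (s - t)‖ₑ ^ q ∂m) ^ (1 / q)) ^ q := by
        gcongr
        exact h1.trans h2
    _ = ∫⁻ t, ‖u (s - t)‖ₑ ^ q ∂m := by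
        rw [← ENNReal.rpow_mul, one_div, inv_mul_cancel₀ hq0.ne', ENNReal.rpow_one]
    _ = ∫⁻ t in Ioi 0, expDensity κ t * ‖u (s - t)‖ₑ ^ q := by
        rw [hm, lintegral_withDensity_eq_lintegral_mul _ (measurable_expDensity κ)
          (hus.enorm.pow_const q)]
        rfl

lemma lintegral_past_le (s : ℝ) {t : ℝ} (ht : 0 < t) (h : ℝ → ℝ≥0∞) :
    ∫⁻ s in Iio s, h (s - t) ≤ ∫⁻ y in Iio s, h y := by
  rw [← lintegral_indicator measurableSet_Iio, ← lintegral_indicator measurableSet_Iio,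
    ← lintegral_sub_right_eq_self ((Iio s).indicator h) t]
  refine lintegral_mono fun r => ?_
  by_cases hr : r < s
  · rw [indicator_of_mem (show r ∈ Iio s from hr),
      indicator_of_mem (show r - t ∈ Iio s by simp only [mem_Iio]; linarith)]
  · rw [indicator_of_notMem (show r ∉ Iio s from hr)]
    exact bot_le

/-- The operator `u ↦ κ * expAverage κ u` is a contraction of `L^q` on half-lines, uniformly in `κ`:
this keeps the products of solutions with an unbounded collision frequency in `L^p`. -/
lemma lintegral_enorm_expAverage_rpow_le (hκ : 0 < κ) (hq : 1 ≤ q) (hu : Measurable u) (T : ℝ) :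
    ∫⁻ s in Iio T, ‖(κ : 𝕜) * expAverage κ u s‖ₑ ^ q ≤ ∫⁻ y in Iio T, ‖u y‖ₑ ^ q := by
  have hm : Measurable fun w : ℝ × ℝ => expDensity κ w.2 * ‖u (w.1 - w.2)‖ₑ ^ q :=
    ((measurable_expDensity κ).comp measurable_snd).mul
      ((hu.comp (measurable_fst.sub measurable_snd)).enorm.pow_const q)
  calc ∫⁻ s in Iio T, ‖(κ : 𝕜) * expAverage κ u s‖ₑ ^ q
      ≤ ∫⁻ s in Iio T, ∫⁻ t in Ioi 0, expDensity κ t * ‖u (s - t)‖ₑ ^ q :=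
        lintegral_mono fun s => enorm_expAverage_rpow_le hκ hq hu s
    _ = ∫⁻ t in Ioi 0, ∫⁻ s in Iio T, expDensity κ t * ‖u (s - t)‖ₑ ^ q :=
        lintegral_lintegral_swap hm.aemeasurable
    _ ≤ ∫⁻ t in Ioi 0, expDensity κ t * ∫⁻ y in Iio T, ‖u y‖ₑ ^ q := by
        refine setLIntegral_mono' measurableSet_Ioi fun t ht => ?_
        rw [lintegral_const_mul']
        · refine mul_le_mul_right ?_ _
          exact lintegral_past_le T ht fun y => ‖u y‖ₑ ^ q
        · exact ENNReal.ofReal_ne_top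
    _ = ∫⁻ y in Iio T, ‖u y‖ₑ ^ q := by
        rw [lintegral_mul_const _ (measurable_expDensity κ), lintegral_expDensity hκ, one_mul]

/-- A pointwise bound for the exponential average, which puts the traces in `L^p`. -/
lemma enorm_expAverage_rpow_le_lintegral (hκ : 1 ≤ κ) (hq : 1 ≤ q) (hu : Measurable u) {s : ℝ}
    (hs : s ≤ T) : ‖expAverage κ u s‖ₑ ^ q ≤ ∫⁻ y in Iio T, ‖u y‖ₑ ^ q := by
  have hκ0 : 0 < κ := by linarith
  have h1 := enorm_expAverage_rpow_le hκ0 hq hu s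
  have h2 : ∫⁻ t in Ioi 0, expDensity κ t * ‖u (s - t)‖ₑ ^ q
      ≤ ENNReal.ofReal κ * ∫⁻ y in Iio T, ‖u y‖ₑ ^ q := by
    calc ∫⁻ t in Ioi 0, expDensity κ t * ‖u (s - t)‖ₑ ^ q
        ≤ ∫⁻ t in Ioi 0, ENNReal.ofReal κ * ‖u (s - t)‖ₑ ^ q := by
          refine setLIntegral_mono' measurableSet_Ioi fun t ht => ?_
          gcongr
          refine ENNReal.ofReal_le_ofReal (mul_le_of_le_one_right hκ0.le ?_)
          rw [Real.exp_le_one_iff]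
          have := mul_pos hκ0 ht
          linarith
      _ = ENNReal.ofReal κ * ∫⁻ t in Ioi 0, ‖u (s - t)‖ₑ ^ q :=
          lintegral_const_mul' _ _ ENNReal.ofReal_ne_top
      _ ≤ ENNReal.ofReal κ * ∫⁻ y in Iio T, ‖u y‖ₑ ^ q := by
          refine mul_le_mul_right ?_ _
          rw [← lintegral_indicator measurableSet_Ioi, ← lintegral_indicator measurableSet_Iio,
            ← lintegral_sub_left_eq_self ((Iio T).indicator fun y => ‖u y‖ₑ ^ q) s]
          refine lintegral_mono fun t => ?_
          by_cases ht : 0 < t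
          · rw [indicator_of_mem (show t ∈ Ioi 0 from ht),
              indicator_of_mem (show s - t ∈ Iio T by simp only [mem_Iio]; linarith)]
          · rw [indicator_of_notMem (show t ∉ Ioi 0 from ht)]
            exact bot_le
  have h3 : ENNReal.ofReal κ * ‖expAverage κ u s‖ₑ ^ q
      ≤ ENNReal.ofReal κ * ∫⁻ y in Iio T, ‖u y‖ₑ ^ q := by
    refine le_trans ?_ (h1.trans h2)
    have h4 : ‖(κ : 𝕜)‖ₑ = ENNReal.ofReal κ := by
      rw [← ofReal_norm, RCLike.norm_ofReal, abs_of_pos hκ0]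
    rw [enorm_mul, ENNReal.mul_rpow_of_nonneg _ _ (by linarith), h4]
    gcongr
    have : 1 ≤ ENNReal.ofReal κ := by simpa using ENNReal.ofReal_le_ofReal hκ
    simpa using ENNReal.rpow_le_rpow_of_exponent_le this hq
  exact (ENNReal.mul_le_mul_iff_right (by simpa using hκ0) ENNReal.ofReal_ne_top).1 h3

lemma integrableOn_exp_smul (hκ : 0 < κ) (hq : 1 ≤ q) (hu : Measurable u)
    (hE : ∫⁻ y in Iio T, ‖u y‖ₑ ^ q ≠ ⊤) :
    IntegrableOn (fun y => Real.exp (κ * y) • u y) (Iic T) := by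
  rw [integrableOn_Iic_iff_integrableOn_Iio]
  have hm : Measurable fun y => Real.exp (κ * y) • u y :=
    (Real.measurable_exp.comp (measurable_id.const_mul κ)).smul hu
  have he : IntegrableOn (fun y => Real.exp (κ * y)) (Iio T) :=
    (integrableOn_exp_mul_Iic hκ T).mono_set Iio_subset_Iic_self
  refine ⟨hm.aestronglyMeasurable, ?_⟩
  rw [HasFiniteIntegral]
  -- `|u| ≤ 1 + |u|^q`
  calc ∫⁻ y in Iio T, ‖Real.exp (κ * y) • u y‖ₑ
      ≤ ∫⁻ y in Iio T, (‖Real.exp (κ * y)‖ₑ + ENNReal.ofReal (Real.exp (κ * T)) * ‖u y‖ₑ ^ q) := by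
        refine setLIntegral_mono' measurableSet_Iio fun y hy => ?_
        rw [enorm_smul]
        rcases le_total ‖u y‖ₑ 1 with h | h
        · exact le_add_right (mul_le_of_le_one_right' h)
        · refine le_add_left ?_
          gcongr
          · rw [Real.enorm_of_nonneg (Real.exp_pos _).le]
            refine ENNReal.ofReal_le_ofReal (Real.exp_le_exp.2 ?_)
            have := (mem_Iio.1 hy).le
            gcongr
          · simpa using ENNReal.rpow_le_rpow_of_exponent_le h hq
    _ = (∫⁻ y in Iio T, ‖Real.exp (κ * y)‖ₑ)
          + ENNReal.ofReal (Real.exp (κ * T)) * ∫⁻ y in Iio T, ‖u y‖ₑ ^ q := by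
        rw [lintegral_add_right _ ((hu.enorm.pow_const q).const_mul _),
          lintegral_const_mul' _ _ ENNReal.ofReal_ne_top]
    _ < ⊤ := ENNReal.add_lt_top.2 ⟨he.2, ENNReal.mul_lt_top ENNReal.ofReal_lt_top hE.lt_top⟩

/-- The exponential average in terms of a primitive, as in the variation of constants. -/
lemma expAverage_eq (κ : ℝ) (u : ℝ → 𝕜) (s : ℝ) :
    expAverage κ u s = Real.exp (-(κ * s)) • ∫ y in Iic s, Real.exp (κ * y) • u y := by
  rw [expAverage, ← integral_smul, ← integral_indicator measurableSet_Ioi,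
    ← integral_indicator measurableSet_Iic,
    ← integral_sub_left_eq_self (μ := volume) ((Ioi (0 : ℝ)).indicator _) s]
  refine integral_congr_ae ?_
  filter_upwards [(countable_singleton s).ae_notMem volume] with y hy
  rcases lt_or_ge y s with h | h
  · rw [indicator_of_mem (show s - y ∈ Ioi 0 by simp only [mem_Ioi]; linarith),
      indicator_of_mem (show y ∈ Iic s from h.le), smul_smul, ← Real.exp_add]
    congr 2
    · ring_nf
    · ring
  · have h' : s < y := lt_of_le_of_ne h fun h' => hy h'.symm
    rw [indicator_of_notMem (show s - y ∉ Ioi 0 by simp only [mem_Ioi]; linarith),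
      indicator_of_notMem (show y ∉ Iic s from not_le.2 h')]

lemma continuousOn_expAverage (hκ : 0 < κ) (hq : 1 ≤ q) (hu : Measurable u)
    (hE : ∫⁻ y in Iio T, ‖u y‖ₑ ^ q ≠ ⊤) : ContinuousOn (expAverage κ u) (Iic T) := by
  have h1 := integrableOn_exp_smul hκ hq hu hE
  have h2 : ContinuousOn (fun s => ∫ y in Iic s, Real.exp (κ * y) • u y) (Iic T) :=
    IntegrableOn.continuousOn_Iic_primitive_Iic h1
  have h3 : Continuous fun s : ℝ => Real.exp (-(κ * s)) := by fun_prop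
  exact (h3.continuousOn.smul h2).congr fun s _ => expAverage_eq κ u s

/-- Integration by parts against the primitive of an integrable function, by Fubini. -/
lemma integral_deriv_smul_primitive {ζ ζ' : ℝ → ℝ} (hζ : ∀ s, HasDerivAt ζ (ζ' s) s)
    (hζ' : Continuous ζ') (hT : 0 < T) (h0 : ζ 0 = 0) (h1 : ζ T = 0) {w : ℝ → 𝕜}
    (hw : IntegrableOn w (Iic T)) :
    ∫ s in Ioo 0 T, ζ' s • (∫ y in Iic s, w y) = - ∫ s in Ioo 0 T, ζ s • w s := by
  have hI : IntegrableOn ζ' (Ioo 0 T) :=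
    (hζ'.integrableOn_Icc (a := 0) (b := T)).mono_set Ioo_subset_Icc_self
  have hprod : Integrable (Function.uncurry fun s y => (Iic s).indicator (fun y => ζ' s • w y) y)
      ((volume.restrict (Ioo 0 T)).prod (volume.restrict (Iic T))) := by
    have h2 : Integrable (fun r : ℝ × ℝ => ζ' r.1 • w r.2)
        ((volume.restrict (Ioo 0 T)).prod (volume.restrict (Iic T))) := hI.smul_prod hw
    have h3 : MeasurableSet {r : ℝ × ℝ | r.2 ≤ r.1} := measurableSet_le measurable_snd measurable_fst
    refine (h2.indicator h3).congr (Eventually.of_forall fun r => ?_)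
    simp only [Function.uncurry, indicator_apply, mem_Iic]
    rfl
  calc ∫ s in Ioo 0 T, ζ' s • (∫ y in Iic s, w y)
      = ∫ s in Ioo 0 T, ∫ y in Iic T, (Iic s).indicator (fun y => ζ' s • w y) y := by
        refine setIntegral_congr_fun measurableSet_Ioo fun s hs => ?_
        rw [integral_indicator measurableSet_Iic, Measure.restrict_restrict measurableSet_Iic,
          Iic_inter_Iic, min_eq_left hs.2.le, integral_smul]
    _ = ∫ y in Iic T, ∫ s in Ioo 0 T, (Iic s).indicator (fun y => ζ' s • w y) y :=
        integral_integral_swap hprod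
    _ = ∫ y in Iic T, - (Ioo 0 T).indicator (fun s => ζ s • w s) y := by
        refine setIntegral_congr_fun measurableSet_Iic fun y hy => ?_
        have h2 : ∫ s in Ioo 0 T, (Iic s).indicator (fun y => ζ' s • w y) y
            = (∫ s in (max 0 y)..T, ζ' s) • w y := by
          have h3 : ∀ s, (Iic s).indicator (fun y => ζ' s • w y) y
              = (Ici y).indicator (fun s => ζ' s • w y) s := fun s => by
            simp only [indicator_apply, mem_Iic, mem_Ici]
          simp_rw [h3]
          rw [integral_indicator measurableSet_Ici, Measure.restrict_restrict measurableSet_Ici,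
            intervalIntegral.integral_of_le (max_le hT.le hy), ← integral_smul_const]
          refine setIntegral_congr_set ?_
          have h4 : ∀ᵐ s : ℝ, s ≠ T ∧ s ≠ y := by
            filter_upwards [(countable_singleton T).ae_notMem volume,
              (countable_singleton y).ae_notMem volume] with s hs1 hs2
            exact ⟨hs1, hs2⟩
          filter_upwards [h4] with s hs
          apply propext
          change (y ≤ s ∧ 0 < s ∧ s < T) ↔ (max 0 y < s ∧ s ≤ T)
          rw [max_lt_iff]
          constructor
          · rintro ⟨a, b, c⟩
            exact ⟨⟨b, lt_of_le_of_ne a (Ne.symm hs.2)⟩, c.le⟩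
          · rintro ⟨⟨a, b⟩, c⟩
            exact ⟨b.le, a, lt_of_le_of_ne c hs.1⟩
        rw [h2, intervalIntegral.integral_eq_sub_of_hasDerivAt (fun s _ => hζ s)
          (hζ'.intervalIntegrable _ _), h1]
        rcases le_or_gt y 0 with h | h
        · rw [max_eq_left h, h0, indicator_of_notMem (fun h' => absurd h'.1 (not_lt.2 h))]
          simp
        · rw [max_eq_right h.le]
          rcases eq_or_lt_of_le (mem_Iic.1 hy) with h' | h'
          · rw [h', h1, indicator_of_notMem (fun h' => absurd h'.2 (lt_irrefl _))]
            simp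
          · rw [indicator_of_mem (show y ∈ Ioo 0 T from ⟨h, h'⟩)]
            simp
    _ = - ∫ s in Ioo 0 T, ζ s • w s := by
        rw [integral_neg, integral_indicator measurableSet_Ioo,
          Measure.restrict_restrict measurableSet_Ioo,
          inter_eq_left.2 (fun s hs => (mem_Iic.2 hs.2.le))]

/-- The exponential average solves `w' + κ w = u` weakly. -/
lemma integral_deriv_smul_expAverage (hκ : 0 < κ) (hq : 1 ≤ q) (hu : Measurable u) (hT : 0 < T)
    (hE : ∫⁻ y in Iio T, ‖u y‖ₑ ^ q ≠ ⊤) {η η' : ℝ → ℝ} (hη : ∀ s, HasDerivAt η (η' s) s)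
    (hη' : Continuous η') (h0 : η 0 = 0) (h1 : η T = 0) :
    ∫ s in Ioo 0 T, (η' s • expAverage κ u s + η s • (u s - (κ : 𝕜) * expAverage κ u s)) = 0 := by
  have hw := integrableOn_exp_smul hκ hq hu hE
  set w : ℝ → 𝕜 := fun y => Real.exp (κ * y) • u y with hw_def
  have hη0 : Continuous η := continuous_iff_continuousAt.2 fun s => (hη s).continuousAt
  have hsub : Ioo 0 T ⊆ Iic T := fun s hs => hs.2.le
  have hG : ContinuousOn (fun s => ∫ y in Iic s, w y) (Icc 0 T) :=
    (IntegrableOn.continuousOn_Iic_primitive_Iic hw).mono fun s hs => hs.2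
  have he : ∀ s, HasDerivAt (fun s => Real.exp (-(κ * s))) (-κ * Real.exp (-(κ * s))) s := by
    intro s
    have h2 : HasDerivAt (fun s => -(κ * s)) (-κ) s := by
      simpa [Pi.neg_def] using ((hasDerivAt_id s).const_mul κ).neg
    simpa [mul_comm] using h2.exp
  set ζ : ℝ → ℝ := fun s => η s * Real.exp (-(κ * s)) with hζ_def
  set ζ' : ℝ → ℝ := fun s => η' s * Real.exp (-(κ * s)) + η s * (-κ * Real.exp (-(κ * s)))
    with hζ'_def
  have hζ : ∀ s, HasDerivAt ζ (ζ' s) s := fun s => (hη s).mul (he s)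
  have hζc : Continuous ζ' := by fun_prop
  have h2 := integral_deriv_smul_primitive hζ hζc hT (by simp [hζ_def, h0]) (by simp [hζ_def, h1])
    hw
  have hi1 : IntegrableOn (fun s => ζ' s • ∫ y in Iic s, w y) (Ioo 0 T) :=
    ((hζc.continuousOn.smul hG).integrableOn_Icc).mono_set Ioo_subset_Icc_self
  have hi2 : IntegrableOn (fun s => ζ s • w s) (Ioo 0 T) := by
    have hζ0 : Continuous ζ := by fun_prop
    have h3 : IntegrableOn (fun s => ζ s • w s) (Icc 0 T) :=
      (hw.mono_set (Icc_subset_Iic_self)).continuousOn_smul hζ0.continuousOn isCompact_Icc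
    exact h3.mono_set Ioo_subset_Icc_self
  rw [← sub_eq_zero, sub_neg_eq_add, ← integral_add hi1 hi2] at h2
  rw [← h2]
  refine setIntegral_congr_fun measurableSet_Ioo fun s _ => ?_
  simp only [expAverage_eq, hζ_def, hζ'_def, hw_def, RCLike.real_smul_eq_coe_mul]
  have h4 : ((Real.exp (-(κ * s)) : ℝ) : 𝕜) * ((Real.exp (κ * s) : ℝ) : 𝕜) = 1 := by
    rw [← RCLike.ofReal_mul, ← Real.exp_add]
    simp
  push_cast
  linear_combination -(η s : 𝕜) * u s * h4

end Average

/-! ### The stationary solution -/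

section Stationary

variable {N : ℕ} {D : Set (EuclideanSpace ℝ (Fin N))} {𝕜 : Type*} [RCLike 𝕜] {p : ℝ≥0∞}
  {σ : EuclideanSpace ℝ (Fin N) → ℝ} {γ : ℝ} {f : Phase N → 𝕜}

/-- The solution of `w' + (1 + Σ) w = f` along the chord with entrance `b`, continued through the
boundary by reflections; it is extended to `s = 0` and `s = τ(b)`, where it gives the traces. -/
def chordSolution (D : Set (EuclideanSpace ℝ (Fin N))) (σ : EuclideanSpace ℝ (Fin N) → ℝ) (γ : ℝ)
    (f : Phase N → 𝕜) (b : Phase N) (s : ℝ) : 𝕜 :=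
  expAverage (1 + σ b.2) (unfold D γ f b) s

/-- The solution of `v · ∇ₓ ψ + (1 + Σ) ψ = f` with bounce-back boundary conditions. -/
def stationary (D : Set (EuclideanSpace ℝ (Fin N))) (σ : EuclideanSpace ℝ (Fin N) → ℝ) (γ : ℝ)
    (f : Phase N → 𝕜) (z : Phase N) : 𝕜 :=
  chordSolution D σ γ f (entry D z) (tMinus D z)

/-- The integral of the `q`-th power of the norm of the unfolded function over the whole past of a
chord. -/
def pastEnergy (D : Set (EuclideanSpace ℝ (Fin N))) (γ q : ℝ) (f : Phase N → 𝕜) (b : Phase N) :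
    ℝ≥0∞ :=
  ∫⁻ y in Iio (tau D b), ‖unfold D γ f b y‖ₑ ^ q

lemma IsEntrance.stationary_flow {b : Phase N} (hb : IsEntrance D b) {s : ℝ} (h0 : 0 ≤ s)
    (h1 : s ≤ tau D b) : stationary D σ γ f (flow s b) = chordSolution D σ γ f b s := by
  rw [stationary, hb.entry_flow h0 h1, hb.tMinus_flow h0 h1]

lemma measurable_unfold_right (hDo : IsOpen D) (hDb : Bornology.IsBounded D) (γ : ℝ)
    (hf : Measurable f) (b : Phase N) : Measurable (unfold D γ f b) := by
  have h := (measurable_unfold hDo hDb γ hf).comp (measurable_prodMk_left (x := b))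
  simp only [Function.comp_def] at h
  exact h

lemma measurable_chordSolution (hDo : IsOpen D) (hDb : Bornology.IsBounded D) (hσm : Measurable σ)
    (γ : ℝ) (hf : Measurable f) :
    Measurable fun q : Phase N × ℝ => chordSolution D σ γ f q.1 q.2 := by
  have h0 : Measurable fun w : (Phase N × ℝ) × ℝ => (w.1.1, w.1.2 - w.2) :=
    (measurable_fst.comp measurable_fst).prodMk ((measurable_snd.comp measurable_fst).sub
      measurable_snd)
  have h1 := (measurable_unfold hDo hDb γ hf).comp h0
  have h2 : Measurable fun w : (Phase N × ℝ) × ℝ => σ w.1.1.2 :=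
    hσm.comp (measurable_snd.comp (measurable_fst.comp measurable_fst))
  have h3 : Measurable fun w : (Phase N × ℝ) × ℝ => Real.exp (-((1 + σ w.1.1.2) * w.2)) :=
    Real.measurable_exp.comp ((h2.const_add 1).mul measurable_snd).neg
  exact ((h3.smul h1).stronglyMeasurable.integral_prod_right'
    (ν := volume.restrict (Ioi (0 : ℝ)))).measurable

lemma measurable_stationary (hDo : IsOpen D) (hDb : Bornology.IsBounded D) (hσm : Measurable σ)
    (γ : ℝ) (hf : Measurable f) : Measurable (stationary D σ γ f) :=
  (measurable_chordSolution hDo hDb hσm γ hf).comp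
    ((measurable_entry hDo hDb).prodMk (measurable_tMinus hDo hDb))

lemma measurable_pastEnergy (hDo : IsOpen D) (hDb : Bornology.IsBounded D) (γ q : ℝ)
    (hf : Measurable f) : Measurable (pastEnergy D γ q f) := by
  have h1 : MeasurableSet {w : Phase N × ℝ | w.2 < tau D w.1} :=
    measurableSet_lt measurable_snd ((measurable_tau hDo hDb).comp measurable_fst)
  have h2 := (((measurable_unfold hDo hDb γ hf).enorm.pow_const q).indicator h1).lintegral_prod_right'
    (ν := volume)
  convert h2 using 2 with b
  rw [pastEnergy, ← lintegral_indicator measurableSet_Iio]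
  rfl

/-- Each reflection costs a factor `γ`, so that the energy of the past is a geometric series. -/
lemma lintegral_pastEnergy_lt_top (hN : 1 ≤ N) (hDo : IsOpen D) (hDc : Convex ℝ D)
    (hDb : Bornology.IsBounded D) (hγ0 : 0 < γ) (hγ1 : γ < 1) {q : ℝ} (hq : 1 ≤ q)
    (hf : Measurable f) (hfq : ∫⁻ z, ‖f z‖ₑ ^ q ∂phaseMeasure D < ⊤) :
    ∫⁻ b, pastEnergy D γ q f b ∂chordMeasure D < ⊤ := by
  set c : ℝ≥0∞ := ENNReal.ofReal γ with hc
  have hc1 : c < 1 := by rw [hc, ENNReal.ofReal_lt_one]; exact hγ1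
  have hfm : Measurable fun z => ‖f z‖ₑ ^ q := hf.enorm.pow_const q
  have hGm : Measurable fun b => ∫⁻ s in Ioo 0 (tau D b), ‖f (flow s b)‖ₑ ^ q := by
    have h2 := ((hfm.comp measurable_flow_swap).indicator
      (measurableSet_chord hDo hDb)).lintegral_prod_right' (ν := volume)
    convert h2 using 2 with b
    rw [← lintegral_indicator measurableSet_Ioo]
    rfl
  have key : ∀ᵐ b ∂chordMeasure D, pastEnergy D γ q f b ≤
      ∑' n : ℕ, c ^ n * ∫⁻ s in Ioo 0 (tau D ((turn D)^[n] b)), ‖f (flow s ((turn D)^[n] b))‖ₑ ^ q := by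
    filter_upwards [ae_isEntrance hN hDo hDc hDb] with b hb
    have hsub : Iio (tau D b) ⊆ ⋃ n : ℕ, Ico (-(n * tau D b)) (tau D b - n * tau D b) := by
      intro y hy
      obtain ⟨h1, h2⟩ := hb.bounces_spec (mem_Iio.1 hy)
      exact mem_iUnion.2 ⟨bounces D b y, by linarith, by linarith⟩
    refine (lintegral_mono_set hsub).trans ((lintegral_iUnion_le _ _).trans ?_)
    refine ENNReal.tsum_le_tsum fun n => ?_
    rw [hb.tau_turn_iterate, restrict_Ioo_eq_restrict_Ico, ← lintegral_indicator measurableSet_Ico,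
      ← lintegral_indicator measurableSet_Ico, ← lintegral_const_mul' _ _ (by
        exact ENNReal.pow_ne_top ENNReal.ofReal_ne_top),
      ← lintegral_add_right_eq_self (μ := volume) (fun s => c ^ n * _) (n * tau D b)]
    refine lintegral_mono fun y => ?_
    by_cases hy : y ∈ Ico (-(n * tau D b)) (tau D b - n * tau D b)
    · have h1 : 0 ≤ y + n * tau D b := by linarith [hy.1]
      have h2 : y + n * tau D b < tau D b := by linarith [hy.2]
      rw [indicator_of_mem hy, indicator_of_mem (show y + n * tau D b ∈ Ico 0 (tau D b) from ⟨h1, h2⟩),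
        hb.unfold_eq γ f h1 h2, enorm_mul, ENNReal.mul_rpow_of_nonneg _ _ (by linarith), place]
      gcongr
      rw [← ofReal_norm, RCLike.norm_ofReal, abs_of_pos (by positivity), ENNReal.ofReal_pow hγ0.le]
      have h3 : c ^ n ≤ 1 := pow_le_one' hc1.le n
      simpa using ENNReal.rpow_le_rpow_of_exponent_ge h3 hq
    · rw [indicator_of_notMem hy]
      exact bot_le
  calc ∫⁻ b, pastEnergy D γ q f b ∂chordMeasure D
      ≤ ∫⁻ b, (∑' n : ℕ, c ^ n * ∫⁻ s in Ioo 0 (tau D ((turn D)^[n] b)),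
          ‖f (flow s ((turn D)^[n] b))‖ₑ ^ q) ∂chordMeasure D := lintegral_mono_ae key
    _ = ∑' n : ℕ, c ^ n * ∫⁻ z, ‖f z‖ₑ ^ q ∂phaseMeasure D := by
        have h0 : ∀ n, Measurable fun b => ∫⁻ s in Ioo 0 (tau D ((turn D)^[n] b)),
            ‖f (flow s ((turn D)^[n] b))‖ₑ ^ q := fun n =>
          hGm.comp (measurable_turn_iterate hDo hDb n)
        rw [lintegral_tsum fun n => ((h0 n).const_mul _).aemeasurable]
        refine tsum_congr fun n => ?_
        have h1 := (measurePreserving_turn_iterate hN hDo hDc hDb n).lintegral_comp hGm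
        rw [lintegral_const_mul _ (h0 n), h1,
          lintegral_chord hN hDo hDc hDb hfm]
    _ = (1 - c)⁻¹ * ∫⁻ z, ‖f z‖ₑ ^ q ∂phaseMeasure D := by
        rw [ENNReal.tsum_mul_right, ENNReal.tsum_geometric]
    _ < ⊤ := ENNReal.mul_lt_top (ENNReal.inv_lt_top.2 (tsub_pos_of_lt hc1)) hfq

lemma ae_pastEnergy_ne_top (hN : 1 ≤ N) (hDo : IsOpen D) (hDc : Convex ℝ D)
    (hDb : Bornology.IsBounded D) (hγ0 : 0 < γ) (hγ1 : γ < 1) {q : ℝ} (hq : 1 ≤ q)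
    (hf : Measurable f) (hfq : ∫⁻ z, ‖f z‖ₑ ^ q ∂phaseMeasure D < ⊤) :
    ∀ᵐ b ∂chordMeasure D, pastEnergy D γ q f b ≠ ⊤ := by
  filter_upwards [ae_lt_top (measurable_pastEnergy hDo hDb γ q hf)
    (lintegral_pastEnergy_lt_top hN hDo hDc hDb hγ0 hγ1 hq hf hfq).ne] with b hb
  exact hb.ne

/-- The product of the stationary solution with `1 + Σ` is in `L^p`, even if `Σ` is unbounded. -/
lemma memLp_mul_stationary (hN : 1 ≤ N) (hDo : IsOpen D) (hDc : Convex ℝ D)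
    (hDb : Bornology.IsBounded D) (hp1 : 1 ≤ p) (hp : p ≠ ⊤) (hσm : Measurable σ)
    (hσ0 : ∀ v, 0 ≤ σ v) (hγ0 : 0 < γ) (hγ1 : γ < 1) (hf : Measurable f)
    (hfp : MemLp f p (phaseMeasure D)) :
    MemLp (fun z => ((1 + σ z.2 : ℝ) : 𝕜) * stationary D σ γ f z) p (phaseMeasure D) := by
  have hp0 : p ≠ 0 := (zero_lt_one.trans_le hp1).ne'
  have hq : 1 ≤ p.toReal := by simpa using ENNReal.toReal_mono hp hp1
  have hσ2 : Measurable fun z : Phase N => σ z.2 := hσm.comp measurable_snd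
  have hm : Measurable fun z : Phase N => ((1 + σ z.2 : ℝ) : 𝕜) * stationary D σ γ f z :=
    (RCLike.measurable_ofReal.comp (hσ2.const_add 1)).mul (measurable_stationary hDo hDb hσm γ hf)
  refine ⟨hm.aestronglyMeasurable, ?_⟩
  rw [eLpNorm_lt_top_iff_lintegral_rpow_enorm_lt_top hp0 hp,
    ← lintegral_chord hN hDo hDc hDb (hm.enorm.pow_const p.toReal)]
  refine lt_of_le_of_lt (lintegral_mono_ae ?_) (lintegral_pastEnergy_lt_top hN hDo hDc hDb hγ0 hγ1
    hq hf ((eLpNorm_lt_top_iff_lintegral_rpow_enorm_lt_top hp0 hp).1 hfp.2))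
  filter_upwards [ae_isEntrance hN hDo hDc hDb] with b hb
  have hκ : 0 < 1 + σ b.2 := by linarith [hσ0 b.2]
  refine le_trans ?_ (lintegral_enorm_expAverage_rpow_le hκ hq
    (measurable_unfold_right hDo hDb γ hf b) (tau D b))
  refine le_trans (le_of_eq ?_) (lintegral_mono_set (Ioo_subset_Iio_self (a := (0 : ℝ))))
  refine setLIntegral_congr_fun measurableSet_Ioo fun s hs => ?_
  simp only [hb.stationary_flow hs.1.le hs.2.le, flow_snd]
  rfl

/-- The resolvent of the semigroup is given by the stationary solution: the Laplace transform of the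
translation `evolve` is the exponential average of the unfolded function. -/
lemma resolvent_ae [Fact (1 ≤ p)] (hDo : IsOpen D) (hDb : Bornology.IsBounded D)
    (hσm : Measurable σ) {U : ℝ≥0 → X 𝕜 p D →L[𝕜] X 𝕜 p D} (hU : IsC0Semigroup U) {M : ℝ}
    (hM : ∀ t, ‖U t‖ ≤ M)
    (hUae : ∀ (t : ℝ≥0) (φ : Phase N → 𝕜) (hφ : MemLp φ p (phaseMeasure D)),
      U t (hφ.toLp φ) =ᵐ[phaseMeasure D] evolve D σ γ t φ) (f : X 𝕜 p D) :
    (resolvent U f : X 𝕜 p D) =ᵐ[phaseMeasure D] stationary D σ γ f := by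
  have hfm : Measurable f := (Lp.stronglyMeasurable f).measurable
  have hG : Measurable fun q : Phase N × ℝ => Real.exp (-q.2) • evolve D σ γ q.2 f q.1 :=
    (Real.measurable_exp.comp measurable_snd.neg).smul (measurable_evolve hDo hDb hσm γ hfm)
  have h1 := coeFn_integral_ae (p := p) (μ := phaseMeasure D) hG (hU.integrableOn hM f) (by
    filter_upwards [ae_restrict_mem measurableSet_Ioi] with t ht
    have h2 := hUae t.toNNReal f (Lp.memLp f)
    rw [Lp.toLp_coeFn, Real.coe_toNNReal _ (mem_Ioi.1 ht).le] at h2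
    filter_upwards [Lp.coeFn_smul (Real.exp (-t)) (U t.toNNReal f), h2] with z hz1 hz2
    rw [hz1, Pi.smul_apply, hz2])
  refine h1.trans (Eventually.of_forall fun z => ?_)
  simp only [stationary, chordSolution, expAverage, evolve, entry_snd]
  refine integral_congr_ae (Eventually.of_forall fun t => ?_)
  simp only [RCLike.real_smul_eq_coe_mul]
  rw [← mul_assoc, ← RCLike.ofReal_mul, ← Real.exp_add]
  congr 3
  ring

end Stationary

/-! ### The resolvent and the domain of the streaming operator -/

section StationaryGraph

variable {N : ℕ} {D : Set (EuclideanSpace ℝ (Fin N))} {𝕜 : Type*} [RCLike 𝕜] {p : ℝ≥0∞}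
  {σ : EuclideanSpace ℝ (Fin N) → ℝ} {γ : ℝ} {f : Phase N → 𝕜}

lemma integral_chord (hN : 1 ≤ N) (hDo : IsOpen D) (hDc : Convex ℝ D)
    (hDb : Bornology.IsBounded D) {F : Phase N → 𝕜} (hF : Integrable F (phaseMeasure D)) :
    ∫ z, F z ∂phaseMeasure D = ∫ b, (∫ s in Ioo 0 (tau D b), F (flow s b)) ∂chordMeasure D := by
  have hmap := map_chordProd hN hDo hDc hDb
  have hS := measurableSet_chord (N := N) hDo hDb
  have h1 : Integrable (fun q : Phase N × ℝ => F (flow q.2 q.1)) (chordProd D) := by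
    rw [← hmap] at hF
    exact hF.comp_measurable measurable_flow_swap
  have h2 : ∫ z, F z ∂phaseMeasure D = ∫ q, F (flow q.2 q.1) ∂chordProd D := by
    rw [← hmap]
    rw [← hmap] at hF
    exact integral_map measurable_flow_swap.aemeasurable hF.aestronglyMeasurable
  rw [h2, chordProd, ← integral_indicator hS, integral_prod _ ((integrable_indicator_iff hS).2 h1)]
  refine integral_congr_ae (Eventually.of_forall fun b => ?_)
  simp only
  rw [← integral_indicator measurableSet_Ioo]
  rfl

lemma IsEntrance.notMem {b : Phase N} (hb : IsEntrance D b) : b.1 ∉ D := by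
  have h := (hb.mem_iff 0).not.2 (by simp)
  simpa using h

lemma IsEntrance.flow_tau_notMem {b : Phase N} (hb : IsEntrance D b) :
    (BounceBack.flow (tau D b) b).1 ∉ D := by
  have h := (hb.mem_iff (tau D b)).not.2 (by simp)
  simpa using h

lemma hasDerivAt_comp_flow {φ : Phase N → ℝ} (hφ : ContDiff ℝ ∞ φ) (b : Phase N) (s : ℝ) :
    HasDerivAt (fun s => φ (flow s b)) (fderiv ℝ φ (flow s b) (b.2, 0)) s := by
  have h1 : HasDerivAt (fun s : ℝ => flow s b) (b.2, 0) s := by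
    have h2 : HasDerivAt (fun s : ℝ => b.1 + s • b.2) b.2 s := by
      simpa using ((hasDerivAt_id s).smul_const b.2).const_add b.1
    exact h2.prodMk (hasDerivAt_const s b.2)
  have h3 := (hφ.differentiable (by simp) (flow s b)).hasFDerivAt
  exact h3.comp_hasDerivAt s h1

lemma continuous_transport {φ : Phase N → ℝ} (hφ : ContDiff ℝ ∞ φ) :
    Continuous fun z : Phase N => fderiv ℝ φ z (z.2, 0) := by
  have h1 : Continuous (fderiv ℝ φ) := hφ.continuous_fderiv (by simp)
  exact h1.clm_apply (by fun_prop)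

lemma hasCompactSupport_transport {φ : Phase N → ℝ} (hφ : HasCompactSupport φ) :
    HasCompactSupport fun z : Phase N => fderiv ℝ φ z (z.2, 0) := by
  refine (hφ.fderiv ℝ).mono fun z hz hz' => hz ?_
  simp only [hz', _root_.zero_apply]

instance : IsLocallyFiniteMeasure (phaseMeasure D) := by unfold phaseMeasure; infer_instance

/-- The weak equation, chord by chord: a test function vanishes at both ends of each chord. -/
lemma hasWeakTransport_stationary (hN : 1 ≤ N) (hDo : IsOpen D) (hDc : Convex ℝ D)
    (hDb : Bornology.IsBounded D) (hp1 : 1 ≤ p) (hp : p ≠ ⊤) (hσm : Measurable σ)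
    (hσ0 : ∀ v, 0 ≤ σ v) (hγ0 : 0 < γ) (hγ1 : γ < 1) (hf : Measurable f)
    (hfp : MemLp f p (phaseMeasure D)) :
    HasWeakTransport D (stationary D σ γ f)
      (fun z => f z - ((1 + σ z.2 : ℝ) : 𝕜) * stationary D σ γ f z) := by
  have hp0 : p ≠ 0 := (zero_lt_one.trans_le hp1).ne'
  have hq : 1 ≤ p.toReal := by simpa using ENNReal.toReal_mono hp hp1
  have hκS := memLp_mul_stationary hN hDo hDc hDb hp1 hp hσm hσ0 hγ0 hγ1 hf hfp
  have hS : MemLp (stationary D σ γ f) p (phaseMeasure D) := by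
    refine hκS.mono (measurable_stationary hDo hDb hσm γ hf).aestronglyMeasurable
      (Eventually.of_forall fun z => ?_)
    rw [norm_mul, RCLike.norm_ofReal]
    refine le_mul_of_one_le_left (norm_nonneg _) ?_
    have := hσ0 z.2
    rw [abs_of_nonneg (by linarith)]
    linarith
  intro φ hφ hφc hφD
  have hi1 := (hS.locallyIntegrable hp1).integrable_smul_left_of_hasCompactSupport
    (continuous_transport hφ) (hasCompactSupport_transport hφc)
  have hi2 := ((hfp.sub hκS).locallyIntegrable hp1).integrable_smul_left_of_hasCompactSupport
    hφ.continuous hφc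
  rw [← sub_eq_zero, sub_neg_eq_add]
  refine (integral_add hi1 hi2).symm.trans ?_
  refine (integral_chord hN hDo hDc hDb (hi1.add hi2)).trans ?_
  refine integral_eq_zero_of_ae ?_
  filter_upwards [ae_isEntrance hN hDo hDc hDb, ae_pastEnergy_ne_top hN hDo hDc hDb hγ0 hγ1 hq hf
    ((eLpNorm_lt_top_iff_lintegral_rpow_enorm_lt_top hp0 hp).1 hfp.2)] with b hb hE
  have hzero : ∀ z : Phase N, z.1 ∉ D → φ z = 0 := fun z hz =>
    image_eq_zero_of_notMem_tsupport fun h => hz (hφD h).1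
  have hc : Continuous fun s : ℝ => fderiv ℝ φ (flow s b) (b.2, 0) := by
    have h1 : Continuous fun s : ℝ => flow s b := by unfold flow; fun_prop
    exact (continuous_transport hφ).comp h1
  have h1 := integral_deriv_smul_expAverage (κ := 1 + σ b.2) (by linarith [hσ0 b.2]) hq
    (measurable_unfold_right hDo hDb γ hf b) hb.tau_pos hE
    (η := fun s => φ (flow s b)) (hasDerivAt_comp_flow hφ b) hc
    (by simpa using hzero b hb.notMem) (hzero _ hb.flow_tau_notMem)
  refine Eq.trans (setIntegral_congr_fun measurableSet_Ioo fun s hs => ?_) h1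
  simp only [Pi.add_apply, Pi.sub_apply, hb.stationary_flow hs.1.le hs.2.le, flow_snd,
    hb.unfold_chord γ f hs.1.le hs.2]
  rfl

lemma HasWeakTransport.congr {ψ ψ' g g' : Phase N → 𝕜} (h : HasWeakTransport D ψ g)
    (hψ : ψ' =ᵐ[phaseMeasure D] ψ) (hg : g' =ᵐ[phaseMeasure D] g) : HasWeakTransport D ψ' g' := by
  intro φ hφ hφc hφD
  have h1 := h φ hφ hφc hφD
  have e1 : ∫ z, fderiv ℝ φ z (z.2, 0) • ψ' z ∂phaseMeasure D
      = ∫ z, fderiv ℝ φ z (z.2, 0) • ψ z ∂phaseMeasure D :=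
    integral_congr_ae (hψ.mono fun z hz => by simp only [hz])
  have e2 : ∫ z, φ z • g' z ∂phaseMeasure D = ∫ z, φ z • g z ∂phaseMeasure D :=
    integral_congr_ae (hg.mono fun z hz => by simp only [hz])
  rw [e1, e2, h1]

/-- The bounce-back condition, which is built into the unfolding. -/
lemma chordSolution_zero {b : Phase N} (hb : IsEntrance D b) (hσe : ∀ v, σ (-v) = σ v)
    (f : Phase N → 𝕜) :
    chordSolution D σ γ f b 0 = (γ : 𝕜) * chordSolution D σ γ f (turn D b) (tau D b) := by
  rw [chordSolution, chordSolution, expAverage, expAverage, ← integral_const_mul, turn_snd, hσe]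
  refine setIntegral_congr_fun measurableSet_Ioi fun t ht => ?_
  rw [hb.unfold_turn γ f (y := 0 - t) (by have := mem_Ioi.1 ht; linarith), mul_smul_comm]
  congr 3
  ring

/-- The chord solutions are continuous up to both ends of the chord. -/
lemma continuousOn_chordSolution (hDo : IsOpen D) (hDb : Bornology.IsBounded D)
    (hσ0 : ∀ v, 0 ≤ σ v) (hf : Measurable f) {q : ℝ} (hq : 1 ≤ q) {b : Phase N}
    (hE : pastEnergy D γ q f b ≠ ⊤) :
    ContinuousOn (chordSolution D σ γ f b) (Iic (tau D b)) :=
  continuousOn_expAverage (by linarith [hσ0 b.2]) hq (measurable_unfold_right hDo hDb γ hf b) hE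

lemma tendsto_stationary_entrance (hDo : IsOpen D) (hDb : Bornology.IsBounded D)
    (hσ0 : ∀ v, 0 ≤ σ v) (hf : Measurable f) {q : ℝ} (hq : 1 ≤ q) {b : Phase N}
    (hb : IsEntrance D b) (hE : pastEnergy D γ q f b ≠ ⊤) :
    Tendsto (fun s : ℝ => stationary D σ γ f (flow s b)) (𝓝[>] 0)
      (𝓝 (chordSolution D σ γ f b 0)) := by
  have h1 := (continuousOn_chordSolution (γ := γ) hDo hDb hσ0 hf hq hE) 0 hb.tau_pos.le
  have h2 : Ioo 0 (tau D b) ∈ 𝓝[>] (0 : ℝ) := Ioo_mem_nhdsGT hb.tau_pos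
  have h3 : 𝓝[>] (0 : ℝ) ≤ 𝓝[Iic (tau D b)] 0 := by
    refine le_inf inf_le_left (le_principal_iff.2 (mem_of_superset h2 ?_))
    exact fun s hs => hs.2.le
  refine (h1.tendsto.mono_left h3).congr' ?_
  filter_upwards [h2] with s hs
  exact (hb.stationary_flow hs.1.le hs.2.le).symm

lemma tendsto_stationary_exit (hDo : IsOpen D) (hDb : Bornology.IsBounded D)
    (hσ0 : ∀ v, 0 ≤ σ v) (hf : Measurable f) {q : ℝ} (hq : 1 ≤ q) {b : Phase N}
    (hb : IsEntrance D b) (hE : pastEnergy D γ q f b ≠ ⊤) :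
    Tendsto (fun s : ℝ => stationary D σ γ f (flow (tau D b - s) b)) (𝓝[>] 0)
      (𝓝 (chordSolution D σ γ f b (tau D b))) := by
  have h1 := (continuousOn_chordSolution (γ := γ) hDo hDb hσ0 hf hq hE) (tau D b) self_mem_Iic
  have h2 : Ioo 0 (tau D b) ∈ 𝓝[>] (0 : ℝ) := Ioo_mem_nhdsGT hb.tau_pos
  have h3 : Tendsto (fun s : ℝ => tau D b - s) (𝓝[>] 0) (𝓝[Iic (tau D b)] (tau D b)) := by
    refine tendsto_nhdsWithin_iff.2 ⟨?_, ?_⟩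
    · have h4 : Continuous fun s : ℝ => tau D b - s := by fun_prop
      simpa using (h4.tendsto 0).mono_left nhdsWithin_le_nhds
    · filter_upwards [h2] with s hs
      exact mem_Iic.2 (by linarith [hs.1])
  refine (h1.tendsto.comp h3).congr' ?_
  filter_upwards [h2] with s hs
  exact (hb.stationary_flow (by linarith [hs.2]) (by linarith [hs.1])).symm

lemma memLp_chordMeasure_of_le {h : Phase N → 𝕜} (hh : Measurable h) (hp1 : 1 ≤ p) (hp : p ≠ ⊤)
    {E : Phase N → ℝ≥0∞} (hE : ∫⁻ b, E b ∂chordMeasure D < ⊤)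
    (hle : ∀ᵐ b ∂chordMeasure D, ‖h b‖ₑ ^ p.toReal ≤ E b) : MemLp h p (chordMeasure D) :=
  ⟨hh.aestronglyMeasurable, (eLpNorm_lt_top_iff_lintegral_rpow_enorm_lt_top
    (zero_lt_one.trans_le hp1).ne' hp).2 ((lintegral_mono_ae hle).trans_lt hE)⟩

lemma flow_neg_rev {b : Phase N} (s : ℝ) : flow (-s) (rev b) = flow (tau D b - s) (turn D b) := by
  rw [flow_turn, flow_rev]
  congr 2
  ring

/-- The stationary solution belongs to the domain of the streaming operator. -/
theorem stationary_mem_streamingGraph [Fact (1 ≤ p)] (hN : 1 ≤ N) (hDo : IsOpen D)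
    (hDc : Convex ℝ D) (hDb : Bornology.IsBounded D) (hDs : HasSmoothBoundary D) (hp : p ≠ ⊤)
    (hσm : Measurable σ) (hσ0 : ∀ v, 0 ≤ σ v) (hσe : ∀ v, σ (-v) = σ v) (hγ0 : 0 < γ)
    (hγ1 : γ < 1) (f ψ : X 𝕜 p D) (hψ : ψ =ᵐ[phaseMeasure D] stationary D σ γ f) :
    (ψ, ψ - f) ∈ streamingGraph 𝕜 p D (fun z => σ z.2) γ := by
  have hp1 : 1 ≤ p := Fact.out
  have hp0 : p ≠ 0 := (zero_lt_one.trans_le hp1).ne'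
  have hq : 1 ≤ p.toReal := by simpa using ENNReal.toReal_mono hp hp1
  have hfm : Measurable f := (Lp.stronglyMeasurable f).measurable
  have hfp := Lp.memLp f
  have hfq := (eLpNorm_lt_top_iff_lintegral_rpow_enorm_lt_top hp0 hp).1 hfp.2
  have hκS := memLp_mul_stationary hN hDo hDc hDb hp1 hp hσm hσ0 hγ0 hγ1 hfm hfp
  have hET := lintegral_pastEnergy_lt_top hN hDo hDc hDb hγ0 hγ1 hq hfm hfq
  have hEm := measurable_pastEnergy hDo hDb γ p.toReal hfm
  have hgood : ∀ᵐ b ∂chordMeasure D, IsEntrance D b ∧ pastEnergy D γ p.toReal f b ≠ ⊤ :=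
    (ae_isEntrance hN hDo hDc hDb).and
      (ae_pastEnergy_ne_top hN hDo hDc hDb hγ0 hγ1 hq hfm hfq)
  have hgood' := (measurePreserving_turn hN hDo hDc hDb).quasiMeasurePreserving.ae hgood
  have hle := incomingMeasure_le hN hDo hDc hDb hDs
  have hac : incomingMeasure D ≪ chordMeasure D :=
    (Measure.absolutelyContinuous_of_le hle).trans (Measure.smul_absolutelyContinuous)
  have hrev := measurePreserving_rev_incoming hDo hDb hDs
  have hcm := measurable_chordSolution hDo hDb hσm γ hfm
  have hbound : ∀ (b : Phase N) (s : ℝ), s ≤ tau D b →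
      ‖chordSolution D σ γ f b s‖ₑ ^ p.toReal ≤ pastEnergy D γ p.toReal f b := fun b s hs =>
    enorm_expAverage_rpow_le_lintegral (by linarith [hσ0 b.2]) hq
      (measurable_unfold_right hDo hDb γ hfm b) hs
  -- the traces, the outgoing one as a function of the reversed phase point
  set hIn : Phase N → 𝕜 := fun b => chordSolution D σ γ f b 0 with hIn_def
  set K : Phase N → 𝕜 := fun b => chordSolution D σ γ f (turn D b) (tau D b) with hK_def
  have hIm : Measurable hIn := by
    have h := hcm.comp (measurable_prodMk_right (y := (0 : ℝ)))
    simp only [Function.comp_def] at h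
    exact h
  have hKm : Measurable K := by
    have h := hcm.comp ((measurable_turn hDo hDb).prodMk (measurable_tau hDo hDb))
    simp only [Function.comp_def] at h
    exact h
  refine ⟨⟨(hfp.sub hκS).toLp _, ?_, ?_⟩, hIn, fun z => K (rev z), ?_, ?_, ?_, ?_, ?_⟩
  · exact (hasWeakTransport_stationary hN hDo hDc hDb hp1 hp hσm hσ0 hγ0 hγ1 hfm hfp).congr hψ
      (hfp.sub hκS).coeFn_toLp
  · filter_upwards [(hfp.sub hκS).coeFn_toLp, Lp.coeFn_sub ψ f, hψ] with z hz1 hz2 hz3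
    simp only [hz1, hz2, hz3, Pi.sub_apply]
    push_cast
    ring
  · refine MemLp.of_measure_le_smul fluxConst_ne_top hle
      (memLp_chordMeasure_of_le hIm hp1 hp hET ?_)
    filter_upwards [hgood] with b hb
    exact hbound b 0 hb.1.tau_pos.le
  · have hK : MemLp K p (chordMeasure D) := by
      refine memLp_chordMeasure_of_le hKm hp1 hp (E := fun b => pastEnergy D γ p.toReal f (turn D b))
        ?_ ?_
      · rwa [(measurePreserving_turn hN hDo hDc hDb).lintegral_comp hEm]
      · filter_upwards [hgood] with b hb
        exact hbound _ _ hb.1.tau_turn.ge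
    have hK' : MemLp K p (incomingMeasure D) := hK.of_measure_le_smul fluxConst_ne_top hle
    rw [← hrev.map_eq]
    refine (memLp_map_measure_iff (hKm.comp measurable_rev).aestronglyMeasurable
      measurable_rev.aemeasurable).2 ?_
    simpa [Function.comp_def] using hK'
  · refine ⟨stationary D σ γ f, hψ.symm, ?_⟩
    filter_upwards [hac.ae_le hgood] with b hb
    exact tendsto_stationary_entrance hDo hDb hσ0 hfm hq hb.1 hb.2
  · refine ⟨stationary D σ γ f, hψ.symm, ?_⟩
    rw [← hrev.map_eq, measurableEmbedding_rev.ae_map_iff]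
    filter_upwards [hac.ae_le hgood, hac.ae_le hgood'] with b hb hb'
    have h1 := tendsto_stationary_exit (γ := γ) hDo hDb hσ0 hfm hq hb'.1 hb'.2
    rw [hb.1.tau_turn] at h1
    rw [rev_rev]
    refine h1.congr fun s => ?_
    rw [← flow_neg_rev]
    congr 1
    ext1
    · simp [sub_eq_add_neg]
    · rfl
  · filter_upwards [hac.ae_le hgood] with b hb
    have h1 : rev ((b.1, -b.2) : Phase N) = b := by simp [rev]
    simp only [h1]
    exact chordSolution_zero hb.1 hσe f

end StationaryGraph

/-! ### Weak transport and characteristics -/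

section WeakTransport

variable {N : ℕ} {D : Set (EuclideanSpace ℝ (Fin N))} {𝕜 : Type*} [RCLike 𝕜] {p : ℝ≥0∞}

/-- Free transport for a time proportional to an additional variable preserves the product measure. -/
lemma measurePreserving_shear (ρ : Measure ℝ) [SFinite ρ] (a : ℝ) :
    MeasurePreserving (fun w : ℝ × Phase N => (w.1, flow (a * w.1) w.2)) (ρ.prod volume)
      (ρ.prod volume) := by
  refine (MeasurePreserving.id ρ).skew_product (g := fun s z => flow (a * s) z) ?_ ?_
  · exact measurable_flow.comp ((measurable_fst.const_mul a).prodMk measurable_snd)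
  · exact Eventually.of_forall fun s => (measurePreserving_flow (a * s)).map_eq

/-- The free flow as a homeomorphism of the phase space. -/
def flowHomeo (a : ℝ) : Phase N ≃ₜ Phase N where
  toFun := flow a
  invFun := flow (-a)
  left_inv z := by simp [flow_flow]
  right_inv z := by simp [flow_flow]
  continuous_toFun := continuous_flow a
  continuous_invFun := continuous_flow (-a)

lemma integral_eq_of_flow (a : ℝ) {F G : Phase N → 𝕜} (h : ∀ z, F z = G (flow a z)) :
    ∫ z, F z = ∫ z, G z := by
  rw [← (measurePreserving_flow (N := N) a).integral_comp
    ((flowHomeo a).measurableEmbedding) G]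
  exact integral_congr_ae (Eventually.of_forall h)

lemma continuous_flow_prod : Continuous fun w : ℝ × Phase N => flow w.1 w.2 := by
  unfold flow
  fun_prop

/-- A locally integrable function is integrable along the flow of a compact set. -/
lemma exists_integrable_flow {G : Phase N → 𝕜} (hG : LocallyIntegrable G volume) (r : ℝ)
    {C : Set (Phase N)} (hC : IsCompact C) :
    ∃ F : ℝ × Phase N → 𝕜, Integrable F ((volume.restrict (Ioc 0 r)).prod volume) ∧
      ∀ s ∈ Ioc 0 r, ∀ z ∈ C, F (s, z) = G (flow s z) := by
  set C' : Set (Phase N) := (fun w : ℝ × Phase N => flow w.1 w.2) '' (Icc 0 r ×ˢ C) with hC'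
  have hC'c : IsCompact C' := (isCompact_Icc.prod hC).image continuous_flow_prod
  have h1 : Integrable (C'.indicator G) volume :=
    (integrable_indicator_iff hC'c.measurableSet).2 (hG.integrableOn_isCompact hC'c)
  have h2 : Integrable (fun w : ℝ × Phase N => C'.indicator G w.2)
      ((volume.restrict (Ioc 0 r)).prod volume) := h1.comp_snd _
  have h3 := (measurePreserving_shear (N := N) (volume.restrict (Ioc 0 r)) 1).integrable_comp_of_integrable
    h2
  refine ⟨_, h3, fun s hs z hz => ?_⟩
  simp only [Function.comp_apply, one_mul]
  exact indicator_of_mem (show flow s z ∈ C' from ⟨(s, z), ⟨Ioc_subset_Icc_self hs, hz⟩, rfl⟩) _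

lemma integrable_smul_flow {G : Phase N → 𝕜} (hG : LocallyIntegrable G volume) (r : ℝ)
    {c : Phase N → ℝ} (hc : Continuous c) (hcc : HasCompactSupport c) :
    Integrable (fun w : ℝ × Phase N => c w.2 • G (flow w.1 w.2))
      ((volume.restrict (Ioc 0 r)).prod volume) := by
  obtain ⟨F, hF, hFG⟩ := exists_integrable_flow hG r hcc.isCompact
  obtain ⟨K, hK⟩ := hc.bounded_above_of_compact_support hcc
  have h1 : Integrable (fun w : ℝ × Phase N => c w.2 • F w)
      ((volume.restrict (Ioc 0 r)).prod volume) := by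
    refine hF.bdd_smul K (hc.comp continuous_snd).aestronglyMeasurable
      (Eventually.of_forall fun w => hK w.2)
  refine h1.congr ?_
  have h2 : ∀ᵐ w ∂(volume.restrict (Ioc 0 r)).prod (volume : Measure (Phase N)), w.1 ∈ Ioc 0 r :=
    Measure.quasiMeasurePreserving_fst.ae (ae_restrict_mem measurableSet_Ioc)
  filter_upwards [h2] with w hw
  by_cases hz : w.2 ∈ tsupport c
  · rw [← hFG w.1 hw w.2 hz]
  · rw [image_eq_zero_of_notMem_tsupport hz, zero_smul, zero_smul]

lemma locallyIntegrable_integral_flow {G : Phase N → 𝕜} (hG : LocallyIntegrable G volume) (r : ℝ) :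
    LocallyIntegrable (fun z => ∫ s in Ioc 0 r, G (flow s z)) volume := by
  rw [locallyIntegrable_iff]
  intro C hC
  obtain ⟨F, hF, hFG⟩ := exists_integrable_flow hG r hC
  refine (hF.integral_prod_right.integrableOn (s := C)).congr_fun (fun z hz => ?_) hC.measurableSet
  exact setIntegral_congr_fun measurableSet_Ioc fun s hs => hFG s hs z hz

lemma fderiv_comp_flow {φ : Phase N → ℝ} (hφ : ContDiff ℝ ∞ φ) (a : ℝ) (z : Phase N) :
    fderiv ℝ (fun z => φ (flow a z)) z (z.2, 0) = fderiv ℝ φ (flow a z) (z.2, 0) := by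
  have hflow : ContDiff ℝ ∞ (flow a : Phase N → Phase N) := by unfold flow; fun_prop
  have h1 := hasDerivAt_comp_flow (hφ.comp hflow) z 0
  have h2 := hasDerivAt_comp_flow hφ (flow a z) 0
  rw [flow_zero] at h1 h2
  refine h1.unique ?_
  have h3 : (fun s => (φ ∘ flow a) (flow s z)) = fun s => φ (flow s (flow a z)) := by
    ext s
    rw [Function.comp_apply, flow_flow, flow_flow, add_comm]
  rwa [h3]

/-- A weak solution of the transport equation satisfies the integrated equation along almost every
characteristic. -/
theorem HasWeakTransport.along_flow (hDo : IsOpen D) (hDc : Convex ℝ D) {ψ g : Phase N → 𝕜}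
    (hψ : LocallyIntegrable ((D ×ˢ univ).indicator ψ) volume)
    (hg : LocallyIntegrable ((D ×ˢ univ).indicator g) volume) (h : HasWeakTransport D ψ g) {r : ℝ}
    (hr : 0 < r) : ∀ᵐ z : Phase N, z.1 ∈ D → (flow r z).1 ∈ D →
      (D ×ˢ univ).indicator ψ (flow r z) - (D ×ˢ univ).indicator ψ z
        = ∫ s in Ioc 0 r, (D ×ˢ univ).indicator g (flow s z) := by
  set S : Set (Phase N) := D ×ˢ univ with hS_def
  have hS : MeasurableSet S := hDo.measurableSet.prod MeasurableSet.univ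
  set ψ₀ := S.indicator ψ
  set g₀ := S.indicator g
  have hweak : ∀ φ : Phase N → ℝ, ContDiff ℝ ∞ φ → HasCompactSupport φ → tsupport φ ⊆ S →
      ∫ z, fderiv ℝ φ z (z.2, 0) • ψ₀ z = - ∫ z, φ z • g₀ z := by
    intro φ h1 h2 h3
    have h4 := h φ h1 h2 h3
    rw [phaseMeasure, ← integral_indicator hS, ← integral_indicator hS] at h4
    have h5 : ∀ (c : Phase N → ℝ) (u : Phase N → 𝕜),
        (fun z => c z • S.indicator u z) = S.indicator fun z => c z • u z := fun c u => by
      ext z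
      by_cases hz : z ∈ S
      · rw [indicator_of_mem hz, indicator_of_mem hz]
      · rw [indicator_of_notMem hz, indicator_of_notMem hz, smul_zero]
    rwa [← h5, ← h5] at h4
  -- it is enough to test the integrated equation with functions `φ` supported in `K`; by
  -- convexity, their translates by the flow for the times `s ≤ r` are supported in `S`
  set K : Set (Phase N) := {z | z.1 ∈ D ∧ (flow r z).1 ∈ D} with hK_def
  have hK : IsOpen K := (hDo.preimage continuous_fst).inter
    (hDo.preimage (continuous_fst.comp (continuous_flow r)))
  have hψr : LocallyIntegrable (fun z => ψ₀ (flow r z)) volume := by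
    rw [locallyIntegrable_iff]
    intro C hC
    have h1 : IntegrableOn ψ₀ (flow r '' C) :=
      hψ.integrableOn_isCompact (hC.image (continuous_flow r))
    have h2 := (integrable_indicator_iff (hC.image (continuous_flow r)).measurableSet).2 h1
    have h3 := (measurePreserving_flow (N := N) r).integrable_comp_of_integrable h2
    refine (h3.integrableOn (s := C)).congr_fun (fun z hz => ?_) hC.measurableSet
    exact indicator_of_mem (mem_image_of_mem _ hz) _
  have hJ := locallyIntegrable_integral_flow hg r
  have hloc := (hψr.sub hψ).sub hJ
  have key := hK.ae_eq_zero_of_integral_contDiff_smul_eq_zero (μ := volume)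
    (hloc.locallyIntegrableOn K) ?_
  · filter_upwards [key] with z hz h1 h2
    exact sub_eq_zero.1 (hz ⟨h1, h2⟩)
  intro φ hφ hφc hφK
  have hφ' := continuous_transport hφ
  have hφc' := hasCompactSupport_transport hφc
  -- the weak equation for the transported test functions
  have hs : ∀ s ∈ Ioc 0 r, ∫ z, fderiv ℝ φ z (z.2, 0) • ψ₀ (flow s z)
      = - ∫ z, φ z • g₀ (flow s z) := by
    intro s hs
    have hflow : ContDiff ℝ ∞ (flow (-s) : Phase N → Phase N) := by unfold flow; fun_prop
    have hinv : ∀ z : Phase N, flow (-s) (flow s z) = z := fun z => by simp [flow_flow]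
    have h1 : HasCompactSupport (fun z => φ (flow (-s) z)) := hφc.comp_homeomorph (flowHomeo (-s))
    have h2 : tsupport (fun z => φ (flow (-s) z)) ⊆ S := by
      intro w hw
      have h3 : flow (-s) w ∈ tsupport φ :=
        tsupport_comp_subset_preimage φ (continuous_flow (-s)) hw
      have h4 := hφK h3
      have h5 : (flow (-s) w).1 + (s / r) • ((flow r (flow (-s) w)).1 - (flow (-s) w).1) ∈ D :=
        hDc.add_smul_sub_mem h4.1 h4.2 ⟨by have := hs.1; positivity, (div_le_one hr).2 hs.2⟩
      refine ⟨?_, mem_univ _⟩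
      have h6 : (flow (-s) w).1 + (s / r) • ((flow r (flow (-s) w)).1 - (flow (-s) w).1) = w.1 := by
        simp only [flow_fst, flow_snd, add_sub_cancel_left, smul_smul, div_mul_cancel₀ _ hr.ne']
        simp
      rwa [h6] at h5
    have h3 := hweak _ (hφ.comp hflow) h1 h2
    have h4 : ∫ z, fderiv ℝ φ z (z.2, 0) • ψ₀ (flow s z)
        = ∫ w, fderiv ℝ (φ ∘ flow (-s)) w (w.2, 0) • ψ₀ w := by
      refine integral_eq_of_flow s fun z => ?_
      have h5 := fderiv_comp_flow hφ (-s) (flow s z)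
      rw [hinv, flow_snd] at h5
      rw [flow_snd]
      exact congrArg (· • ψ₀ (flow s z)) h5.symm
    have h5 : ∫ z, φ z • g₀ (flow s z) = ∫ w, (φ ∘ flow (-s)) w • g₀ w :=
      integral_eq_of_flow s fun z => by rw [Function.comp_apply, hinv]
    rw [h4, h5]
    exact h3
  -- integration over `0 < s ≤ r`: the derivatives of the translates of `φ` add up to an increment
  have hJφ : ∫ z, φ z • (∫ s in Ioc 0 r, g₀ (flow s z))
      = ∫ s in Ioc 0 r, ∫ z, φ z • g₀ (flow s z) := by
    rw [integral_integral_swap (f := fun s z => φ z • g₀ (flow s z))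
      (integrable_smul_flow hg r hφ.continuous hφc)]
    exact integral_congr_ae (Eventually.of_forall fun z => (integral_smul _ _).symm)
  have hψφ : ∫ s in Ioc 0 r, ∫ z, fderiv ℝ φ z (z.2, 0) • ψ₀ (flow s z)
      = ∫ w, (φ w - φ (flow (-r) w)) • ψ₀ w := by
    have h1 := integrable_smul_flow hψ r hφ' hφc'
    have h2 := (measurePreserving_shear (N := N) (volume.restrict (Ioc 0 r))
      (-1)).integrable_comp_of_integrable h1
    have h3 : ∀ s, ∫ z, fderiv ℝ φ z (z.2, 0) • ψ₀ (flow s z)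
        = ∫ w : Phase N, fderiv ℝ φ (flow (-s) w) (w.2, 0) • ψ₀ w := by
      intro s
      refine integral_eq_of_flow s fun z => ?_
      rw [flow_flow, neg_add_cancel, flow_zero, flow_snd]
    simp_rw [h3]
    rw [integral_integral_swap (f := fun s (w : Phase N) =>
      fderiv ℝ φ (flow (-s) w) (w.2, 0) • ψ₀ w)]
    · refine integral_congr_ae (Eventually.of_forall fun w => ?_)
      simp only
      rw [integral_smul_const]
      congr 1
      have h4 : ∀ s, HasDerivAt (fun s => - φ (flow (-s) w))
          (fderiv ℝ φ (flow (-s) w) (w.2, 0)) s := by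
        intro s
        have h5 := ((hasDerivAt_comp_flow hφ w (-s)).scomp s (hasDerivAt_neg s)).neg
        simpa [Function.comp_def, Pi.neg_def] using h5
      rw [← intervalIntegral.integral_of_le hr.le,
        intervalIntegral.integral_eq_sub_of_hasDerivAt (fun s _ => h4 s)]
      · simp; ring
      · refine Continuous.intervalIntegrable ?_ _ _
        have h6 : Continuous fun s : ℝ => flow (-s) w := by unfold flow; fun_prop
        exact hφ'.comp h6
    · refine h2.congr (Eventually.of_forall fun q => ?_)
      simp only [Function.comp_apply, Function.uncurry, neg_mul, one_mul, flow_flow, flow_snd]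
      simp
  have hfin : ∫ z, φ z • ψ₀ (flow r z) = ∫ w, φ (flow (-r) w) • ψ₀ w :=
    integral_eq_of_flow r fun z => by rw [flow_flow, neg_add_cancel, flow_zero]
  have i1 := hψr.integrable_smul_left_of_hasCompactSupport hφ.continuous hφc
  have i2 := hψ.integrable_smul_left_of_hasCompactSupport hφ.continuous hφc
  have i3 := hJ.integrable_smul_left_of_hasCompactSupport hφ.continuous hφc
  have i4 : Integrable (fun w => φ (flow (-r) w) • ψ₀ w) volume := by
    have h1 := (measurePreserving_flow (N := N) (-r)).integrable_comp_of_integrable i1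
    refine h1.congr (Eventually.of_forall fun z => ?_)
    simp [flow_flow]
  have e1 : ∫ s in Ioc 0 r, ∫ z, φ z • g₀ (flow s z)
      = - ∫ s in Ioc 0 r, ∫ z, fderiv ℝ φ z (z.2, 0) • ψ₀ (flow s z) := by
    rw [← integral_neg]
    exact setIntegral_congr_fun measurableSet_Ioc fun s hs' => by simp only [hs s hs', neg_neg]
  have e2 : ∫ w, (φ w - φ (flow (-r) w)) • ψ₀ w
      = (∫ w, φ w • ψ₀ w) - ∫ w, φ (flow (-r) w) • ψ₀ w := by
    refine Eq.trans ?_ (integral_sub i2 i4)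
    exact integral_congr_ae (Eventually.of_forall fun w => by simp only [sub_smul])
  calc ∫ z, φ z • ((fun z => ψ₀ (flow r z)) - ψ₀ - fun z => ∫ s in Ioc 0 r, g₀ (flow s z)) z
      = ∫ z, (φ z • ψ₀ (flow r z) - φ z • ψ₀ z - φ z • ∫ s in Ioc 0 r, g₀ (flow s z)) :=
        integral_congr_ae (Eventually.of_forall fun z => by
          simp only [Pi.sub_apply, smul_sub])
    _ = 0 := by
        refine (integral_sub (i1.sub i2) i3).trans ?_
        have e3 : ∫ z, ((fun z => φ z • ψ₀ (flow r z)) - fun z => φ z • ψ₀ z) z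
            = (∫ z, φ z • ψ₀ (flow r z)) - ∫ z, φ z • ψ₀ z := integral_sub i1 i2
        rw [e3, hJφ, e1, hψφ, e2, hfin]
        ring

end WeakTransport

/-! ### Exponential decay along the chords -/

section Chords

variable {N : ℕ} {D : Set (EuclideanSpace ℝ (Fin N))} {𝕜 : Type*} [RCLike 𝕜] {p : ℝ≥0∞}

/-- An integrable solution of the integral equation `k(r) = k₀ - κ ∫₀ʳ k` is exponential. -/
lemma ae_eq_exp_of_integral_eq {κ ℓ : ℝ} {k : ℝ → 𝕜} (hk : IntegrableOn k (Ioo 0 ℓ)) (k₀ : 𝕜)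
    (h : ∀ᵐ r, 0 < r → r < ℓ → k r - k₀ = -(κ : 𝕜) * ∫ u in Ioc 0 r, k u) :
    ∀ᵐ r, 0 < r → r < ℓ → k r = (Real.exp (-(κ * r)) : 𝕜) * k₀ := by
  set k' : ℝ → 𝕜 := (Ioo 0 ℓ).indicator k with hk'_def
  have hk' : Integrable k' volume := (integrable_indicator_iff measurableSet_Ioo).2 hk
  -- the continuous version `H` of the solution, and its `C¹` version `E`
  set H : ℝ → 𝕜 := fun r => k₀ - (κ : 𝕜) * ∫ u in (0 : ℝ)..r, k' u with hH_def
  have hH : Continuous H :=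
    continuous_const.sub (continuous_const.mul
      (intervalIntegral.continuous_primitive (fun a b => hk'.intervalIntegrable) 0))
  have hkH : ∀ᵐ r, 0 < r → r < ℓ → k r = H r := by
    filter_upwards [h] with r hr h0 h1
    have h2 : ∫ u in (0 : ℝ)..r, k' u = ∫ u in Ioc 0 r, k u := by
      rw [intervalIntegral.integral_of_le h0.le]
      exact setIntegral_congr_fun measurableSet_Ioc fun u hu =>
        indicator_of_mem (show u ∈ Ioo 0 ℓ from ⟨hu.1, hu.2.trans_lt h1⟩) _
    simp only [hH_def]
    rw [h2]
    linear_combination hr h0 h1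
  set E : ℝ → 𝕜 := fun r => k₀ - (κ : 𝕜) * ∫ u in (0 : ℝ)..r, H u with hE_def
  have hE : ∀ r, HasDerivAt E (-(κ : 𝕜) * H r) r := by
    intro r
    have h1 := (intervalIntegral.integral_hasDerivAt_right (hH.intervalIntegrable 0 r)
      hH.stronglyMeasurable.stronglyMeasurableAtFilter hH.continuousAt)
    have h2 := (h1.const_mul (κ : 𝕜)).const_sub k₀
    simpa using h2
  have hEH : ∀ r, 0 ≤ r → r < ℓ → E r = H r := by
    intro r h0 h1
    simp only [hE_def, hH_def]
    congr 2
    refine intervalIntegral.integral_congr_ae ?_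
    filter_upwards [hkH] with u hu hu'
    rw [uIoc_of_le h0] at hu'
    rw [hk'_def, indicator_of_mem (show u ∈ Ioo 0 ℓ from ⟨hu'.1, hu'.2.trans_lt h1⟩)]
    exact (hu hu'.1 (hu'.2.trans_lt h1)).symm
  have hexp : ∀ r : ℝ, HasDerivAt (fun r : ℝ => Real.exp (κ * r)) (κ * Real.exp (κ * r)) r := by
    intro r
    have := ((hasDerivAt_id r).const_mul κ).exp
    simpa [mul_comm] using this
  have hconst : ∀ r, 0 ≤ r → r < ℓ → Real.exp (κ * r) • E r = k₀ := by
    intro r h0 h1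
    have hd : ∀ y, HasDerivAt (fun r => Real.exp (κ * r) • E r)
        (Real.exp (κ * y) • (-(κ : 𝕜) * H y) + (κ * Real.exp (κ * y)) • E y) y := fun y =>
      (hexp y).smul (hE y)
    have h2 := constant_of_has_deriv_right_zero (f := fun r => Real.exp (κ * r) • E r)
      (a := 0) (b := r) (fun y _ => (hd y).continuousAt.continuousWithinAt) (fun y hy => by
        have h3 := (hd y).hasDerivWithinAt (s := Ici y)
        convert h3 using 1
        rw [hEH y hy.1 (hy.2.trans h1)]
        simp only [RCLike.real_smul_eq_coe_mul]
        push_cast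
        ring) r ⟨h0, le_rfl⟩
    rw [h2]
    simp [hE_def]
  filter_upwards [hkH] with r hr h0 h1
  rw [hr h0 h1, ← hEH r h0.le h1, ← hconst r h0.le h1, RCLike.real_smul_eq_coe_mul, ← mul_assoc,
    ← RCLike.ofReal_mul, ← Real.exp_add]
  simp

lemma exists_mem_Ioo_of_ae {P : ℝ → Prop} (h : ∀ᵐ s, P s) {a b : ℝ} (hab : a < b) :
    ∃ s ∈ Ioo a b, P s := by
  by_contra! hcon
  have h1 : volume (Ioo a b) = 0 := measure_mono_null (fun s hs => hcon s hs) (ae_iff.1 h)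
  rw [Real.volume_Ioo, ENNReal.ofReal_eq_zero] at h1
  linarith

/-- If the integral equation holds from almost every starting time `s` on, the solution is one
exponential function: starting times that tend to `0` give the same constant. -/
lemma exists_ae_eq_exp {κ τ : ℝ} (hτ : 0 < τ) {h : ℝ → 𝕜} (hh : IntegrableOn h (Ioo 0 τ))
    (H : ∀ᵐ s, s ∈ Ioo 0 τ → ∀ᵐ r, 0 < r → s + r < τ →
      h (s + r) - h s = -(κ : 𝕜) * ∫ u in Ioc 0 r, h (s + u)) :
    ∃ c : 𝕜, ∀ᵐ s, s ∈ Ioo 0 τ → h s = (Real.exp (-(κ * s)) : 𝕜) * c := by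
  have hexp : ∀ x y : ℝ, x + y = 0 → ((Real.exp x : ℝ) : 𝕜) * ((Real.exp y : ℝ) : 𝕜) = 1 := by
    intro x y hxy
    rw [← RCLike.ofReal_mul, ← Real.exp_add, hxy]
    simp
  have key : ∀ᵐ s, s ∈ Ioo 0 τ → ∀ᵐ y, s < y → y < τ →
      h y = (Real.exp (-(κ * y)) : 𝕜) * ((Real.exp (κ * s) : 𝕜) * h s) := by
    filter_upwards [H] with s hs hsτ
    have h1 : IntegrableOn (fun u => h (s + u)) (Ioo 0 (τ - s)) := by
      have h2 := (measurePreserving_add_left volume s).integrableOn_comp_preimage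
        (measurableEmbedding_addLeft s) (f := h) (s := Ioo s τ)
      have h3 : (fun u => s + u) ⁻¹' Ioo s τ = Ioo 0 (τ - s) := by
        ext u; simp only [mem_preimage, mem_Ioo]; constructor <;> rintro ⟨a, b⟩ <;>
          constructor <;> linarith
      rw [h3] at h2
      exact h2.2 (hh.mono_set (Ioo_subset_Ioo_left hsτ.1.le))
    have h2 := ae_eq_exp_of_integral_eq (κ := κ) h1 (h s) (by
      filter_upwards [hs hsτ] with r hr h0 hr1
      exact hr h0 (by linarith))
    have h3 := (measurePreserving_sub_right volume s).quasiMeasurePreserving.ae h2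
    filter_upwards [h3] with y hy h4 h5
    have h6 := hy (by linarith) (by linarith)
    rw [add_sub_cancel] at h6
    rw [h6, ← mul_assoc, ← RCLike.ofReal_mul, ← Real.exp_add]
    congr 3
    ring
  have hpos : ∀ n : ℕ, (0 : ℝ) < min τ (1 / (n + 1)) := fun n =>
    lt_min hτ (by positivity)
  choose s hs hsP using fun n => exists_mem_Ioo_of_ae key (hpos n)
  have hsτ : ∀ n, s n ∈ Ioo 0 τ := fun n => ⟨(hs n).1, (hs n).2.trans_le (min_le_left _ _)⟩
  -- the solutions that start at `s n` and at `s 0` have a common point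
  have hall : ∀ᵐ y, ∀ n, s n < y → y < τ →
      h y = (Real.exp (-(κ * y)) : 𝕜) * ((Real.exp (κ * s n) : 𝕜) * h (s n)) :=
    ae_all_iff.2 fun n => hsP n (hsτ n)
  have heq : ∀ n, (Real.exp (κ * s n) : 𝕜) * h (s n) = (Real.exp (κ * s 0) : 𝕜) * h (s 0) := by
    intro n
    obtain ⟨y, hy, hy'⟩ := exists_mem_Ioo_of_ae hall (max_lt (hsτ n).2 (hsτ 0).2)
    have h1 := hy' n ((le_max_left _ _).trans_lt hy.1) hy.2
    have h2 := hy' 0 ((le_max_right _ _).trans_lt hy.1) hy.2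
    have h3 : ((Real.exp (-(κ * y)) : ℝ) : 𝕜) ≠ 0 := by
      simp only [ne_eq, RCLike.ofReal_eq_zero]
      exact (Real.exp_pos _).ne'
    exact mul_left_cancel₀ h3 (h1.symm.trans h2)
  refine ⟨(Real.exp (κ * s 0) : 𝕜) * h (s 0), ?_⟩
  filter_upwards [hall] with y hy hyτ
  obtain ⟨n, hn⟩ := exists_nat_one_div_lt hyτ.1
  rw [hy n ((hs n).2.trans ((min_le_right _ _).trans_lt hn)) hyτ.2, heq n]

lemma frequently_of_ae {P : ℝ → Prop} {τ : ℝ} (hτ : 0 < τ) (h : ∀ᵐ s, s ∈ Ioo 0 τ → P s) :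
    ∃ᶠ s in 𝓝[>] (0 : ℝ), P s := by
  intro hcon
  obtain ⟨ε, hε, hsub⟩ := mem_nhdsGT_iff_exists_Ioo_subset.1 hcon
  obtain ⟨s, hs, hs'⟩ := exists_mem_Ioo_of_ae h (lt_min hτ (mem_Ioi.1 hε))
  exact hsub ⟨hs.1, hs.2.trans_le (min_le_right _ _)⟩
    (hs' ⟨hs.1, hs.2.trans_le (min_le_left _ _)⟩)

/-- A weak solution of `v · ∇ₓ ψ = - κ(v) ψ` is exponential along almost every chord. -/
lemma HasWeakTransport.exists_exp (hN : 1 ≤ N) (hDo : IsOpen D) (hDc : Convex ℝ D)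
    (hDb : Bornology.IsBounded D) (hp1 : 1 ≤ p) (hp : p ≠ ⊤) {ψ g : Phase N → 𝕜}
    (hψm : Measurable ψ) (hgm : Measurable g) (hψ : MemLp ψ p (phaseMeasure D))
    (hg : MemLp g p (phaseMeasure D)) (h : HasWeakTransport D ψ g)
    {κ : EuclideanSpace ℝ (Fin N) → ℝ}
    (hgψ : ∀ᵐ z ∂phaseMeasure D, g z = -(κ z.2 : 𝕜) * ψ z) :
    ∀ᵐ b ∂chordMeasure D, ∃ c : 𝕜, ∀ᵐ s, s ∈ Ioo 0 (tau D b) →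
      ψ (flow s b) = (Real.exp (-(κ b.2 * s)) : 𝕜) * c := by
  have hp0 : p ≠ 0 := (zero_lt_one.trans_le hp1).ne'
  set S : Set (Phase N) := D ×ˢ univ with hS_def
  have hS : MeasurableSet S := hDo.measurableSet.prod MeasurableSet.univ
  have hψ₀ : LocallyIntegrable (S.indicator ψ) volume :=
    ((memLp_indicator_iff_restrict hS).2 hψ).locallyIntegrable hp1
  have hg₀ : LocallyIntegrable (S.indicator g) volume :=
    ((memLp_indicator_iff_restrict hS).2 hg).locallyIntegrable hp1
  have hψ₀m : Measurable (S.indicator ψ) := hψm.indicator hS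
  have hg₀m : Measurable (S.indicator g) := hgm.indicator hS
  -- the integrated equation over time `r`, first for fixed `r` and almost every `z`, then by Fubini
  -- for almost every `z` and almost every `r`
  let P : Phase N → ℝ → Prop := fun z r => z.1 ∈ D → (flow r z).1 ∈ D →
      S.indicator ψ (flow r z) - S.indicator ψ z = ∫ s in Ioc 0 r, S.indicator g (flow s z)
  have hPm : MeasurableSet {w : Phase N × ℝ | P w.1 w.2} := by
    have hf : Measurable fun w : Phase N × ℝ => flow w.2 w.1 := measurable_flow_swap
    have h1 : MeasurableSet {w : Phase N × ℝ | w.1.1 ∈ D} :=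
      (measurable_fst.comp measurable_fst) hDo.measurableSet
    have h2 : MeasurableSet {w : Phase N × ℝ | (flow w.2 w.1).1 ∈ D} :=
      (measurable_fst.comp hf) hDo.measurableSet
    have h3 : Measurable fun w : Phase N × ℝ => ∫ s in Ioc 0 w.2, S.indicator g (flow s w.1) := by
      have h4 : MeasurableSet {x : (Phase N × ℝ) × ℝ | 0 < x.2 ∧ x.2 ≤ x.1.2} :=
        (measurableSet_lt measurable_const measurable_snd).inter
          (measurableSet_le measurable_snd (measurable_snd.comp measurable_fst))
      have h5 : Measurable fun x : (Phase N × ℝ) × ℝ => S.indicator g (flow x.2 x.1.1) :=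
        hg₀m.comp (measurable_flow.comp (measurable_snd.prodMk (measurable_fst.comp measurable_fst)))
      have h6 := ((h5.indicator h4).stronglyMeasurable.integral_prod_right'
        (ν := (volume : Measure ℝ))).measurable
      convert h6 using 2 with w
      rw [← integral_indicator measurableSet_Ioc]
      rfl
    have h4 : MeasurableSet {w : Phase N × ℝ | S.indicator ψ (flow w.2 w.1) - S.indicator ψ w.1
        = ∫ s in Ioc 0 w.2, S.indicator g (flow s w.1)} :=
      measurableSet_eq_fun ((hψ₀m.comp hf).sub (hψ₀m.comp measurable_fst)) h3
    have h5 : {w : Phase N × ℝ | P w.1 w.2} = {w : Phase N × ℝ | w.1.1 ∈ D}ᶜ ∪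
        ({w : Phase N × ℝ | (flow w.2 w.1).1 ∈ D}ᶜ ∪
        {w : Phase N × ℝ | S.indicator ψ (flow w.2 w.1) - S.indicator ψ w.1
        = ∫ s in Ioc 0 w.2, S.indicator g (flow s w.1)}) := by
      ext w
      simp only [P, mem_ofPred_eq, mem_union, mem_compl_iff]
      tauto
    rw [h5]
    exact h1.compl.union (h2.compl.union h4)
  have hae : ∀ᵐ z : Phase N, ∀ᵐ r ∂(volume.restrict (Ioi (0 : ℝ))), P z r := by
    rw [Measure.ae_ae_comm hPm]
    filter_upwards [ae_restrict_mem measurableSet_Ioi] with r hr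
    exact h.along_flow hDo hDc hψ₀ hg₀ hr
  have hchord := ae_chord_of_ae hN hDo hDc hDb (ae_restrict_of_ae (s := S) hae)
  have hgchord := ae_chord_of_ae hN hDo hDc hDb hgψ
  have hfin : ∀ᵐ b ∂chordMeasure D, IntegrableOn (fun s => ψ (flow s b)) (Ioo 0 (tau D b)) := by
    have hm : Measurable fun z => ‖ψ z‖ₑ ^ p.toReal := hψm.enorm.pow_const _
    have hm' : Measurable fun b => ∫⁻ s in Ioo 0 (tau D b), ‖ψ (flow s b)‖ₑ ^ p.toReal := by
      have h2 := ((hm.comp measurable_flow_swap).indicator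
        (measurableSet_chord hDo hDb)).lintegral_prod_right' (ν := volume)
      convert h2 using 2 with b
      rw [← lintegral_indicator measurableSet_Ioo]
      rfl
    have h1 := (eLpNorm_lt_top_iff_lintegral_rpow_enorm_lt_top hp0 hp).1 hψ.2
    rw [← lintegral_chord hN hDo hDc hDb hm] at h1
    filter_upwards [ae_lt_top hm' h1.ne] with b hb
    have hbm : Measurable fun s => ψ (flow s b) := by
      have h2 := hψm.comp (measurable_flow_swap.comp (measurable_prodMk_left (x := b)))
      simp only [Function.comp_def] at h2
      exact h2
    exact MemLp.integrable hp1 ⟨hbm.aestronglyMeasurable,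
      (eLpNorm_lt_top_iff_lintegral_rpow_enorm_lt_top hp0 hp).2 hb⟩
  filter_upwards [hchord, hgchord, hfin, ae_isEntrance hN hDo hDc hDb] with b hb1 hb2 hb3 hb
  refine exists_ae_eq_exp hb.tau_pos hb3 ?_
  filter_upwards [hb1] with s hs hsτ
  have h1 := hs hsτ
  rw [ae_restrict_iff' measurableSet_Ioi] at h1
  have h2 := (measurePreserving_add_left volume s).quasiMeasurePreserving.ae hb2
  have hmem : ∀ y, 0 < y → y < tau D b → flow y b ∈ S := fun y h0 h1 =>
    ⟨(hb.mem_iff y).2 ⟨h0, h1⟩, mem_univ _⟩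
  filter_upwards [h1] with r hr h0 h3
  have h4 := hr h0 (hmem s hsτ.1 hsτ.2).1 (by
    rw [flow_flow, add_comm]
    exact (hmem (s + r) (by linarith [hsτ.1]) h3).1)
  rw [flow_flow, add_comm r s, indicator_of_mem (hmem (s + r) (by linarith [hsτ.1]) h3),
    indicator_of_mem (hmem s hsτ.1 hsτ.2)] at h4
  rw [h4, ← integral_const_mul]
  refine setIntegral_congr_ae measurableSet_Ioc ?_
  filter_upwards [h2] with u hu hu'
  have h5 : 0 < s + u := by linarith [hsτ.1, hu'.1]
  have h6 : s + u < tau D b := by linarith [hu'.2]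
  rw [flow_flow, add_comm u s, indicator_of_mem (hmem _ h5 h6), hu ⟨h5, h6⟩, flow_snd]

end Chords

/-! ### Uniqueness for the stationary equation, and the generator -/

section Generator

variable {N : ℕ} {D : Set (EuclideanSpace ℝ (Fin N))} {𝕜 : Type*} [RCLike 𝕜] {p : ℝ≥0∞}
  {σ : EuclideanSpace ℝ (Fin N) → ℝ} {γ : ℝ}

lemma ae_sub_left {P : ℝ → Prop} {τ : ℝ} (h : ∀ᵐ s, s ∈ Ioo 0 τ → P s) :
    ∀ᵐ s, s ∈ Ioo 0 τ → P (τ - s) := by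
  have h1 := (Measure.measurePreserving_sub_left volume τ).quasiMeasurePreserving.ae h
  filter_upwards [h1] with s hs hsτ
  exact hs ⟨by linarith [hsτ.2], by linarith [hsτ.1]⟩

/-- The operator `1 - T` is injective: on each chord a solution decays exponentially, so that the
boundary condition, used at both ends, bounds its incoming trace by `γ²` times itself. -/
theorem eq_zero_of_mem_streamingGraph [Fact (1 ≤ p)] (hN : 1 ≤ N) (hDo : IsOpen D)
    (hDc : Convex ℝ D) (hDb : Bornology.IsBounded D) (hDs : HasSmoothBoundary D) (hp : p ≠ ⊤)
    (hσ0 : ∀ v, 0 ≤ σ v) (hγ0 : 0 < γ) (hγ1 : γ < 1) {ψ : X 𝕜 p D}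
    (h : (ψ, ψ) ∈ streamingGraph 𝕜 p D (fun z => σ z.2) γ) : ψ = 0 := by
  have hp1 : 1 ≤ p := Fact.out
  obtain ⟨⟨g, hweak, hgψ⟩, hIn, hOut, -, -, ⟨ψ₁, hψ₁, hIn'⟩, ⟨ψ₂, hψ₂, hOut'⟩, hbc⟩ := h
  have hψm : Measurable ψ := (Lp.stronglyMeasurable ψ).measurable
  have hexp := hweak.exists_exp (κ := fun v => 1 + σ v) hN hDo hDc hDb hp1 hp hψm
    (Lp.stronglyMeasurable g).measurable (Lp.memLp ψ) (Lp.memLp g) (by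
      filter_upwards [hgψ] with z hz
      push_cast
      linear_combination hz)
  have hac := chordMeasure_absolutelyContinuous hN hDo hDc hDb hDs
  have hrev := measurePreserving_rev_incoming hDo hDb hDs
  have hturn := (measurePreserving_turn hN hDo hDc hDb).quasiMeasurePreserving
  rw [← hrev.map_eq, measurableEmbedding_rev.ae_map_iff] at hOut'
  have hc : ∀ (v : EuclideanSpace ℝ (Fin N)) (c : 𝕜), Continuous fun s : ℝ =>
      ((Real.exp (-((1 + σ v) * s)) : ℝ) : 𝕜) * c := fun v c =>
    (RCLike.continuous_ofReal.comp (by fun_prop)).mul continuous_const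
  -- the solution on a chord in terms of its incoming trace
  have hchord : ∀ᵐ b ∂chordMeasure D, ∀ᵐ s, s ∈ Ioo 0 (tau D b) →
      ψ (flow s b) = (Real.exp (-((1 + σ b.2) * s)) : 𝕜) * hIn b := by
    filter_upwards [hexp, hac.ae_le hIn', ae_chord_of_ae hN hDo hDc hDb hψ₁,
      ae_isEntrance hN hDo hDc hDb] with b ⟨c, hb1⟩ hb2 hb3 hb
    have h1 : hIn b = c := by
      have h2 : Tendsto (fun s : ℝ => ((Real.exp (-((1 + σ b.2) * s)) : ℝ) : 𝕜) * c) (𝓝[>] 0)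
          (𝓝 c) := by
        simpa using ((hc b.2 c).tendsto 0).mono_left nhdsWithin_le_nhds
      refine tendsto_nhds_unique_of_frequently_eq hb2 h2 (frequently_of_ae hb.tau_pos ?_)
      filter_upwards [hb1, hb3] with s hs1 hs3 hs
      exact (hs3 hs).trans (hs1 hs)
    rw [h1]
    exact hb1
  -- `rev b` is the exit of the chord with entrance `turn D b`
  have hle : ∀ᵐ b ∂chordMeasure D, ‖hIn b‖ ≤ γ * ‖hIn (turn D b)‖ := by
    filter_upwards [hac.ae_le hOut', hac.ae_le hbc, hturn.ae hchord,
      hturn.ae (ae_chord_of_ae hN hDo hDc hDb hψ₂), ae_isEntrance hN hDo hDc hDb]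
      with b hb1 hb2 hb3 hb4 hb
    rw [hb.tau_turn] at hb3 hb4
    have h1 : hOut (rev b)
        = ((Real.exp (-((1 + σ (turn D b).2) * tau D b)) : ℝ) : 𝕜) * hIn (turn D b) := by
      have h2 : Tendsto (fun s : ℝ => ((Real.exp (-((1 + σ (turn D b).2) * (tau D b - s))) : ℝ) : 𝕜)
          * hIn (turn D b)) (𝓝[>] 0)
          (𝓝 (((Real.exp (-((1 + σ (turn D b).2) * tau D b)) : ℝ) : 𝕜) * hIn (turn D b))) := by
        have h3 : Continuous fun s : ℝ => tau D b - s := by fun_prop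
        simpa [Function.comp_def] using (((hc (turn D b).2 (hIn (turn D b))).comp h3).tendsto 0).mono_left
          nhdsWithin_le_nhds
      refine tendsto_nhds_unique_of_frequently_eq hb1 h2 (frequently_of_ae hb.tau_pos ?_)
      filter_upwards [ae_sub_left hb3, ae_sub_left hb4] with s hs3 hs4 hs
      rw [← hs3 hs, ← hs4 hs, ← flow_neg_rev]
      congr 1
      ext1
      · simp [sub_eq_add_neg]
      · rfl
    have h2 : hIn b = (γ : 𝕜) * hOut (rev b) := hb2
    have h3 : 0 ≤ (1 + σ (turn D b).2) * tau D b :=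
      mul_nonneg (by linarith [hσ0 (turn D b).2]) hb.tau_pos.le
    rw [h2, h1, norm_mul, norm_mul, RCLike.norm_ofReal, RCLike.norm_ofReal, abs_of_pos hγ0,
      abs_of_pos (Real.exp_pos _)]
    gcongr
    refine mul_le_of_le_one_left (norm_nonneg _) (Real.exp_le_one_iff.2 (by linarith))
  have hzero : ∀ᵐ b ∂chordMeasure D, hIn b = 0 := by
    filter_upwards [hle, hturn.ae hle, ae_isEntrance hN hDo hDc hDb] with b h1 h2 hb
    rw [hb.turn_turn] at h2
    rw [← norm_le_zero_iff]
    by_contra! hpos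
    have h3 : γ * ‖hIn (turn D b)‖ ≤ γ * (γ * ‖hIn b‖) := by gcongr
    have h4 : γ * (γ * ‖hIn b‖) < ‖hIn b‖ := by
      have h5 : γ * γ < 1 := by nlinarith
      nlinarith
    linarith
  refine (Lp.eq_zero_iff_ae_eq_zero).2
    (ae_of_chord hN hDo hDc hDb (P := fun z => ψ z = 0) (hψm (measurableSet_singleton 0)) ?_)
  filter_upwards [hchord, hzero] with b hb1 hb2
  filter_upwards [hb1] with s hs hsτ
  rw [hs hsτ, hb2, mul_zero]

lemma HasWeakTransport.sub {ψ₁ ψ₂ g₁ g₂ : X 𝕜 p D} (hp1 : 1 ≤ p)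
    (h₁ : HasWeakTransport D ψ₁ g₁) (h₂ : HasWeakTransport D ψ₂ g₂) :
    HasWeakTransport D (ψ₁ - ψ₂ : X 𝕜 p D) (g₁ - g₂ : X 𝕜 p D) := by
  refine HasWeakTransport.congr (ψ := fun z => ψ₁ z - ψ₂ z) (g := fun z => g₁ z - g₂ z) ?_
    (Lp.coeFn_sub _ _) (Lp.coeFn_sub _ _)
  intro φ hφ hφc hφD
  have hi : ∀ (c : Phase N → ℝ), Continuous c → HasCompactSupport c → ∀ f : X 𝕜 p D,
      Integrable (fun z => c z • f z) (phaseMeasure D) := fun c hc hcc f =>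
    ((Lp.memLp f).locallyIntegrable hp1).integrable_smul_left_of_hasCompactSupport hc hcc
  simp only [smul_sub]
  rw [integral_sub (hi _ (continuous_transport hφ) (hasCompactSupport_transport hφc) _)
    (hi _ (continuous_transport hφ) (hasCompactSupport_transport hφc) _),
    integral_sub (hi _ hφ.continuous hφc _) (hi _ hφ.continuous hφc _), h₁ φ hφ hφc hφD,
    h₂ φ hφ hφc hφD]
  ring

lemma HasIncomingTrace.sub {ψ₁ ψ₂ : X 𝕜 p D} {h₁ h₂ : Phase N → 𝕜}
    (H₁ : HasIncomingTrace D ψ₁ h₁) (H₂ : HasIncomingTrace D ψ₂ h₂) :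
    HasIncomingTrace D (ψ₁ - ψ₂ : X 𝕜 p D) (h₁ - h₂) := by
  obtain ⟨u₁, hu₁, H₁⟩ := H₁
  obtain ⟨u₂, hu₂, H₂⟩ := H₂
  refine ⟨u₁ - u₂, (hu₁.sub hu₂).trans (Lp.coeFn_sub ψ₁ ψ₂).symm, ?_⟩
  filter_upwards [H₁, H₂] with z hz₁ hz₂
  exact hz₁.sub hz₂

lemma HasOutgoingTrace.sub {ψ₁ ψ₂ : X 𝕜 p D} {h₁ h₂ : Phase N → 𝕜}
    (H₁ : HasOutgoingTrace D ψ₁ h₁) (H₂ : HasOutgoingTrace D ψ₂ h₂) :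
    HasOutgoingTrace D (ψ₁ - ψ₂ : X 𝕜 p D) (h₁ - h₂) := by
  obtain ⟨u₁, hu₁, H₁⟩ := H₁
  obtain ⟨u₂, hu₂, H₂⟩ := H₂
  refine ⟨u₁ - u₂, (hu₁.sub hu₂).trans (Lp.coeFn_sub ψ₁ ψ₂).symm, ?_⟩
  filter_upwards [H₁, H₂] with z hz₁ hz₂
  exact hz₁.sub hz₂

lemma streamingGraph_sub (hp1 : 1 ≤ p) {S : Phase N → ℝ} {a₁ a₂ : X 𝕜 p D × X 𝕜 p D}
    (h₁ : a₁ ∈ streamingGraph 𝕜 p D S γ) (h₂ : a₂ ∈ streamingGraph 𝕜 p D S γ) :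
    a₁ - a₂ ∈ streamingGraph 𝕜 p D S γ := by
  obtain ⟨⟨g₁, hw₁, hg₁⟩, i₁, o₁, hi₁, ho₁, hti₁, hto₁, hbc₁⟩ := h₁
  obtain ⟨⟨g₂, hw₂, hg₂⟩, i₂, o₂, hi₂, ho₂, hti₂, hto₂, hbc₂⟩ := h₂
  refine ⟨⟨g₁ - g₂, hw₁.sub hp1 hw₂, ?_⟩, i₁ - i₂, o₁ - o₂, hi₁.sub hi₂, ho₁.sub ho₂,
    hti₁.sub hti₂, hto₁.sub hto₂, ?_⟩
  · filter_upwards [hg₁, hg₂, Lp.coeFn_sub a₁.1 a₂.1, Lp.coeFn_sub a₁.2 a₂.2, Lp.coeFn_sub g₁ g₂]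
      with z h1 h2 h3 h4 h5
    rw [Prod.snd_sub, Prod.fst_sub, h3, h4, h5]
    simp only [Pi.sub_apply, h1, h2]
    ring
  · filter_upwards [hbc₁, hbc₂] with z h1 h2
    simp only [Pi.sub_apply, h1, h2]
    ring

/-- A bounded semigroup that is given by the explicit solution has the streaming operator as its
generator: `1 - T` is injective, and the resolvent of the semigroup is a right inverse. -/
theorem generatorGraph_eq_streamingGraph [Fact (1 ≤ p)] (hN : 1 ≤ N) (hDo : IsOpen D)
    (hDc : Convex ℝ D) (hDb : Bornology.IsBounded D) (hDs : HasSmoothBoundary D) (hp : p ≠ ⊤)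
    (hσm : Measurable σ) (hσ0 : ∀ v, 0 ≤ σ v) (hσe : ∀ v, σ (-v) = σ v) (hγ0 : 0 < γ)
    (hγ1 : γ < 1) {U : ℝ≥0 → X 𝕜 p D →L[𝕜] X 𝕜 p D} (hU : IsC0Semigroup U) {M : ℝ}
    (hM : ∀ t, ‖U t‖ ≤ M)
    (hUae : ∀ (t : ℝ≥0) (φ : Phase N → 𝕜) (hφ : MemLp φ p (phaseMeasure D)),
      U t (hφ.toLp φ) =ᵐ[phaseMeasure D] evolve D σ γ t φ) :
    generatorGraph U = streamingGraph 𝕜 p D (fun z => σ z.2) γ := by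
  have hres : ∀ f : X 𝕜 p D,
      (resolvent U f, resolvent U f - f) ∈ streamingGraph 𝕜 p D (fun z => σ z.2) γ := fun f =>
    stationary_mem_streamingGraph hN hDo hDc hDb hDs hp hσm hσ0 hσe hγ0 hγ1 f _
      (resolvent_ae hDo hDb hσm hU hM hUae f)
  ext a
  rw [hU.mem_generatorGraph_iff hM a]
  constructor
  · intro h
    have h1 := hres (a.1 - a.2)
    rwa [h, sub_sub_cancel] at h1
  · intro h
    have h1 := streamingGraph_sub Fact.out (hres (a.1 - a.2)) h
    have h2 : (resolvent U (a.1 - a.2), resolvent U (a.1 - a.2) - (a.1 - a.2)) - a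
        = (resolvent U (a.1 - a.2) - a.1, resolvent U (a.1 - a.2) - a.1) := by
      ext1
      · rfl
      · change resolvent U (a.1 - a.2) - (a.1 - a.2) - a.2 = resolvent U (a.1 - a.2) - a.1
        abel
    rw [h2] at h1
    exact sub_eq_zero.1
      (eq_zero_of_mem_streamingGraph hN hDo hDc hDb hDs hp hσ0 hγ0 hγ1 h1)

end Generator

end BounceBack

end

theorem mainTheorem2 {𝕜 : Type*} [RCLike 𝕜] (N : ℕ) (hN : 1 ≤ N)
    (p : ℝ≥0∞) [Fact (1 ≤ p)] (hp : p ≠ ⊤)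
    (D : Set (EuclideanSpace ℝ (Fin N))) (hDopen : IsOpen D) (hDconv : Convex ℝ D)
    (hDbdd : Bornology.IsBounded D) (hDsmooth : BounceBack.HasSmoothBoundary D)
    (γ : ℝ) (hγ0 : 0 < γ) (hγ1 : γ < 1)
    (σ : EuclideanSpace ℝ (Fin N) → ℝ) (hσmeas : Measurable σ) (hσnonneg : ∀ v, 0 ≤ σ v)
    (hσeven : ∀ v, σ (-v) = σ v) :
    (∃ U : ℝ≥0 → BounceBack.X 𝕜 p D →L[𝕜] BounceBack.X 𝕜 p D,
      BounceBack.IsC0Semigroup U ∧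
        BounceBack.generatorGraph U =
          BounceBack.streamingGraph 𝕜 p D (fun z => σ z.2) γ) ∧
    ∀ U : ℝ≥0 → BounceBack.X 𝕜 p D →L[𝕜] BounceBack.X 𝕜 p D,
      BounceBack.IsC0Semigroup U →
      BounceBack.generatorGraph U = BounceBack.streamingGraph 𝕜 p D (fun z => σ z.2) γ →
      ∀ t : ℝ≥0, ∃ V : ℕ → BounceBack.X 𝕜 p D →L[𝕜] BounceBack.X 𝕜 p D,
        (∀ (n : ℕ) (φ : BounceBack.Phase N → 𝕜) (hφ : MemLp φ p (BounceBack.phaseMeasure D)),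
          V n (hφ.toLp φ) =ᵐ[BounceBack.phaseMeasure D]
            BounceBack.seriesTerm D σ γ (t : ℝ) φ n) ∧
        HasSum V (U t) := by
  obtain ⟨U, hU, hM, hUae, hV⟩ := BounceBack.exists_semigroup (𝕜 := 𝕜) (p := p) hN hDopen hDconv
    hDbdd hp hσmeas hσnonneg hσeven hγ0 hγ1
  have hgen := BounceBack.generatorGraph_eq_streamingGraph hN hDopen hDconv hDbdd hDsmooth hp
    hσmeas hσnonneg hσeven hγ0 hγ1 hU hM hUae
  refine ⟨⟨U, hU, hgen⟩, fun U' hU' hgen' t => ?_⟩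
  rw [hU.eq_of_generatorGraph_eq hM hU' (hgen'.trans hgen.symm)]
  exact hV t
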